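/- **Setting.** An operator space structure on a complex vector space $X$ is a family of norms $\|\cdot\|_n$ on the spaces $\mathbb M_n(X)$ of $n\times n$ matrices over $X$ with $\|x\oplus y\|_{m+n}=\max\{\|x\|_m,\|y\|_n\}$ and $\|\alpha x\beta\|_m\le\|\alpha\|\,\|x\|_m\,\|\beta\|$ for scalar matrices $\alpha,\beta\in\mathbb M_m$ (with the operator norm). A linear map $\varphi\colon X\to Y$ is a complete contraction if all its entrywise amplifications $\mathbb M_n(X)\to\mathbb M_n(Y)$ are contractions, and a completely isometric isomorphism if it is surjective and all of them are isometries. $\mathbf{FdOS}$ is the category of finite-dimensional operator spaces and linear complete contractions. $\mathbb C$ is an operator space via the operator norms on $\mathbb M_n(\mathbb C)$; $\mathrm{CB}(X,Y)$ is the space of all linear maps $X\to Y$ with $\mathbb M_n(\mathrm{CB}(X,Y))\cong \mathrm{CB}(X,M_n(Y))$ normed by the cb-norm $\|\varphi\|_{cb}=\sup_k\|\varphi_k\|$; and $X^*=\mathrm{CB}(X,\mathbb C)$. On the algebraic tensor product $X\otimes Y$ one has three operator space structures: the completely injective tensor $X\check\otimes Y$, induced by $X\otimes Y\cong \mathrm{CB}(Y^*,X)$;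 the completely projective tensor $X\hat\otimes Y$, with $\|v\|_\wedge=\inf\{\|\alpha\|\|x\|\|y\|\|\beta\| : v=\alpha(x\otimes y)\beta,\ x\in M_p(X),\ y\in M_q(Y),\ \alpha\in M_{n,pq},\ \beta\in M_{pq,n}\}$; and the Haagerup tensor $X\otimes_h Y$, with $\|v\|_h=\inf\{\|x\|\|y\| : v=x\odot y,\ x\in M_{n,r}(X),\ y\in M_{r,n}(Y)\}$, where $(x\odot y)_{ij}=\sum_k x_{ik}\otimes y_{kj}$. **Definition.** Let $(\mathbf C,I,\otimes)$ and $(\mathbf C,J,\triangleleft)$ be two monoidal structures on a category. $(J,\triangleleft)$ is *normal duoidal* to $(I,\otimes)$ if there are a natural transformation (the weak interchange) $w\colon (A\triangleleft B)\otimes(C\triangleleft D)\to(A\otimes C)\triangleleft(B\otimes D)$, an isomorphism $i\colon I\cong J$ and morphisms $\delta\colon I\to I\triangleleft I$, $\mu\colon J\otimes J\to J$ such that $w$ is compatible with the associators of $\otimes$ and of $\triangleleft$; $w$ and $\delta$ are compatible with the left and right unitors of $\otimes$; $w$ and $\mu$ are compatible with the left and right unitors of $\triangleleft$; $(I,\delta,i)$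 is a comonoid for $\triangleleft$; and $(J,\mu,i)$ is a monoid for $\otimes$. A *BV-category with negation* is a $*$-autonomous category $(\mathbf C,I,\otimes,\multimap)$ (symmetric monoidal closed, with an object $\bot$ such that $A\to(A\multimap\bot)\multimap\bot$ is always an isomorphism) with a second monoidal structure $(J,\triangleleft)$ that is normal duoidal to $(I,\otimes)$ and whose interchange $w$ commutes with the symmetry of $\otimes$. **Proposition.** The category $\mathbf{FdOS}$ is a BV-category with negation with respect to $(\mathbf{FdOS},\mathbb C,\hat\otimes,\mathrm{CB}(-,-))$, with dualizing object $\mathbb C$, and $(\mathbf{FdOS},\mathbb C,\otimes_h)$. Here tensor products of morphisms, associators, unitors, the symmetry of $\hat\otimes$, evaluation and currying are those of vector spaces, $i$ is the identity of $\mathbb C$, and the weak interchange is the shuffle map $$w\colon (A\otimes_h B)\hat\otimes(C\otimes_h D)\to(A\hat\otimes C)\otimes_h(B\hat\otimes D),\qquad (a\otimes b)\otimes(c\otimes d)\mapsto(a\otimes c)\otimes(b\otimes d).$$ The same permutation is also a complete contraction $$v\colon (A\check\otimes B)\otimes_h(C\check\otimes D)\to(A\otimes_h C)\check\otimes(B\otimes_h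 D),$$ where $\check\otimes$ is the par of the $*$-autonomous structure: $a\otimes b\mapsto(\varphi\mapsto\varphi(a)b)$ is a completely isometric isomorphism $A\check\otimes B\cong\mathrm{CB}(A^*,B)$. -/

import Mathlib

open CategoryTheory
open scoped TensorProduct Matrix.Norms.L2Operator

set_option linter.unusedSectionVars false
set_option linter.unusedVariables false

namespace MatrixSpace

variable {ι κ ρ σ ι' κ' : Type*} [Fintype ι] [Fintype κ] [Fintype ρ] [Fintype σ]
  [Fintype ι'] [Fintype κ'] [DecidableEq ι] [DecidableEq κ] [DecidableEq ρ] [DecidableEq σ]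
  [DecidableEq ι'] [DecidableEq κ']

/-! Facts on the operator norm of scalar matrices. -/

lemma opNorm_le_of_mulVec (A : Matrix ι κ ℂ) (K : ℝ) (hK : 0 ≤ K)
    (h : ∀ ξ : EuclideanSpace ℂ κ, ‖WithLp.toLp 2 (A.mulVec ξ.ofLp)‖ ≤ K * ‖ξ‖) : ‖A‖ ≤ K := by
  rw [Matrix.l2_opNorm_def]
  exact ContinuousLinearMap.opNorm_le_bound _ hK h

/-- The 0-1 matrix of a map of index sets. -/
def incl (f : ι → κ) : Matrix κ ι ℂ := Matrix.of fun k i => if k = f i then 1 else 0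

lemma opNorm_one_le : ‖(1 : Matrix ι ι ℂ)‖ ≤ 1 := by
  rw [← Matrix.diagonal_one, Matrix.l2_opNorm_diagonal]
  exact (pi_norm_le_iff_of_nonneg zero_le_one).2 fun i => by simp

lemma opNorm_le_one_of (A : Matrix ι κ ℂ) (h : A.conjTranspose * A = 1) : ‖A‖ ≤ 1 := by
  have h1 := Matrix.l2_opNorm_conjTranspose_mul_self A
  rw [h] at h1
  have := opNorm_one_le (ι := κ)
  nlinarith [norm_nonneg A]

lemma opNorm_incl {f : ι → κ} (hf : Function.Injective f) : ‖incl f‖ ≤ 1 := by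
  apply opNorm_le_one_of
  ext i j
  simp [Matrix.mul_apply, incl, Matrix.one_apply, hf.eq_iff]
  by_cases h : i = j <;> simp [h, Ne.symm]

lemma opNorm_transpose_incl {f : ι → κ} (hf : Function.Injective f) :
    ‖(incl f).transpose‖ ≤ 1 := by
  have : (incl f).transpose = (incl f).conjTranspose := by
    ext i j; simp only [Matrix.transpose_apply, Matrix.conjTranspose_apply, incl, Matrix.of_apply]; split_ifs <;> simp
  rw [this, Matrix.l2_opNorm_conjTranspose]
  exact opNorm_incl hf

lemma opNorm_fromBlocks (A : Matrix ι κ ℂ) (B : Matrix ρ σ ℂ) :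
    ‖Matrix.fromBlocks A 0 0 B‖ ≤ max ‖A‖ ‖B‖ := by
  refine opNorm_le_of_mulVec _ _ (le_max_of_le_left (norm_nonneg _)) fun ξ => ?_
  set a : EuclideanSpace ℂ κ := WithLp.toLp 2 (fun i => ξ (Sum.inl i))
  set b : EuclideanSpace ℂ σ := WithLp.toLp 2 (fun i => ξ (Sum.inr i))
  have ha := Matrix.l2_opNorm_mulVec A a
  have hb := Matrix.l2_opNorm_mulVec B b
  have e1 : ‖ξ‖ ^ 2 = ‖a‖ ^ 2 + ‖b‖ ^ 2 := by
    simp [EuclideanSpace.norm_sq_eq, a, b]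
  have e2 : ‖WithLp.toLp 2 ((Matrix.fromBlocks A 0 0 B).mulVec ξ.ofLp)‖ ^ 2 =
      ‖(WithLp.toLp 2 (A.mulVec a.ofLp) : EuclideanSpace ℂ ι)‖ ^ 2 +
      ‖(WithLp.toLp 2 (B.mulVec b.ofLp) : EuclideanSpace ℂ ρ)‖ ^ 2 := by
    simp [EuclideanSpace.norm_sq_eq, Matrix.fromBlocks_mulVec, a, b, Function.comp_def]
  set M := max ‖A‖ ‖B‖
  have hM : 0 ≤ M := le_max_of_le_left (norm_nonneg _)
  have ha' := ha.trans (mul_le_mul_of_nonneg_right (le_max_left ‖A‖ ‖B‖) (norm_nonneg a))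
  have hb' := hb.trans (mul_le_mul_of_nonneg_right (le_max_right ‖A‖ ‖B‖) (norm_nonneg b))
  refine le_of_sq_le_sq ?_ (by positivity)
  rw [e2, mul_pow, e1, mul_add, ← mul_pow, ← mul_pow]
  exact add_le_add (pow_le_pow_left₀ (norm_nonneg _) ha' 2)
    (pow_le_pow_left₀ (norm_nonneg _) hb' 2)

lemma opNorm_kronecker_one (A : Matrix ι κ ℂ) :
    ‖(Matrix.kroneckerMap (· * ·) A (1 : Matrix ρ ρ ℂ))‖ ≤ ‖A‖ := by
  refine opNorm_le_of_mulVec _ _ (norm_nonneg _) fun ξ => ?_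
  set a : ρ → EuclideanSpace ℂ κ := fun r => WithLp.toLp 2 (fun i => ξ (i, r))
  have e1 : ‖ξ‖ ^ 2 = ∑ r, ‖a r‖ ^ 2 := by
    simp only [EuclideanSpace.norm_sq_eq, a, Fintype.sum_prod_type]
    rw [Finset.sum_comm]
  refine le_of_sq_le_sq ?_ (by positivity)
  rw [mul_pow, e1, Finset.mul_sum, EuclideanSpace.norm_sq_eq, Fintype.sum_prod_type,
    Finset.sum_comm]
  refine Finset.sum_le_sum fun r _ => ?_
  have h := pow_le_pow_left₀ (norm_nonneg (WithLp.toLp 2 (A.mulVec (a r).ofLp) : EuclideanSpace ℂ ι))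
    (Matrix.l2_opNorm_mulVec A (a r)) 2
  rw [mul_pow] at h
  refine le_trans (le_of_eq ?_) h
  rw [EuclideanSpace.norm_sq_eq]
  refine Finset.sum_congr rfl fun i _ => ?_
  simp [Matrix.mulVec, dotProduct, Fintype.sum_prod_type, Matrix.one_apply, a]

lemma opNorm_kronecker (A : Matrix ι κ ℂ) (B : Matrix ρ σ ℂ) :
    ‖(Matrix.kroneckerMap (· * ·) A B)‖ ≤ ‖A‖ * ‖B‖ := by
  have e : (Matrix.kroneckerMap (· * ·) A B) =
      (Matrix.kroneckerMap (· * ·) A (1 : Matrix ρ ρ ℂ)) *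
      (incl (Prod.swap : ρ × κ → κ × ρ) *
      (Matrix.kroneckerMap (· * ·) B (1 : Matrix κ κ ℂ)) *
      (incl (Prod.swap : σ × κ → κ × σ)).transpose) := by
    ext ⟨i, r⟩ ⟨k, s⟩
    simp [Matrix.mul_apply, incl, Fintype.sum_prod_type, Matrix.one_apply, Prod.ext_iff,
      ite_and, Finset.sum_ite_eq]
  rw [e]
  refine (Matrix.l2_opNorm_mul _ _).trans ?_
  refine mul_le_mul (opNorm_kronecker_one A) ?_ (norm_nonneg _) (norm_nonneg _)
  refine (Matrix.l2_opNorm_mul _ _).trans ?_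
  refine (mul_le_mul_of_nonneg_left (opNorm_transpose_incl Prod.swap_injective)
    (norm_nonneg _)).trans ?_
  rw [mul_one]
  refine (Matrix.l2_opNorm_mul _ _).trans ?_
  refine (mul_le_mul (opNorm_incl Prod.swap_injective) (opNorm_kronecker_one B)
    (norm_nonneg _) zero_le_one).trans ?_
  rw [one_mul]

lemma opNorm_fromCols (A : Matrix ι κ ℂ) (B : Matrix ι σ ℂ) :
    ‖Matrix.fromCols A B‖ ^ 2 ≤ ‖A‖ ^ 2 + ‖B‖ ^ 2 := by
  have h := Matrix.l2_opNorm_conjTranspose_mul_self (Matrix.fromCols A B).conjTranspose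
  have hA := Matrix.l2_opNorm_conjTranspose_mul_self A.conjTranspose
  have hB := Matrix.l2_opNorm_conjTranspose_mul_self B.conjTranspose
  rw [Matrix.l2_opNorm_conjTranspose, Matrix.conjTranspose_conjTranspose] at h hA hB
  rw [Matrix.conjTranspose_fromCols_eq_fromRows_conjTranspose, Matrix.fromCols_mul_fromRows] at h
  rw [sq, sq, sq, ← h, ← hA, ← hB]
  exact norm_add_le _ _

lemma opNorm_fromRows (A : Matrix ι κ ℂ) (B : Matrix ρ κ ℂ) :
    ‖Matrix.fromRows A B‖ ^ 2 ≤ ‖A‖ ^ 2 + ‖B‖ ^ 2 := by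
  have h := opNorm_fromCols A.conjTranspose B.conjTranspose
  rwa [← Matrix.conjTranspose_fromRows_eq_fromCols_conjTranspose,
    Matrix.l2_opNorm_conjTranspose, Matrix.l2_opNorm_conjTranspose,
    Matrix.l2_opNorm_conjTranspose] at h

end MatrixSpace

namespace MatrixSpace

variable {ι κ ρ σ ι' κ' : Type*} [Fintype ι] [Fintype κ] [Fintype ρ] [Fintype σ]
  [Fintype ι'] [Fintype κ'] [DecidableEq ι] [DecidableEq κ] [DecidableEq ρ] [DecidableEq σ]
  [DecidableEq ι'] [DecidableEq κ']
variable {X Y : Type*} [AddCommGroup X] [Module ℂ X] [AddCommGroup Y] [Module ℂ Y]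

/-- The product `α x` of a scalar matrix and a matrix with entries in `X`. -/
def lmul (α : Matrix ι κ ℂ) (x : Matrix κ ρ X) : Matrix ι ρ X :=
  Matrix.of fun i j => ∑ k, α i k • x k j

/-- The product `x β` of a matrix with entries in `X` and a scalar matrix. -/
def rmul (x : Matrix ι κ X) (β : Matrix κ ρ ℂ) : Matrix ι ρ X :=
  Matrix.of fun i j => ∑ k, β k j • x i k

/-- The direct sum `x ⊕ y`, a block diagonal matrix. -/
def dsum {m n : ℕ} (x : Matrix (Fin m) (Fin m) X) (y : Matrix (Fin n) (Fin n) X) :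
    Matrix (Fin (m + n)) (Fin (m + n)) X :=
  (Matrix.fromBlocks x 0 0 y).submatrix finSumFinEquiv.symm finSumFinEquiv.symm

/-- The matrix `x` in the upper left corner of an `N × N` matrix. -/
def pad {m n : ℕ} (N : ℕ) (x : Matrix (Fin m) (Fin n) X) : Matrix (Fin N) (Fin N) X :=
  Matrix.of fun i j => if h : i.val < m ∧ j.val < n then x ⟨i, h.1⟩ ⟨j, h.2⟩ else 0

/-- The identification of `X` with `M_1(X)`. -/
def sing (x : X) : Matrix (Fin 1) (Fin 1) X := Matrix.of fun _ _ => x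

lemma lmul_lmul (α : Matrix ι κ ℂ) (β : Matrix κ ρ ℂ) (x : Matrix ρ σ X) :
    lmul α (lmul β x) = lmul (α * β) x := by
  ext i j
  simp only [lmul, Matrix.of_apply, Matrix.mul_apply, Finset.smul_sum, Finset.sum_smul, smul_smul]
  rw [Finset.sum_comm]

lemma rmul_rmul (x : Matrix ι κ X) (α : Matrix κ ρ ℂ) (β : Matrix ρ σ ℂ) :
    rmul (rmul x α) β = rmul x (α * β) := by
  ext i j
  simp only [rmul, Matrix.of_apply, Matrix.mul_apply, Finset.smul_sum, Finset.sum_smul, smul_smul]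
  rw [Finset.sum_comm]
  simp only [mul_comm]

lemma lmul_rmul (α : Matrix ι κ ℂ) (x : Matrix κ ρ X) (β : Matrix ρ σ ℂ) :
    lmul α (rmul x β) = rmul (lmul α x) β := by
  ext i j
  simp only [lmul, rmul, Matrix.of_apply, Finset.smul_sum, smul_smul]
  rw [Finset.sum_comm]
  simp only [mul_comm]

lemma lmul_one (x : Matrix ι κ X) : lmul 1 x = x := by
  ext i j; simp [lmul, Matrix.one_apply]

lemma rmul_one (x : Matrix ι κ X) : rmul x 1 = x := by
  ext i j; simp [rmul, Matrix.one_apply]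

lemma lmul_smul_one (c : ℂ) (x : Matrix ι κ X) : lmul (c • 1) x = c • x := by
  ext i j; simp [lmul, Matrix.one_apply, mul_ite]

lemma lmul_smul (α : Matrix ι κ ℂ) (c : ℂ) (x : Matrix κ ρ X) : lmul α (c • x) = c • lmul α x := by
  ext i j; simp [lmul, Finset.smul_sum, smul_smul, mul_comm]

lemma rmul_smul (x : Matrix ι κ X) (c : ℂ) (β : Matrix κ ρ ℂ) : rmul (c • x) β = c • rmul x β := by
  ext i j; simp [rmul, Finset.smul_sum, smul_smul, mul_comm]

lemma smul_lmul (α : Matrix ι κ ℂ) (c : ℂ) (x : Matrix κ ρ X) : lmul (c • α) x = c • lmul α x := by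
  ext i j; simp [lmul, Finset.smul_sum, smul_smul]

lemma smul_rmul (x : Matrix ι κ X) (c : ℂ) (β : Matrix κ ρ ℂ) : rmul x (c • β) = c • rmul x β := by
  ext i j; simp [rmul, Finset.smul_sum, smul_smul]

lemma lmul_add (α : Matrix ι κ ℂ) (x y : Matrix κ ρ X) : lmul α (x + y) = lmul α x + lmul α y := by
  ext i j; simp [lmul, Finset.sum_add_distrib]

lemma rmul_add (x y : Matrix ι κ X) (β : Matrix κ ρ ℂ) : rmul (x + y) β = rmul x β + rmul y β := by
  ext i j; simp [rmul, Finset.sum_add_distrib]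

lemma lmul_zero (α : Matrix ι κ ℂ) : lmul α (0 : Matrix κ ρ X) = 0 := by
  ext i j; simp [lmul]

lemma rmul_zero (β : Matrix κ ρ ℂ) : rmul (0 : Matrix ι κ X) β = 0 := by
  ext i j; simp [rmul]

lemma map_lmul (φ : X →ₗ[ℂ] Y) (α : Matrix ι κ ℂ) (x : Matrix κ ρ X) :
    (lmul α x).map φ = lmul α (x.map φ) := by
  ext i j; simp [lmul]

lemma map_rmul (φ : X →ₗ[ℂ] Y) (x : Matrix ι κ X) (β : Matrix κ ρ ℂ) :
    (rmul x β).map φ = rmul (x.map φ) β := by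
  ext i j; simp [rmul]

lemma submatrix_eq (f : ι → κ) (g : ρ → σ) (x : Matrix κ σ X) :
    x.submatrix f g = lmul (incl f).transpose (rmul x (incl g)) := by
  ext i j
  simp [lmul, rmul, incl]

lemma incl_transpose_mul {f : ι → κ} (hf : Function.Injective f) :
    (incl f).transpose * incl f = 1 := by
  ext i j
  by_cases h : i = j
  · subst h; simp [Matrix.mul_apply, incl]
  · have : ¬ (f j = f i) := fun h' => h (hf h').symm
    simp [Matrix.mul_apply, incl , h, this]

lemma incl_mul (f : ι → κ) (g : κ → ρ) : incl g * incl f = incl (g ∘ f) := by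
  ext i j
  simp [Matrix.mul_apply, incl]

lemma incl_symm_transpose (e : ι ≃ κ) : (incl e.symm).transpose = incl e := by
  ext i j
  simp only [Matrix.transpose_apply, incl, Matrix.of_apply, Equiv.eq_symm_apply, eq_comm]

lemma pad_eq {m n N : ℕ} (hm : m ≤ N) (hn : n ≤ N) (x : Matrix (Fin m) (Fin n) X) :
    pad N x = lmul (incl (Fin.castLE hm)) (rmul x (incl (Fin.castLE hn)).transpose) := by
  ext i j
  simp only [pad, lmul, rmul, incl, Matrix.of_apply, Matrix.transpose_apply, ite_smul, one_smul, zero_smul]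
  by_cases h : i.val < m ∧ j.val < n
  · rw [dif_pos h, Finset.sum_eq_single ⟨i, h.1⟩, if_pos (by ext; rfl),
      Finset.sum_eq_single ⟨j, h.2⟩, if_pos (by ext; rfl)]
    · intro b _ hb; rw [if_neg]; rintro rfl; exact hb rfl
    · simp
    · intro b _ hb; rw [if_neg]; rintro rfl; exact hb rfl
    · simp
  · rw [dif_neg h, eq_comm]
    refine Finset.sum_eq_zero fun k _ => ?_
    split_ifs with h1
    · refine Finset.sum_eq_zero fun l _ => ?_
      rw [if_neg]
      intro h2
      exact h ⟨by rw [h1]; exact k.2, by rw [h2]; exact l.2⟩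
    · rfl

end MatrixSpace

open MatrixSpace

/-- An operator space structure on a complex vector space `X`: a norm on each space
`M_n(X)` of `n × n` matrices, subject to (M1) and (M2). In finite dimension the ground norm is
automatically complete. -/
@[ext]
structure OperatorSpaceStructure (X : Type*) [AddCommGroup X] [Module ℂ X] where
  norm : ∀ n : ℕ, Matrix (Fin n) (Fin n) X → ℝ
  norm_add_le : ∀ {n : ℕ} (x y : Matrix (Fin n) (Fin n) X), norm n (x + y) ≤ norm n x + norm n y
  norm_smul : ∀ {n : ℕ} (c : ℂ) (x : Matrix (Fin n) (Fin n) X), norm n (c • x) = ‖c‖ * norm n x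
  eq_zero_of_norm_eq_zero : ∀ {n : ℕ} (x : Matrix (Fin n) (Fin n) X), norm n x = 0 → x = 0
  norm_dsum : ∀ {m n : ℕ} (x : Matrix (Fin m) (Fin m) X) (y : Matrix (Fin n) (Fin n) X),
    norm (m + n) (dsum x y) = max (norm m x) (norm n y)
  norm_mul_le : ∀ {m : ℕ} (α : Matrix (Fin m) (Fin m) ℂ) (x : Matrix (Fin m) (Fin m) X)
    (β : Matrix (Fin m) (Fin m) ℂ), norm m (lmul α (rmul x β)) ≤ ‖α‖ * norm m x * ‖β‖

namespace OperatorSpaceStructure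

section norms

variable {X : Type*} [AddCommGroup X] [Module ℂ X] (s : OperatorSpaceStructure X)

/-- The norm of a rectangular matrix over `X`, padded with zeros to a square matrix of size
`max m n`. -/
def rnorm {m n : ℕ} (x : Matrix (Fin m) (Fin n) X) : ℝ :=
  s.norm (max m n) (pad (max m n) x)

lemma norm_zero (n : ℕ) : s.norm n 0 = 0 := by
  have := s.norm_smul (0 : ℂ) (0 : Matrix (Fin n) (Fin n) X)
  simpa using this

lemma norm_nonneg {n : ℕ} (x : Matrix (Fin n) (Fin n) X) : 0 ≤ s.norm n x := by
  have h := s.norm_add_le x ((-1 : ℂ) • x)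
  rw [s.norm_smul] at h
  simp only [neg_smul, one_smul, add_neg_cancel, s.norm_zero, norm_neg, norm_one, one_mul] at h
  linarith

/-- Compression by rectangular scalar matrices. -/
lemma norm_compress {m p : ℕ} (α : Matrix (Fin m) (Fin p) ℂ) (x : Matrix (Fin p) (Fin p) X)
    (β : Matrix (Fin p) (Fin m) ℂ) : s.norm m (lmul α (rmul x β)) ≤ ‖α‖ * s.norm p x * ‖β‖ := by
  let jl : Fin m → Fin (m + p) := Fin.castAdd p
  let jr : Fin p → Fin (m + p) := Fin.natAdd m
  have hl : Function.Injective jl := Fin.castAdd_injective m p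
  have hr : Function.Injective jr := Fin.natAdd_injective p m
  have e1 : dsum (lmul α (rmul x β)) (0 : Matrix (Fin p) (Fin p) X) =
      lmul (incl jl * α * (incl jr).transpose)
        (rmul (dsum (0 : Matrix (Fin m) (Fin m) X) x) (incl jr * β * (incl jl).transpose)) := by
    have h0 : x = lmul (incl jr).transpose
        (rmul (dsum (0 : Matrix (Fin m) (Fin m) X) x) (incl jr)) := by
      rw [← submatrix_eq]; ext i j; simp [dsum, jr]
    have h1 : lmul (incl jl * α * (incl jr).transpose)
        (rmul (dsum (0 : Matrix (Fin m) (Fin m) X) x) (incl jr * β * (incl jl).transpose)) =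
        lmul (incl jl) (rmul (lmul α (rmul x β)) (incl jl).transpose) := by
      conv_rhs => rw [h0]
      simp only [← lmul_rmul, rmul_rmul, lmul_lmul, Matrix.mul_assoc]
    rw [h1]
    generalize lmul α (rmul x β) = y
    ext i j
    refine Fin.addCases (fun i => ?_) (fun i => ?_) i <;>
    refine Fin.addCases (fun j => ?_) (fun j => ?_) j
    · simp [dsum, lmul, rmul, incl, jl]
    · have : ∀ k : Fin m, ¬ (Fin.natAdd m j = Fin.castAdd p k) := fun k h => by
        have := congrArg Fin.val h; simp at this; omega
      simp [dsum, lmul, rmul, incl, jl, this]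
    · have : ∀ k : Fin m, ¬ (Fin.natAdd m i = Fin.castAdd p k) := fun k h => by
        have := congrArg Fin.val h; simp at this; omega
      simp [dsum, lmul, rmul, incl, jl, this]
    · have : ∀ k : Fin m, ¬ (Fin.natAdd m i = Fin.castAdd p k) := fun k h => by
        have := congrArg Fin.val h; simp at this; omega
      simp [dsum, lmul, rmul, incl, jl, this]
  have e2 := s.norm_dsum (lmul α (rmul x β)) (0 : Matrix (Fin p) (Fin p) X)
  rw [e1, s.norm_zero, max_eq_left (s.norm_nonneg _)] at e2
  have e3 := s.norm_dsum (0 : Matrix (Fin m) (Fin m) X) x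
  rw [s.norm_zero, max_eq_right (s.norm_nonneg _)] at e3
  rw [← e2]
  refine (s.norm_mul_le _ _ _).trans ?_
  rw [e3]
  have hα : ‖incl jl * α * (incl jr).transpose‖ ≤ ‖α‖ := by
    refine (Matrix.l2_opNorm_mul _ _).trans ?_
    refine (mul_le_of_le_one_right (_root_.norm_nonneg _) (opNorm_transpose_incl hr)).trans ?_
    refine (Matrix.l2_opNorm_mul _ _).trans ?_
    exact mul_le_of_le_one_left (_root_.norm_nonneg _) (opNorm_incl hl)
  have hβ : ‖incl jr * β * (incl jl).transpose‖ ≤ ‖β‖ := by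
    refine (Matrix.l2_opNorm_mul _ _).trans ?_
    refine (mul_le_of_le_one_right (_root_.norm_nonneg _) (opNorm_transpose_incl hl)).trans ?_
    refine (Matrix.l2_opNorm_mul _ _).trans ?_
    exact mul_le_of_le_one_left (_root_.norm_nonneg _) (opNorm_incl hr)
  have := s.norm_nonneg x
  gcongr

/-- The norm of a matrix with arbitrary finite index sets. -/
noncomputable def gnorm {ι κ : Type*} [Fintype ι] [Fintype κ] (x : Matrix ι κ X) : ℝ :=
  s.rnorm (x.submatrix (Fintype.equivFin ι).symm (Fintype.equivFin κ).symm)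

variable {ι κ ρ σ ι' κ' : Type*} [Fintype ι] [Fintype κ] [Fintype ρ] [Fintype σ]
  [Fintype ι'] [Fintype κ'] [DecidableEq ι] [DecidableEq κ] [DecidableEq ρ] [DecidableEq σ]
  [DecidableEq ι'] [DecidableEq κ']

lemma gnorm_eq (x : Matrix ι κ X) : ∃ (N : ℕ) (f : ι → Fin N) (g : κ → Fin N),
    Function.Injective f ∧ Function.Injective g ∧
    s.gnorm x = s.norm N (lmul (incl f) (rmul x (incl g).transpose)) := by
  refine ⟨max (Fintype.card ι) (Fintype.card κ),
    Fin.castLE (le_max_left _ _) ∘ Fintype.equivFin ι,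
    Fin.castLE (le_max_right _ _) ∘ Fintype.equivFin κ,
    (Fin.castLE_injective _).comp (Equiv.injective _),
    (Fin.castLE_injective _).comp (Equiv.injective _), ?_⟩
  unfold gnorm rnorm
  congr 1
  rw [pad_eq (le_max_left _ _) (le_max_right _ _), submatrix_eq]
  simp only [← lmul_rmul, rmul_rmul, lmul_lmul]
  rw [incl_symm_transpose, incl_mul, ← Matrix.transpose_transpose (incl (Fintype.equivFin κ).symm),
    ← Matrix.transpose_mul, incl_symm_transpose, incl_mul]

lemma gnorm_mul_le (α : Matrix ι κ ℂ) (x : Matrix κ ρ X) (β : Matrix ρ σ ℂ) :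
    s.gnorm (lmul α (rmul x β)) ≤ ‖α‖ * s.gnorm x * ‖β‖ := by
  obtain ⟨M, f, g, hf, hg, h1⟩ := s.gnorm_eq (lmul α (rmul x β))
  obtain ⟨N, f', g', hf', hg', h2⟩ := s.gnorm_eq x
  rw [h1, h2]
  set z := lmul (incl f') (rmul x (incl g').transpose)
  have hz : x = lmul (incl f').transpose (rmul z (incl g')) := by
    simp only [z, ← lmul_rmul, rmul_rmul, lmul_lmul, incl_transpose_mul hf', incl_transpose_mul hg',
      lmul_one, rmul_one]
  have : lmul (incl f) (rmul (lmul α (rmul x β)) (incl g).transpose) =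
      lmul (incl f * α * (incl f').transpose) (rmul z (incl g' * β * (incl g).transpose)) := by
    conv_lhs => rw [hz]
    simp only [← lmul_rmul, rmul_rmul, lmul_lmul, Matrix.mul_assoc]
  rw [this]
  refine (s.norm_compress _ _ _).trans ?_
  have hα : ‖incl f * α * (incl f').transpose‖ ≤ ‖α‖ := by
    refine (Matrix.l2_opNorm_mul _ _).trans ?_
    refine (mul_le_of_le_one_right (_root_.norm_nonneg _) (opNorm_transpose_incl hf')).trans ?_
    refine (Matrix.l2_opNorm_mul _ _).trans ?_
    exact mul_le_of_le_one_left (_root_.norm_nonneg _) (opNorm_incl hf)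
  have hβ : ‖incl g' * β * (incl g).transpose‖ ≤ ‖β‖ := by
    refine (Matrix.l2_opNorm_mul _ _).trans ?_
    refine (mul_le_of_le_one_right (_root_.norm_nonneg _) (opNorm_transpose_incl hg)).trans ?_
    refine (Matrix.l2_opNorm_mul _ _).trans ?_
    exact mul_le_of_le_one_left (_root_.norm_nonneg _) (opNorm_incl hg')
  have := s.norm_nonneg z
  gcongr

end norms
end OperatorSpaceStructure

namespace OperatorSpaceStructure

section norms2

variable {X : Type*} [AddCommGroup X] [Module ℂ X] (s : OperatorSpaceStructure X)
variable {ι κ ρ σ ι' κ' : Type*} [Fintype ι] [Fintype κ] [Fintype ρ] [Fintype σ]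
  [Fintype ι'] [Fintype κ'] [DecidableEq ι] [DecidableEq κ] [DecidableEq ρ] [DecidableEq σ]
  [DecidableEq ι'] [DecidableEq κ']

lemma gnorm_fin {n : ℕ} (x : Matrix (Fin n) (Fin n) X) : s.gnorm x = s.norm n x := by
  obtain ⟨N, f, g, hf, hg, h1⟩ := s.gnorm_eq x
  rw [h1]
  apply le_antisymm
  · refine (s.norm_compress _ _ _).trans ?_
    have := opNorm_incl hf
    have := opNorm_transpose_incl hg
    have := s.norm_nonneg x
    calc _ ≤ 1 * s.norm n x * 1 := by gcongr
      _ = _ := by ring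
  · have hz : x = lmul (incl f).transpose
        (rmul (lmul (incl f) (rmul x (incl g).transpose)) (incl g)) := by
      simp only [← lmul_rmul, rmul_rmul, lmul_lmul, incl_transpose_mul hf, incl_transpose_mul hg,
        lmul_one, rmul_one]
    conv_lhs => rw [hz]
    refine (s.norm_compress _ _ _).trans ?_
    have := opNorm_incl hg
    have := opNorm_transpose_incl hf
    have := s.norm_nonneg (lmul (incl f) (rmul x (incl g).transpose))
    calc _ ≤ 1 * s.norm N (lmul (incl f) (rmul x (incl g).transpose)) * 1 := by gcongr
      _ = _ := by ring

lemma gnorm_nonneg (x : Matrix ι κ X) : 0 ≤ s.gnorm x := s.norm_nonneg _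

lemma gnorm_add_le (x y : Matrix ι κ X) : s.gnorm (x + y) ≤ s.gnorm x + s.gnorm y := by
  unfold gnorm rnorm
  refine le_trans (le_of_eq ?_) (s.norm_add_le _ _)
  congr 1
  rw [pad_eq (le_max_left _ _) (le_max_right _ _), pad_eq (le_max_left _ _) (le_max_right _ _),
    pad_eq (le_max_left _ _) (le_max_right _ _), ← lmul_add, ← rmul_add]
  rfl

lemma gnorm_smul (c : ℂ) (x : Matrix ι κ X) : s.gnorm (c • x) = ‖c‖ * s.gnorm x := by
  unfold gnorm rnorm
  rw [← s.norm_smul]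
  congr 1
  rw [pad_eq (le_max_left _ _) (le_max_right _ _), pad_eq (le_max_left _ _) (le_max_right _ _),
    ← lmul_smul, ← rmul_smul]
  rfl

lemma gnorm_zero : s.gnorm (0 : Matrix ι κ X) = 0 := by
  have := s.gnorm_smul (0 : ℂ) (0 : Matrix ι κ X)
  simpa using this

lemma eq_zero_of_gnorm (x : Matrix ι κ X) (h : s.gnorm x = 0) : x = 0 := by
  obtain ⟨N, f, g, hf, hg, h1⟩ := s.gnorm_eq x
  have hz : x = lmul (incl f).transpose
      (rmul (lmul (incl f) (rmul x (incl g).transpose)) (incl g)) := by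
    simp only [← lmul_rmul, rmul_rmul, lmul_lmul, incl_transpose_mul hf, incl_transpose_mul hg,
      lmul_one, rmul_one]
  rw [hz, s.eq_zero_of_norm_eq_zero _ (h1.symm.trans h), rmul_zero, lmul_zero]

lemma gnorm_sum_le {τ : Type*} (t : Finset τ) (x : τ → Matrix ι κ X) :
    s.gnorm (∑ a ∈ t, x a) ≤ ∑ a ∈ t, s.gnorm (x a) := by
  classical
  induction t using Finset.induction_on with
  | empty => simp [s.gnorm_zero]
  | insert a t ha ih =>
    rw [Finset.sum_insert ha, Finset.sum_insert ha]
    exact (s.gnorm_add_le _ _).trans (add_le_add le_rfl ih)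

lemma gnorm_lmul_le (α : Matrix ι κ ℂ) (x : Matrix κ ρ X) :
    s.gnorm (lmul α x) ≤ ‖α‖ * s.gnorm x := by
  have h := s.gnorm_mul_le α x (1 : Matrix ρ ρ ℂ)
  rw [rmul_one] at h
  exact h.trans (mul_le_of_le_one_right (mul_nonneg (_root_.norm_nonneg _) (s.gnorm_nonneg _))
    opNorm_one_le)

lemma gnorm_rmul_le (x : Matrix ι κ X) (β : Matrix κ ρ ℂ) :
    s.gnorm (rmul x β) ≤ s.gnorm x * ‖β‖ := by
  have h := s.gnorm_mul_le (1 : Matrix ι ι ℂ) x β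
  rw [lmul_one] at h
  refine h.trans (mul_le_mul_of_nonneg_right ?_ (_root_.norm_nonneg _))
  exact mul_le_of_le_one_left (s.gnorm_nonneg _) opNorm_one_le

lemma gnorm_submatrix_le {f : ι → κ} {g : ρ → σ} (hf : Function.Injective f)
    (hg : Function.Injective g) (x : Matrix κ σ X) : s.gnorm (x.submatrix f g) ≤ s.gnorm x := by
  rw [submatrix_eq]
  refine (s.gnorm_mul_le _ _ _).trans ?_
  have := opNorm_incl hg
  have := opNorm_transpose_incl hf
  have := s.gnorm_nonneg x
  calc _ ≤ 1 * s.gnorm x * 1 := by gcongr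
    _ = _ := by ring

lemma gnorm_submatrix_equiv (e : ι ≃ κ) (f : ρ ≃ σ) (x : Matrix κ σ X) :
    s.gnorm (x.submatrix e f) = s.gnorm x := by
  apply le_antisymm (s.gnorm_submatrix_le e.injective f.injective x)
  have := s.gnorm_submatrix_le e.symm.injective f.symm.injective (x.submatrix e f)
  simpa using this

lemma gnorm_eq_rnorm {m n : ℕ} (x : Matrix (Fin m) (Fin n) X) : s.gnorm x = s.rnorm x := by
  have hm := le_max_left m n
  have hn := le_max_right m n
  unfold rnorm
  rw [pad_eq hm hn, ← gnorm_fin]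
  have hf := Fin.castLE_injective hm
  have hg := Fin.castLE_injective hn
  apply le_antisymm
  · have hz : x = lmul (incl (Fin.castLE hm)).transpose
        (rmul (lmul (incl (Fin.castLE hm)) (rmul x (incl (Fin.castLE hn)).transpose))
          (incl (Fin.castLE hn))) := by
      simp only [← lmul_rmul, rmul_rmul, lmul_lmul, incl_transpose_mul hf, incl_transpose_mul hg,
        lmul_one, rmul_one]
    conv_lhs => rw [hz]
    refine (s.gnorm_mul_le _ _ _).trans ?_
    have := opNorm_incl hg
    have := opNorm_transpose_incl hf
    have := s.gnorm_nonneg (lmul (incl (Fin.castLE hm)) (rmul x (incl (Fin.castLE hn)).transpose))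
    calc _ ≤ 1 * s.gnorm (lmul (incl (Fin.castLE hm)) (rmul x (incl (Fin.castLE hn)).transpose)) * 1 := by
          gcongr
      _ = _ := by ring
  · refine (s.gnorm_mul_le _ _ _).trans ?_
    have := opNorm_incl hf
    have := opNorm_transpose_incl hg
    have := s.gnorm_nonneg x
    calc _ ≤ 1 * s.gnorm x * 1 := by gcongr
      _ = _ := by ring

lemma gnorm_fromBlocks_fin {m n : ℕ} (x : Matrix (Fin m) (Fin m) X) (y : Matrix (Fin n) (Fin n) X) :
    s.gnorm (Matrix.fromBlocks x 0 0 y) = max (s.gnorm x) (s.gnorm y) := by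
  rw [gnorm_fin, gnorm_fin, ← s.norm_dsum, ← gnorm_fin, dsum, gnorm_submatrix_equiv]

lemma gnorm_fromBlocks_le (x : Matrix ι κ X) (y : Matrix ρ σ X) :
    s.gnorm (Matrix.fromBlocks x 0 0 y) ≤ max (s.gnorm x) (s.gnorm y) := by
  obtain ⟨M, f, g, hf, hg, h1⟩ := s.gnorm_eq x
  obtain ⟨N, f', g', hf', hg', h2⟩ := s.gnorm_eq y
  rw [h1, h2, ← gnorm_fin, ← gnorm_fin, ← gnorm_fromBlocks_fin]
  refine le_trans (le_of_eq ?_) (s.gnorm_submatrix_le (f := Sum.map f f') (g := Sum.map g g')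
    (hf.sumMap hf') (hg.sumMap hg') _)
  congr 1
  ext (i | i) (j | j)
  · simp [lmul, rmul, incl, hf.eq_iff, hg.eq_iff]
  · simp
  · simp
  · simp [lmul, rmul, incl, hf'.eq_iff, hg'.eq_iff]

lemma gnorm_le_fromBlocks_left (x : Matrix ι κ X) (y : Matrix ρ σ X) :
    s.gnorm x ≤ s.gnorm (Matrix.fromBlocks x 0 0 y) :=
  s.gnorm_submatrix_le (f := Sum.inl) (g := Sum.inl) Sum.inl_injective Sum.inl_injective
    (Matrix.fromBlocks x 0 0 y)

lemma gnorm_le_fromBlocks_right (x : Matrix ι κ X) (y : Matrix ρ σ X) :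
    s.gnorm y ≤ s.gnorm (Matrix.fromBlocks x 0 0 y) :=
  s.gnorm_submatrix_le (f := Sum.inr) (g := Sum.inr) Sum.inr_injective Sum.inr_injective
    (Matrix.fromBlocks x 0 0 y)

lemma gnorm_fromBlocks (x : Matrix ι κ X) (y : Matrix ρ σ X) :
    s.gnorm (Matrix.fromBlocks x 0 0 y) = max (s.gnorm x) (s.gnorm y) :=
  le_antisymm (s.gnorm_fromBlocks_le x y)
    (max_le (s.gnorm_le_fromBlocks_left x y) (s.gnorm_le_fromBlocks_right x y))

/-- The entries of a matrix are dominated by its norm. -/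
lemma norm_entry_le (x : Matrix ι κ X) (i : ι) (j : κ) :
    s.norm 1 (sing (x i j)) ≤ s.gnorm x := by
  rw [← gnorm_fin]
  exact s.gnorm_submatrix_le (f := fun _ : Fin 1 => i) (g := fun _ : Fin 1 => j)
    (fun _ _ _ => Subsingleton.elim _ _) (fun _ _ _ => Subsingleton.elim _ _) x

/-- A linear functional on a finite-dimensional operator space is bounded for the ground norm. -/
lemma exists_functional_bound [FiniteDimensional ℂ X] (f : X →ₗ[ℂ] ℂ) :
    ∃ K : ℝ, 0 ≤ K ∧ ∀ x : X, ‖f x‖ ≤ K * s.norm 1 (sing x) := by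
  let _ : Norm X := ⟨fun x => s.norm 1 (sing x)⟩
  have core : NormedSpace.Core ℂ X :=
    { norm_nonneg := fun x => s.norm_nonneg _
      norm_smul := fun c x => s.norm_smul c (sing x)
      norm_triangle := fun x y => s.norm_add_le (sing x) (sing y)
      norm_eq_zero_iff := fun x => ⟨fun h => by
        have := s.eq_zero_of_norm_eq_zero _ h
        exact congrFun (congrFun this 0) 0, fun h => by
        subst h; exact s.norm_zero 1⟩ }
  let _ : NormedAddCommGroup X := NormedAddCommGroup.ofCore core
  let _ : NormedSpace ℂ X := NormedSpace.ofCore core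
  refine ⟨‖LinearMap.toContinuousLinearMap f‖, _root_.norm_nonneg _, fun x => ?_⟩
  exact (LinearMap.toContinuousLinearMap f).le_opNorm x

/-- Linear functionals are completely bounded. -/
lemma exists_functional_cb_bound [FiniteDimensional ℂ X] (f : X →ₗ[ℂ] ℂ) :
    ∃ K : ℝ, 0 ≤ K ∧ ∀ {ι κ : Type} [Fintype ι] [Fintype κ] [DecidableEq ι] [DecidableEq κ]
      (x : Matrix ι κ X), ‖x.map f‖ ≤ K * s.gnorm x := by
  obtain ⟨K, hK, h⟩ := s.exists_functional_bound f
  refine ⟨K, hK, fun {ι κ} _ _ _ _ x => ?_⟩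
  refine opNorm_le_of_mulVec _ _ (mul_nonneg hK (s.gnorm_nonneg x)) fun ξ => ?_
  set η : EuclideanSpace ℂ ι := WithLp.toLp 2 ((x.map f).mulVec ξ.ofLp) with hη
  let R : Matrix (Fin 1) ι ℂ := Matrix.of fun _ i => star (η i)
  let C : Matrix κ (Fin 1) ℂ := Matrix.of fun j _ => ξ j
  have hcol : ∀ {τ : Type} [Fintype τ] [DecidableEq τ] (v : EuclideanSpace ℂ τ),
      ‖(Matrix.of fun j _ => v j : Matrix τ (Fin 1) ℂ)‖ ≤ ‖v‖ := by
    intro τ _ _ v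
    refine opNorm_le_of_mulVec _ _ (_root_.norm_nonneg _) fun w => ?_
    have : WithLp.toLp 2 (Matrix.mulVec (Matrix.of fun j _ => v j : Matrix τ (Fin 1) ℂ) w.ofLp) =
        (w 0) • v := by
      ext j; simp [Matrix.mulVec, dotProduct, mul_comm]
    rw [this, _root_.norm_smul, mul_comm]
    refine mul_le_mul_of_nonneg_left ?_ (_root_.norm_nonneg _)
    rw [EuclideanSpace.norm_eq]; simp
  have hR : ‖R‖ ≤ ‖η‖ := by
    have : R.conjTranspose = (Matrix.of fun j _ => η j : Matrix ι (Fin 1) ℂ) := by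
      ext i j; simp [R]
    rw [← Matrix.l2_opNorm_conjTranspose R, this]
    exact hcol η
  have hC : ‖C‖ ≤ ‖ξ‖ := hcol ξ
  have e1 : ((‖η‖ ^ 2 : ℝ) : ℂ) = f (∑ i, R 0 i • ∑ j, C j 0 • x i j) := by
    rw [EuclideanSpace.norm_sq_eq]
    push_cast
    rw [map_sum]
    refine Finset.sum_congr rfl fun i _ => ?_
    have : η i = ∑ j, C j 0 * f (x i j) := by
      simp [hη, Matrix.mulVec, dotProduct, C, mul_comm]
    rw [map_smul, map_sum]
    simp only [map_smul, smul_eq_mul]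
    rw [← this]
    simp only [R]
    rw [← Complex.conj_mul']
    rfl
  have e2 : ‖η‖ ^ 2 ≤ K * (‖η‖ * s.gnorm x * ‖ξ‖) := by
    have h1 := h (∑ i, R 0 i • ∑ j, C j 0 • x i j)
    rw [← e1] at h1
    have h2 : s.norm 1 (sing (∑ i, R 0 i • ∑ j, C j 0 • x i j)) ≤ ‖R‖ * s.gnorm x * ‖C‖ := by
      rw [← gnorm_fin]
      refine le_trans (le_of_eq ?_) (s.gnorm_mul_le R x C)
      congr 1
    have h3 : ‖R‖ * s.gnorm x * ‖C‖ ≤ ‖η‖ * s.gnorm x * ‖ξ‖ := by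
      have := s.gnorm_nonneg x
      gcongr
    have h4 : ‖((‖η‖ ^ 2 : ℝ) : ℂ)‖ = ‖η‖ ^ 2 := by simp
    rw [h4] at h1
    exact h1.trans (mul_le_mul_of_nonneg_left (h2.trans h3) hK)
  by_cases h0 : ‖η‖ = 0
  · rw [h0]; exact mul_nonneg (mul_nonneg hK (s.gnorm_nonneg x)) (_root_.norm_nonneg _)
  · have hpos : 0 < ‖η‖ := lt_of_le_of_ne (_root_.norm_nonneg _) (Ne.symm h0)
    have : ‖η‖ * ‖η‖ ≤ ‖η‖ * (K * s.gnorm x * ‖ξ‖) := by nlinarith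
    exact le_of_mul_le_mul_left this hpos

/-- Replicating a vector along a diagonal does not increase its norm. -/
lemma gnorm_diag_le (y : X) : ∀ k : ℕ,
    s.gnorm (Matrix.of fun i j => if i = j then y else 0 : Matrix (Fin k) (Fin k) X) ≤
      s.norm 1 (sing y)
  | 0 => by
    have : (Matrix.of fun i j => if i = j then y else 0 : Matrix (Fin 0) (Fin 0) X) = 0 := by
      ext i; exact i.elim0
    rw [this, gnorm_zero]; exact s.norm_nonneg _
  | k + 1 => by
    have ih := gnorm_diag_le y k
    have : (Matrix.of fun i j => if i = j then y else 0 : Matrix (Fin (k + 1)) (Fin (k + 1)) X) =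
        dsum (Matrix.of fun i j => if i = j then y else 0 : Matrix (Fin k) (Fin k) X) (sing y) := by
      ext i j
      refine Fin.addCases (fun i => ?_) (fun i => ?_) i <;>
      refine Fin.addCases (fun j => ?_) (fun j => ?_) j
      · simp [dsum, sing]
      · have : ¬ (Fin.castAdd 1 i = Fin.natAdd k j) := fun h => by
          have := congrArg Fin.val h; simp at this; omega
        simp [dsum, sing, this]
      · have : ¬ (Fin.natAdd k i = Fin.castAdd 1 j) := fun h => by
          have := congrArg Fin.val h; simp at this; omega
        simp [dsum, sing, this]
      · have : i = j := Subsingleton.elim _ _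
        simp [dsum, sing, this]
    rw [this, gnorm_fin, s.norm_dsum, ← gnorm_fin]
    exact max_le ih le_rfl

/-- The scalar multiples of one vector. -/
lemma gnorm_smul_vec_le (A : Matrix ι κ ℂ) (y : X) :
    s.gnorm (Matrix.of fun i j => A i j • y : Matrix ι κ X) ≤ ‖A‖ * s.norm 1 (sing y) := by
  have e : (Matrix.of fun i j => A i j • y : Matrix ι κ X) = lmul A (Matrix.of fun i j => if i = j then y else 0) := by
    ext i j; simp [lmul]
  rw [e]
  refine (s.gnorm_lmul_le _ _).trans (mul_le_mul_of_nonneg_left ?_ (_root_.norm_nonneg _))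
  rw [← s.gnorm_submatrix_equiv (Fintype.equivFin κ).symm (Fintype.equivFin κ).symm]
  refine le_trans (le_of_eq ?_) (s.gnorm_diag_le y (Fintype.card κ))
  congr 1
  ext i j
  simp

end norms2
end OperatorSpaceStructure

namespace MatrixSpace

variable {X Y : Type*} [AddCommGroup X] [Module ℂ X] [AddCommGroup Y] [Module ℂ Y]

/-- For a matrix `T` of linear maps `X → Y`, i.e. a linear map `X → M_n(Y)`, and a matrix `x`
over `X`, the matrix of all `T i j (x p q)`: the image of `x` under the amplification
`M_k(X) → M_k(M_n(Y))`. -/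
def amplProd {ι κ ρ σ : Type*} (T : Matrix ι κ (X →ₗ[ℂ] Y)) (x : Matrix ρ σ X) :
    Matrix (ρ × ι) (σ × κ) Y :=
  Matrix.of fun p q => T p.2 q.2 (x p.1 q.1)

/-- The same matrix, indexed by `Fin (k * n)`: the identification `M_k(M_n(Y)) ≅ M_{kn}(Y)`. -/
def ampl {k n : ℕ} (T : Matrix (Fin n) (Fin n) (X →ₗ[ℂ] Y)) (x : Matrix (Fin k) (Fin k) X) :
    Matrix (Fin (k * n)) (Fin (k * n)) Y :=
  (amplProd T x).submatrix finProdFinEquiv.symm finProdFinEquiv.symm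

end MatrixSpace

namespace OperatorSpaceStructure

/-- The operator space `ℂ`: `M_n(ℂ)` with the operator norm. -/
noncomputable def complex : OperatorSpaceStructure ℂ where
  norm n x := ‖x‖
  norm_add_le x y := _root_.norm_add_le x y
  norm_smul c x := _root_.norm_smul c x
  eq_zero_of_norm_eq_zero x h := norm_eq_zero.1 h
  norm_dsum {m n} x y := by
    have key : ∀ {a b c d : Type} [Fintype a] [Fintype b] [Fintype c] [Fintype d]
        [DecidableEq a] [DecidableEq b] [DecidableEq c] [DecidableEq d] {f : a → b} {g : c → d}
        (_ : Function.Injective f) (_ : Function.Injective g) (z : Matrix b d ℂ),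
        ‖z.submatrix f g‖ ≤ ‖z‖ := by
      intro a b c d _ _ _ _ _ _ _ _ f g hf hg z
      have e : z.submatrix f g = (incl f).transpose * z * incl g := by
        ext i j; simp [Matrix.mul_apply, incl]
      rw [e]
      refine (Matrix.l2_opNorm_mul _ _).trans ?_
      refine (mul_le_of_le_one_right (_root_.norm_nonneg _) (opNorm_incl hg)).trans ?_
      refine (Matrix.l2_opNorm_mul _ _).trans ?_
      exact mul_le_of_le_one_left (_root_.norm_nonneg _) (opNorm_transpose_incl hf)
    apply le_antisymm
    · exact (key finSumFinEquiv.symm.injective finSumFinEquiv.symm.injective _).trans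
        (opNorm_fromBlocks x y)
    · refine max_le ?_ ?_
      · refine le_trans (le_of_eq ?_) (key (f := Fin.castAdd n) (g := Fin.castAdd n)
          (Fin.castAdd_injective m n) (Fin.castAdd_injective m n) (dsum x y))
        congr 1
        ext i j; simp [dsum]
      · refine le_trans (le_of_eq ?_) (key (f := Fin.natAdd m) (g := Fin.natAdd m)
          (Fin.natAdd_injective n m) (Fin.natAdd_injective n m) (dsum x y))
        congr 1
        ext i j; simp [dsum]
  norm_mul_le {m} α x β := by
    have e : lmul α (rmul x β) = α * x * β := by
      ext i j
      rw [lmul_rmul]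
      simp [lmul, rmul, Matrix.mul_apply, mul_comm]
    rw [e]
    refine (Matrix.l2_opNorm_mul _ _).trans ?_
    exact mul_le_mul_of_nonneg_right (Matrix.l2_opNorm_mul _ _) (_root_.norm_nonneg _)

variable {X Y : Type*} [AddCommGroup X] [Module ℂ X] [AddCommGroup Y] [Module ℂ Y]

/-- The operator space structure induced by an injective linear map. -/
def comap (φ : X →ₗ[ℂ] Y) (hφ : Function.Injective φ) (t : OperatorSpaceStructure Y) :
    OperatorSpaceStructure X where
  norm n x := t.norm n (x.map φ)
  norm_add_le x y := by
    rw [Matrix.map_add _ (map_add φ)]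
    exact t.norm_add_le _ _
  norm_smul c x := by
    rw [Matrix.map_smul _ c (fun a => map_smul φ c a)]
    exact t.norm_smul _ _
  eq_zero_of_norm_eq_zero x h := by
    have := t.eq_zero_of_norm_eq_zero _ h
    ext i j
    apply hφ
    simpa using congrFun (congrFun this i) j
  norm_dsum x y := by
    rw [← t.norm_dsum]
    congr 1
    ext i j
    simp only [dsum, Matrix.map_apply, Matrix.submatrix_apply]
    generalize finSumFinEquiv.symm i = a
    generalize finSumFinEquiv.symm j = b
    rcases a with a | a <;> rcases b with b | b <;> simp
  norm_mul_le α x β := by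
    rw [map_lmul, map_rmul]
    exact t.norm_mul_le _ _ _

section CB

variable (s : OperatorSpaceStructure X) (t : OperatorSpaceStructure Y)

lemma exists_ampl_bound [FiniteDimensional ℂ X] {n : ℕ}
    (T : Matrix (Fin n) (Fin n) (X →ₗ[ℂ] Y)) :
    ∃ K : ℝ, 0 ≤ K ∧ ∀ {k : ℕ} (x : Matrix (Fin k) (Fin k) X),
      t.norm (k * n) (ampl T x) ≤ K * s.norm k x := by
  let b := Module.finBasis ℂ X
  choose K hK hb using fun c => s.exists_functional_cb_bound (b.coord c)
  refine ⟨∑ c, ∑ i, ∑ j, K c * t.norm 1 (sing (T i j (b c))),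
    Finset.sum_nonneg fun c _ => Finset.sum_nonneg fun i _ => Finset.sum_nonneg fun j _ =>
      mul_nonneg (hK c) (t.norm_nonneg _), fun {k} x => ?_⟩
  rw [← gnorm_fin, ← gnorm_fin, ampl, gnorm_submatrix_equiv]
  have e : amplProd T x = ∑ c, ∑ i, ∑ j, (Matrix.of fun p q =>
      (incl (fun p : Fin k => (p, i)) * x.map (b.coord c) *
        (incl (fun p : Fin k => (p, j))).transpose) p q • T i j (b c) :
        Matrix (Fin k × Fin n) (Fin k × Fin n) Y) := by
    ext ⟨p, i⟩ ⟨q, j⟩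
    simp only [amplProd, Matrix.of_apply, Matrix.sum_apply]
    conv_lhs => rw [← b.sum_repr (x p q)]
    rw [map_sum]
    refine Finset.sum_congr rfl fun c _ => ?_
    rw [Finset.sum_eq_single i, Finset.sum_eq_single j]
    · simp [Matrix.mul_apply, incl]
    · intro j' _ hj
      have : ¬ (j = j') := fun h => hj h.symm
      simp [Matrix.mul_apply, incl, this]
    · simp
    · intro i' _ hi
      refine Finset.sum_eq_zero fun j' _ => ?_
      have : ¬ (i = i') := fun h => hi h.symm
      simp [Matrix.mul_apply, incl, this]
    · simp
  rw [e]
  refine (t.gnorm_sum_le _ _).trans ?_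
  rw [Finset.sum_mul]
  refine Finset.sum_le_sum fun c _ => (t.gnorm_sum_le _ _).trans ?_
  rw [Finset.sum_mul]
  refine Finset.sum_le_sum fun i _ => (t.gnorm_sum_le _ _).trans ?_
  rw [Finset.sum_mul]
  refine Finset.sum_le_sum fun j _ => (t.gnorm_smul_vec_le _ _).trans ?_
  have hi : Function.Injective (fun p : Fin k => (p, i)) := fun a b h => congrArg Prod.fst h
  have hj : Function.Injective (fun p : Fin k => (p, j)) := fun a b h => congrArg Prod.fst h
  have h1 : ‖incl (fun p : Fin k => (p, i)) * x.map (b.coord c) *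
        (incl (fun p : Fin k => (p, j))).transpose‖ ≤ K c * s.gnorm x := by
    refine (Matrix.l2_opNorm_mul _ _).trans ?_
    refine (mul_le_of_le_one_right (_root_.norm_nonneg _) (opNorm_transpose_incl hj)).trans ?_
    refine (Matrix.l2_opNorm_mul _ _).trans ?_
    refine (mul_le_of_le_one_left (_root_.norm_nonneg _) (opNorm_incl hi)).trans ?_
    exact hb c x
  calc _ ≤ K c * s.gnorm x * t.norm 1 (sing (T i j (b c))) :=
        mul_le_mul_of_nonneg_right h1 (t.norm_nonneg _)
    _ = _ := by ring

/-- The norms of the images of the unit balls under the amplifications of `T : X → M_n(Y)`. -/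
def cbSet {n : ℕ} (T : Matrix (Fin n) (Fin n) (X →ₗ[ℂ] Y)) : Set ℝ :=
  {c | ∃ (k : ℕ) (x : Matrix (Fin k) (Fin k) X), s.norm k x ≤ 1 ∧ c = t.norm (k * n) (ampl T x)}

lemma cbSet_bddAbove [FiniteDimensional ℂ X] {n : ℕ} (T : Matrix (Fin n) (Fin n) (X →ₗ[ℂ] Y)) :
    BddAbove (cbSet s t T) := by
  obtain ⟨K, hK, h⟩ := exists_ampl_bound s t T
  refine ⟨K, ?_⟩
  rintro c ⟨k, x, hx, rfl⟩
  exact (h x).trans (mul_le_of_le_one_right hK hx)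

lemma cbSet_nonempty {n : ℕ} (T : Matrix (Fin n) (Fin n) (X →ₗ[ℂ] Y)) :
    (cbSet s t T).Nonempty :=
  ⟨_, 0, 0, by rw [s.norm_zero]; exact zero_le_one, rfl⟩

/-- The operator space `CB(X, Y)` (for `X` finite-dimensional, so that every linear map is
completely bounded): the norm of `T` in `M_n(CB(X, Y)) ≅ CB(X, M_n(Y))` is the cb-norm. -/
noncomputable def cb [FiniteDimensional ℂ X] : OperatorSpaceStructure (X →ₗ[ℂ] Y) where
  norm n T := sSup (cbSet s t T)
  norm_add_le {n} T S := by
    refine csSup_le (cbSet_nonempty s t _) ?_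
    rintro c ⟨k, x, hx, rfl⟩
    have e : ampl (T + S) x = ampl T x + ampl S x := by
      ext i j; simp [ampl, amplProd]
    rw [e]
    exact (t.norm_add_le _ _).trans (add_le_add
      (le_csSup (cbSet_bddAbove s t T) ⟨k, x, hx, rfl⟩)
      (le_csSup (cbSet_bddAbove s t S) ⟨k, x, hx, rfl⟩))
  norm_smul {n} a T := by
    open scoped Pointwise in
    have e : cbSet s t (a • T) = ‖a‖ • cbSet s t T := by
      have h : ∀ {k : ℕ} (x : Matrix (Fin k) (Fin k) X),
          t.norm (k * n) (ampl (a • T) x) = ‖a‖ * t.norm (k * n) (ampl T x) := by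
        intro k x
        rw [← t.norm_smul]
        congr 1
      ext c
      simp only [cbSet, Set.mem_ofPred_eq, Set.mem_smul_set, smul_eq_mul]
      constructor
      · rintro ⟨k, x, hx, rfl⟩
        exact ⟨_, ⟨k, x, hx, rfl⟩, (h x).symm⟩
      · rintro ⟨_, ⟨k, x, hx, rfl⟩, rfl⟩
        exact ⟨k, x, hx, (h x).symm⟩
    rw [e, Real.sSup_smul_of_nonneg (_root_.norm_nonneg a), smul_eq_mul]
  eq_zero_of_norm_eq_zero {n} T h := by
    have h0 : ∀ x : X, s.norm 1 (sing x) ≤ 1 → ∀ i j, T i j x = 0 := by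
      intro x hx i j
      have h1 : t.norm (1 * n) (ampl T (sing x)) = 0 := le_antisymm
        ((le_csSup (cbSet_bddAbove s t T) ⟨1, _, hx, rfl⟩).trans h.le) (t.norm_nonneg _)
      have h2 := t.eq_zero_of_norm_eq_zero _ h1
      have h3 := congrFun (congrFun h2 (finProdFinEquiv (0, i))) (finProdFinEquiv (0, j))
      simpa [ampl, amplProd, sing] using h3
    ext i j x
    have hN := s.norm_nonneg (sing x)
    have h1 : s.norm 1 (sing (((s.norm 1 (sing x) + 1 : ℝ) : ℂ)⁻¹ • x)) ≤ 1 := by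
      have : sing (((s.norm 1 (sing x) + 1 : ℝ) : ℂ)⁻¹ • x) =
        ((s.norm 1 (sing x) + 1 : ℝ) : ℂ)⁻¹ • sing x := by ext; simp [sing]
      rw [this, s.norm_smul, norm_inv, Complex.norm_real, Real.norm_of_nonneg (by positivity),
        inv_mul_le_iff₀ (by positivity)]
      linarith
    have h2 := h0 _ h1 i j
    rw [map_smul, smul_eq_zero] at h2
    rcases h2 with h2 | h2
    · exfalso
      rw [inv_eq_zero, Complex.ofReal_eq_zero] at h2
      linarith
    · simpa using h2
  norm_dsum {m n} T S := by
    have h : ∀ {k : ℕ} (x : Matrix (Fin k) (Fin k) X), t.norm (k * (m + n)) (ampl (dsum T S) x) =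
        max (t.norm (k * m) (ampl T x)) (t.norm (k * n) (ampl S x)) := by
      intro k x
      rw [← gnorm_fin, ← gnorm_fin, ← gnorm_fin]
      simp only [ampl, gnorm_submatrix_equiv]
      rw [← gnorm_fromBlocks]
      rw [← t.gnorm_submatrix_equiv
        (((Equiv.refl (Fin k)).prodCongr finSumFinEquiv.symm).trans (Equiv.prodSumDistrib _ _ _))
        (((Equiv.refl (Fin k)).prodCongr finSumFinEquiv.symm).trans (Equiv.prodSumDistrib _ _ _))]
      congr 1
      ext ⟨p, i⟩ ⟨q, j⟩
      obtain ⟨i, rfl⟩ := finSumFinEquiv.surjective i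
      obtain ⟨j, rfl⟩ := finSumFinEquiv.surjective j
      rcases i with i | i <;> rcases j with j | j <;> simp [amplProd, dsum]
    apply le_antisymm
    · refine csSup_le (cbSet_nonempty s t _) ?_
      rintro c ⟨k, x, hx, rfl⟩
      rw [h]
      exact max_le_max (le_csSup (cbSet_bddAbove s t T) ⟨k, x, hx, rfl⟩)
        (le_csSup (cbSet_bddAbove s t S) ⟨k, x, hx, rfl⟩)
    · refine max_le ?_ ?_
      · refine csSup_le (cbSet_nonempty s t _) ?_
        rintro c ⟨k, x, hx, rfl⟩
        exact ((le_max_left _ _).trans (h x).ge).trans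
          (le_csSup (cbSet_bddAbove s t _) ⟨k, x, hx, rfl⟩)
      · refine csSup_le (cbSet_nonempty s t _) ?_
        rintro c ⟨k, x, hx, rfl⟩
        exact ((le_max_right _ _).trans (h x).ge).trans
          (le_csSup (cbSet_bddAbove s t _) ⟨k, x, hx, rfl⟩)
  norm_mul_le {m} α T β := by
    refine csSup_le (cbSet_nonempty s t _) ?_
    rintro c ⟨k, x, hx, rfl⟩
    have e : amplProd (lmul α (rmul T β)) x =
        lmul (Matrix.kroneckerMap (· * ·) (1 : Matrix (Fin k) (Fin k) ℂ) α)
          (rmul (amplProd T x) (Matrix.kroneckerMap (· * ·) (1 : Matrix (Fin k) (Fin k) ℂ) β)) := by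
      ext ⟨p, i⟩ ⟨q, j⟩
      simp [amplProd, lmul, rmul, Fintype.sum_prod_type, Matrix.one_apply, ite_smul, Finset.sum_ite_eq]
    have hk : ∀ γ : Matrix (Fin m) (Fin m) ℂ,
        ‖Matrix.kroneckerMap (· * ·) (1 : Matrix (Fin k) (Fin k) ℂ) γ‖ ≤ ‖γ‖ := fun γ =>
      (opNorm_kronecker _ _).trans (mul_le_of_le_one_left (_root_.norm_nonneg _) opNorm_one_le)
    rw [← gnorm_fin, ampl, gnorm_submatrix_equiv, e]
    refine (t.gnorm_mul_le _ _ _).trans ?_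
    have h1 : t.gnorm (amplProd T x) ≤ sSup (cbSet s t T) := by
      refine le_csSup (cbSet_bddAbove s t T) ⟨k, x, hx, ?_⟩
      rw [← gnorm_fin, ampl, gnorm_submatrix_equiv]
    have h2 := hk α
    have h3 := hk β
    have h4 := t.gnorm_nonneg (amplProd T x)
    have h5 := h4.trans h1
    gcongr

end CB

end OperatorSpaceStructure

namespace MatrixSpace

variable {X Y : Type*} [AddCommGroup X] [Module ℂ X] [AddCommGroup Y] [Module ℂ Y]
variable {ι κ ρ σ : Type*}

/-- The matrix inner product `x ⊙ y`. -/
def odot [Fintype κ] (x : Matrix ι κ X) (y : Matrix κ ρ Y) : Matrix ι ρ (X ⊗[ℂ] Y) :=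
  Matrix.of fun i j => ∑ k, x i k ⊗ₜ[ℂ] y k j

/-- The tensor product of matrices `x ⊗ y = [x_{ij} ⊗ y_{kl}]_{(i,k),(j,l)}`. -/
def kron (x : Matrix ι κ X) (y : Matrix ρ σ Y) : Matrix (ι × ρ) (κ × σ) (X ⊗[ℂ] Y) :=
  Matrix.of fun p q => x p.1 q.1 ⊗ₜ[ℂ] y p.2 q.2

lemma odot_lmul [Fintype κ] [Fintype ρ] (α : Matrix ι ρ ℂ) (x : Matrix ρ κ X) (y : Matrix κ σ Y) :
    odot (lmul α x) y = lmul α (odot x y) := by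
  ext i j
  simp only [odot, lmul, Matrix.of_apply, TensorProduct.sum_tmul, TensorProduct.smul_tmul',
    Finset.smul_sum]
  rw [Finset.sum_comm]

lemma odot_rmul [Fintype κ] [Fintype ρ] (x : Matrix ι κ X) (y : Matrix κ ρ Y) (β : Matrix ρ σ ℂ) :
    odot x (rmul y β) = rmul (odot x y) β := by
  ext i j
  simp only [odot, rmul, Matrix.of_apply, TensorProduct.tmul_sum, TensorProduct.tmul_smul,
    Finset.smul_sum]
  rw [Finset.sum_comm]

end MatrixSpace

namespace OperatorSpaceStructure

variable {X Y : Type*} [AddCommGroup X] [Module ℂ X] [AddCommGroup Y] [Module ℂ Y]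

/-- The operator space structure on a tensor product whose norms are the infima of given sets
of costs. -/
noncomputable def ofCosts (S : ∀ n : ℕ, Matrix (Fin n) (Fin n) (X ⊗[ℂ] Y) → Set ℝ)
    (h_nonneg : ∀ {n : ℕ} {v : Matrix (Fin n) (Fin n) (X ⊗[ℂ] Y)} {c : ℝ}, c ∈ S n v → 0 ≤ c)
    (h_sing : ∀ (a : X) (b : Y), (S 1 (sing (a ⊗ₜ[ℂ] b))).Nonempty)
    (h_add : ∀ {n : ℕ} {v w : Matrix (Fin n) (Fin n) (X ⊗[ℂ] Y)} {c d : ℝ}, c ∈ S n v →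
      d ∈ S n w → ∃ e ∈ S n (v + w), e ≤ c + d)
    (h_mul : ∀ {m n : ℕ} {v : Matrix (Fin n) (Fin n) (X ⊗[ℂ] Y)} {c : ℝ}
      (α : Matrix (Fin m) (Fin n) ℂ) (β : Matrix (Fin n) (Fin m) ℂ), c ∈ S n v →
      ∃ e ∈ S m (lmul α (rmul v β)), e ≤ ‖α‖ * c * ‖β‖)
    (h_dsum : ∀ {m n : ℕ} {v : Matrix (Fin m) (Fin m) (X ⊗[ℂ] Y)}
      {w : Matrix (Fin n) (Fin n) (X ⊗[ℂ] Y)} {c d : ℝ}, c ∈ S m v → d ∈ S n w →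
      ∃ e ∈ S (m + n) (dsum v w), e ≤ max c d)
    (h_pos : ∀ {n : ℕ} {v : Matrix (Fin n) (Fin n) (X ⊗[ℂ] Y)}, v ≠ 0 →
      ∃ δ : ℝ, 0 < δ ∧ ∀ c ∈ S n v, δ ≤ c) :
    OperatorSpaceStructure (X ⊗[ℂ] Y) := by
  have h_ne1 : ∀ w : X ⊗[ℂ] Y, (S 1 (sing w)).Nonempty := by
    intro w
    induction w using TensorProduct.induction_on with
    | zero => simpa using h_sing 0 0
    | tmul a b => exact h_sing a b
    | add v w hv hw =>
      obtain ⟨c, hc⟩ := hv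
      obtain ⟨d, hd⟩ := hw
      obtain ⟨e, he, -⟩ := h_add hc hd
      exact ⟨e, he⟩
  have h_ne : ∀ {n : ℕ} (v : Matrix (Fin n) (Fin n) (X ⊗[ℂ] Y)), (S n v).Nonempty := by
    intro n v
    have h0 : ∀ t : Finset (Fin n × Fin n), (S n (∑ p ∈ t,
        lmul (incl (fun _ : Fin 1 => p.1)) (rmul (sing (v p.1 p.2))
          (incl (fun _ : Fin 1 => p.2)).transpose))).Nonempty := by
      intro t
      induction t using Finset.induction_on with
      | empty =>
        obtain ⟨c, hc⟩ := h_ne1 0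
        obtain ⟨e, he, -⟩ := h_mul (0 : Matrix (Fin n) (Fin 1) ℂ) (0 : Matrix (Fin 1) (Fin n) ℂ) hc
        refine ⟨e, ?_⟩
        have h0 : lmul (0 : Matrix (Fin n) (Fin 1) ℂ) (rmul (sing (0 : X ⊗[ℂ] Y))
            (0 : Matrix (Fin 1) (Fin n) ℂ)) = 0 := by
          ext i j; simp [lmul]
        rwa [h0] at he
      | insert p t hp ih =>
        rw [Finset.sum_insert hp]
        obtain ⟨c, hc⟩ := h_ne1 (v p.1 p.2)
        obtain ⟨e, he, -⟩ := h_mul (incl (fun _ : Fin 1 => p.1))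
          (incl (fun _ : Fin 1 => p.2)).transpose hc
        obtain ⟨d, hd⟩ := ih
        obtain ⟨f, hf, -⟩ := h_add he hd
        exact ⟨f, hf⟩
    convert h0 Finset.univ using 2
    ext i j
    rw [Matrix.sum_apply, Fintype.sum_prod_type, Finset.sum_eq_single i, Finset.sum_eq_single j]
    · simp [lmul, rmul, incl, sing]
    · intro k _ hk
      simp [lmul, rmul, incl, sing, Ne.symm hk]
    · simp
    · intro k _ hk
      simp [lmul, rmul, incl, sing, Ne.symm hk]
    · simp
  have h_bdd : ∀ {n : ℕ} (v : Matrix (Fin n) (Fin n) (X ⊗[ℂ] Y)), BddBelow (S n v) :=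
    fun v => ⟨0, fun c hc => h_nonneg hc⟩
  have h_le : ∀ {m n : ℕ} (v : Matrix (Fin n) (Fin n) (X ⊗[ℂ] Y))
      (α : Matrix (Fin m) (Fin n) ℂ) (β : Matrix (Fin n) (Fin m) ℂ),
      sInf (S m (lmul α (rmul v β))) ≤ ‖α‖ * sInf (S n v) * ‖β‖ := by
    intro m n v α β
    have : ∀ ε > 0, sInf (S m (lmul α (rmul v β))) ≤ ‖α‖ * (sInf (S n v) + ε) * ‖β‖ := by
      intro ε hε
      obtain ⟨c, hc, hc'⟩ := Real.lt_sInf_add_pos (h_ne v) hε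
      obtain ⟨e, he, he'⟩ := h_mul α β hc
      refine ((csInf_le (h_bdd _) he).trans he').trans ?_
      gcongr
    refine le_of_forall_pos_le_add fun ε hε => ?_
    have hp : 0 < ‖α‖ * ‖β‖ + 1 := by positivity
    refine (this (ε / (‖α‖ * ‖β‖ + 1)) (by positivity)).trans ?_
    have : ‖α‖ * ‖β‖ * (ε / (‖α‖ * ‖β‖ + 1)) ≤ ε := by
      rw [mul_div_assoc', div_le_iff₀ hp]
      nlinarith
    nlinarith
  have h_smul_le : ∀ {n : ℕ} (a : ℂ) (v : Matrix (Fin n) (Fin n) (X ⊗[ℂ] Y)),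
      sInf (S n (a • v)) ≤ ‖a‖ * sInf (S n v) := by
    intro n a v
    have h := h_le v (a • (1 : Matrix (Fin n) (Fin n) ℂ)) (1 : Matrix (Fin n) (Fin n) ℂ)
    rw [rmul_one, lmul_smul_one] at h
    refine h.trans ?_
    have h1 : ‖(a • 1 : Matrix (Fin n) (Fin n) ℂ)‖ ≤ ‖a‖ := by
      rw [_root_.norm_smul]
      exact mul_le_of_le_one_right (_root_.norm_nonneg _) opNorm_one_le
    have h2 := opNorm_one_le (ι := Fin n)
    have h3 : 0 ≤ sInf (S n v) := Real.sInf_nonneg fun c hc => h_nonneg hc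
    calc _ ≤ ‖a‖ * sInf (S n v) * 1 := by gcongr
      _ = _ := mul_one _
  exact
  { norm := fun n v => sInf (S n v)
    norm_add_le := fun {n} v w => by
      refine le_of_forall_pos_le_add fun ε hε => ?_
      obtain ⟨c, hc, hc'⟩ := Real.lt_sInf_add_pos (h_ne v) (half_pos hε)
      obtain ⟨d, hd, hd'⟩ := Real.lt_sInf_add_pos (h_ne w) (half_pos hε)
      obtain ⟨e, he, he'⟩ := h_add hc hd
      have := csInf_le (h_bdd _) he
      linarith
    norm_smul := fun {n} a v => by
      apply le_antisymm (h_smul_le a v)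
      by_cases ha : a = 0
      · subst ha
        rw [_root_.norm_zero, zero_mul]
        exact Real.sInf_nonneg fun c hc => h_nonneg hc
      · have h := h_smul_le a⁻¹ (a • v)
        rw [inv_smul_smul₀ ha, norm_inv] at h
        rwa [← le_inv_mul_iff₀ (norm_pos_iff.2 ha)]
    eq_zero_of_norm_eq_zero := fun {n} v h => by
      by_contra hv
      obtain ⟨δ, hδ, h'⟩ := h_pos hv
      have := le_csInf (h_ne v) h'
      linarith
    norm_dsum := fun {m n} v w => by
      apply le_antisymm
      · refine le_of_forall_pos_le_add fun ε hε => ?_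
        obtain ⟨c, hc, hc'⟩ := Real.lt_sInf_add_pos (h_ne v) hε
        obtain ⟨d, hd, hd'⟩ := Real.lt_sInf_add_pos (h_ne w) hε
        obtain ⟨e, he, he'⟩ := h_dsum hc hd
        refine ((csInf_le (h_bdd _) he).trans he').trans ?_
        rw [← max_add_add_right]
        exact max_le_max hc'.le hd'.le
      · have aux : ∀ {k : ℕ} {f : Fin k → Fin (m + n)} (_ : Function.Injective f),
            sInf (S k ((dsum v w).submatrix f f)) ≤ sInf (S (m + n) (dsum v w)) := by
          intro k f hf
          rw [submatrix_eq]
          refine (h_le _ _ _).trans ?_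
          have h1 := opNorm_transpose_incl hf
          have h2 := opNorm_incl hf
          have h3 : 0 ≤ sInf (S (m + n) (dsum v w)) := Real.sInf_nonneg fun c hc => h_nonneg hc
          calc _ ≤ 1 * sInf (S (m + n) (dsum v w)) * 1 := by gcongr
            _ = _ := by ring
        refine max_le ?_ ?_
        · refine le_trans (le_of_eq ?_) (aux (Fin.castAdd_injective m n))
          congr 2
          ext i j; simp [dsum]
        · refine le_trans (le_of_eq ?_) (aux (Fin.natAdd_injective n m))
          congr 2
          ext i j; simp [dsum]
    norm_mul_le := fun α v β => h_le v α β }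

section aux

variable (s : OperatorSpaceStructure X)
variable {ι κ ρ σ : Type*} [Fintype ι] [Fintype κ] [Fintype ρ] [Fintype σ]
  [DecidableEq ι] [DecidableEq κ] [DecidableEq ρ] [DecidableEq σ]

lemma gnorm_fromCols (x : Matrix ι κ X) (y : Matrix ι σ X) :
    s.gnorm (Matrix.fromCols x y) ^ 2 ≤ s.gnorm x ^ 2 + s.gnorm y ^ 2 := by
  have hx : ((s.gnorm x : ℝ) : ℂ) • (((s.gnorm x : ℝ) : ℂ)⁻¹ • x) = x := by
    by_cases h : s.gnorm x = 0
    · rw [s.eq_zero_of_gnorm x h]; simp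
    · rw [smul_inv_smul₀]; exact_mod_cast h
  have hy : ((s.gnorm y : ℝ) : ℂ) • (((s.gnorm y : ℝ) : ℂ)⁻¹ • y) = y := by
    by_cases h : s.gnorm y = 0
    · rw [s.eq_zero_of_gnorm y h]; simp
    · rw [smul_inv_smul₀]; exact_mod_cast h
  have hn : ∀ {c : ℝ}, 0 ≤ c → ‖((c : ℝ) : ℂ)⁻¹‖ * c ≤ 1 := by
    intro c hc
    rw [norm_inv, Complex.norm_real, Real.norm_of_nonneg hc]
    by_cases h : c = 0
    · simp [h]
    · rw [inv_mul_cancel₀ h]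
  have e : Matrix.fromCols x y = lmul (Matrix.fromCols (((s.gnorm x : ℝ) : ℂ) • (1 : Matrix ι ι ℂ))
      (((s.gnorm y : ℝ) : ℂ) • (1 : Matrix ι ι ℂ)))
      (Matrix.fromBlocks (((s.gnorm x : ℝ) : ℂ)⁻¹ • x) 0 0 (((s.gnorm y : ℝ) : ℂ)⁻¹ • y)) := by
    conv_lhs => rw [← hx, ← hy]
    ext i (j | j) <;> simp [lmul, Matrix.one_apply, ite_smul]
  have h1 : s.gnorm (Matrix.fromBlocks (((s.gnorm x : ℝ) : ℂ)⁻¹ • x) 0 0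
      (((s.gnorm y : ℝ) : ℂ)⁻¹ • y)) ≤ 1 := by
    refine (s.gnorm_fromBlocks_le _ _).trans (max_le ?_ ?_) <;> rw [gnorm_smul]
    · exact hn (s.gnorm_nonneg x)
    · exact hn (s.gnorm_nonneg y)
  have h2 := opNorm_fromCols (((s.gnorm x : ℝ) : ℂ) • (1 : Matrix ι ι ℂ))
      (((s.gnorm y : ℝ) : ℂ) • (1 : Matrix ι ι ℂ))
  have h3 : ∀ {c : ℝ}, 0 ≤ c → ‖(((c : ℝ) : ℂ) • (1 : Matrix ι ι ℂ))‖ ^ 2 ≤ c ^ 2 := by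
    intro c hc
    refine pow_le_pow_left₀ (_root_.norm_nonneg _) ?_ 2
    rw [_root_.norm_smul, Complex.norm_real, Real.norm_of_nonneg hc]
    exact mul_le_of_le_one_right hc opNorm_one_le
  have h4 : s.gnorm (Matrix.fromCols x y) ≤
      ‖Matrix.fromCols (((s.gnorm x : ℝ) : ℂ) • (1 : Matrix ι ι ℂ))
        (((s.gnorm y : ℝ) : ℂ) • (1 : Matrix ι ι ℂ))‖ := by
    conv_lhs => rw [e]
    exact (s.gnorm_lmul_le _ _).trans (mul_le_of_le_one_right (_root_.norm_nonneg _) h1)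
  calc _ ≤ _ := pow_le_pow_left₀ (s.gnorm_nonneg _) h4 2
    _ ≤ _ := h2
    _ ≤ _ := add_le_add (h3 (s.gnorm_nonneg x)) (h3 (s.gnorm_nonneg y))

lemma gnorm_fromRows (x : Matrix ι κ X) (y : Matrix ρ κ X) :
    s.gnorm (Matrix.fromRows x y) ^ 2 ≤ s.gnorm x ^ 2 + s.gnorm y ^ 2 := by
  have hx : ((s.gnorm x : ℝ) : ℂ) • (((s.gnorm x : ℝ) : ℂ)⁻¹ • x) = x := by
    by_cases h : s.gnorm x = 0
    · rw [s.eq_zero_of_gnorm x h]; simp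
    · rw [smul_inv_smul₀]; exact_mod_cast h
  have hy : ((s.gnorm y : ℝ) : ℂ) • (((s.gnorm y : ℝ) : ℂ)⁻¹ • y) = y := by
    by_cases h : s.gnorm y = 0
    · rw [s.eq_zero_of_gnorm y h]; simp
    · rw [smul_inv_smul₀]; exact_mod_cast h
  have hn : ∀ {c : ℝ}, 0 ≤ c → ‖((c : ℝ) : ℂ)⁻¹‖ * c ≤ 1 := by
    intro c hc
    rw [norm_inv, Complex.norm_real, Real.norm_of_nonneg hc]
    by_cases h : c = 0
    · simp [h]
    · rw [inv_mul_cancel₀ h]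
  have e : Matrix.fromRows x y = rmul
      (Matrix.fromBlocks (((s.gnorm x : ℝ) : ℂ)⁻¹ • x) 0 0 (((s.gnorm y : ℝ) : ℂ)⁻¹ • y))
      (Matrix.fromRows (((s.gnorm x : ℝ) : ℂ) • (1 : Matrix κ κ ℂ))
      (((s.gnorm y : ℝ) : ℂ) • (1 : Matrix κ κ ℂ))) := by
    conv_lhs => rw [← hx, ← hy]
    ext (i | i) j <;> simp [rmul, Matrix.one_apply, ite_smul]
  have h1 : s.gnorm (Matrix.fromBlocks (((s.gnorm x : ℝ) : ℂ)⁻¹ • x) 0 0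
      (((s.gnorm y : ℝ) : ℂ)⁻¹ • y)) ≤ 1 := by
    refine (s.gnorm_fromBlocks_le _ _).trans (max_le ?_ ?_) <;> rw [gnorm_smul]
    · exact hn (s.gnorm_nonneg x)
    · exact hn (s.gnorm_nonneg y)
  have h2 := opNorm_fromRows (((s.gnorm x : ℝ) : ℂ) • (1 : Matrix κ κ ℂ))
      (((s.gnorm y : ℝ) : ℂ) • (1 : Matrix κ κ ℂ))
  have h3 : ∀ {c : ℝ}, 0 ≤ c → ‖(((c : ℝ) : ℂ) • (1 : Matrix κ κ ℂ))‖ ^ 2 ≤ c ^ 2 := by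
    intro c hc
    refine pow_le_pow_left₀ (_root_.norm_nonneg _) ?_ 2
    rw [_root_.norm_smul, Complex.norm_real, Real.norm_of_nonneg hc]
    exact mul_le_of_le_one_right hc opNorm_one_le
  have h4 : s.gnorm (Matrix.fromRows x y) ≤
      ‖Matrix.fromRows (((s.gnorm x : ℝ) : ℂ) • (1 : Matrix κ κ ℂ))
        (((s.gnorm y : ℝ) : ℂ) • (1 : Matrix κ κ ℂ))‖ := by
    conv_lhs => rw [e]
    exact (s.gnorm_rmul_le _ _).trans (mul_le_of_le_one_left (_root_.norm_nonneg _) h1)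
  calc _ ≤ _ := pow_le_pow_left₀ (s.gnorm_nonneg _) h4 2
    _ ≤ _ := h2
    _ ≤ _ := add_le_add (h3 (s.gnorm_nonneg x)) (h3 (s.gnorm_nonneg y))

end aux

end OperatorSpaceStructure

namespace OperatorSpaceStructure

variable {X Y : Type*} [AddCommGroup X] [Module ℂ X] [AddCommGroup Y] [Module ℂ Y]
variable (s : OperatorSpaceStructure X) (t : OperatorSpaceStructure Y)

/-- The operator space dual `X* = CB(X, ℂ)`. -/
noncomputable def dual [FiniteDimensional ℂ X] : OperatorSpaceStructure (X →ₗ[ℂ] ℂ) :=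
  cb s complex

/-- The linear map `X ⊗ Y → L(Y*, X)`, `x ⊗ y ↦ (φ ↦ φ(y) x)`. -/
noncomputable def tensorToHom (X Y : Type*) [AddCommGroup X] [Module ℂ X] [AddCommGroup Y]
    [Module ℂ Y] : X ⊗[ℂ] Y →ₗ[ℂ] ((Y →ₗ[ℂ] ℂ) →ₗ[ℂ] X) :=
  TensorProduct.lift (LinearMap.mk₂ ℂ
    (fun x y => LinearMap.smulRight (Module.Dual.eval ℂ Y y) x)
    (fun x x' y => by ext φ; simp)
    (fun c x y => by ext φ; simp only [LinearMap.smulRight_apply, LinearMap.smul_apply, smul_comm c])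
    (fun x y y' => by ext φ; simp [add_smul]) (fun c x y => by ext φ; simp [mul_smul]))

lemma tensorToHom_tmul (x : X) (y : Y) (φ : Y →ₗ[ℂ] ℂ) :
    tensorToHom X Y (x ⊗ₜ[ℂ] y) φ = φ y • x := by
  simp [tensorToHom]

lemma tensorToHom_injective [FiniteDimensional ℂ Y] :
    Function.Injective (tensorToHom X Y) := by
  rw [injective_iff_map_eq_zero]
  intro v hv
  let b := Module.finBasis ℂ Y
  apply (TensorProduct.equivFinsuppOfBasisRight (M := X) b).injective
  ext i
  have h : ∀ w : X ⊗[ℂ] Y, TensorProduct.equivFinsuppOfBasisRight (M := X) b w i =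
      tensorToHom X Y w (b.coord i) := by
    intro w
    induction w using TensorProduct.induction_on with
    | zero => simp
    | tmul x y => simp [tensorToHom_tmul]
    | add v w hv hw => simp [hv, hw]
  rw [h, hv]
  simp

/-- The completely injective tensor product: the structure induced by the linear isomorphism
`X ⊗ Y ≅ CB(Y*, X)`. -/
noncomputable def injTensor [FiniteDimensional ℂ Y] : OperatorSpaceStructure (X ⊗[ℂ] Y) :=
  comap (tensorToHom X Y) tensorToHom_injective (cb (dual t) s)

lemma exists_coord [FiniteDimensional ℂ X] [FiniteDimensional ℂ Y] {w : X ⊗[ℂ] Y} (hw : w ≠ 0) :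
    ∃ (h : X ⊗[ℂ] Y →ₗ[ℂ] ℂ) (f : X →ₗ[ℂ] ℂ) (g : Y →ₗ[ℂ] ℂ),
      (∀ x y, h (x ⊗ₜ[ℂ] y) = f x * g y) ∧ h w ≠ 0 := by
  let b := Module.finBasis ℂ X
  let b' := Module.finBasis ℂ Y
  have : ∃ i, (b.tensorProduct b').coord i w ≠ 0 := by
    by_contra hcon
    push Not at hcon
    exact hw ((b.tensorProduct b').forall_coord_eq_zero_iff.1 hcon)
  obtain ⟨⟨i, j⟩, hij⟩ := this
  exact ⟨(b.tensorProduct b').coord (i, j), b.coord i, b'.coord j, fun x y => by simp [mul_comm], hij⟩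

lemma norm_complex_entry {n : ℕ} (A : Matrix (Fin n) (Fin n) ℂ) (i j : Fin n) :
    ‖A i j‖ ≤ ‖A‖ := by
  have h := complex.norm_entry_le A i j
  rw [gnorm_fin] at h
  refine le_trans (le_of_eq ?_) h
  have e : (sing (A i j) : Matrix (Fin 1) (Fin 1) ℂ) = Matrix.diagonal (fun _ => A i j) := by
    ext a b
    rw [Subsingleton.elim a b]
    simp [sing]
  change _ = ‖(sing (A i j) : Matrix (Fin 1) (Fin 1) ℂ)‖
  rw [e, Matrix.l2_opNorm_diagonal]
  simp

/-- The values `‖x‖ ‖y‖` over all representations `v = x ⊙ y`. -/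
def haagerupCosts (n : ℕ) (v : Matrix (Fin n) (Fin n) (X ⊗[ℂ] Y)) : Set ℝ :=
  {c | ∃ (r : ℕ) (x : Matrix (Fin n) (Fin r) X) (y : Matrix (Fin r) (Fin n) Y),
    v = odot x y ∧ c = s.rnorm x * t.rnorm y}

/-- The values `‖α‖ ‖x‖ ‖y‖ ‖β‖` over all representations `v = α (x ⊗ y) β`. -/
def projCosts (n : ℕ) (v : Matrix (Fin n) (Fin n) (X ⊗[ℂ] Y)) : Set ℝ :=
  {c | ∃ (p q : ℕ) (x : Matrix (Fin p) (Fin p) X) (y : Matrix (Fin q) (Fin q) Y)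
    (α : Matrix (Fin n) (Fin p × Fin q) ℂ) (β : Matrix (Fin p × Fin q) (Fin n) ℂ),
    v = lmul α (rmul (kron x y) β) ∧ c = ‖α‖ * s.norm p x * t.norm q y * ‖β‖}

section haagerup

lemma haagerupCosts_nonneg {n : ℕ} {v : Matrix (Fin n) (Fin n) (X ⊗[ℂ] Y)} {c : ℝ}
    (h : c ∈ haagerupCosts s t n v) : 0 ≤ c := by
  obtain ⟨r, x, y, -, rfl⟩ := h
  exact mul_nonneg (s.norm_nonneg _) (t.norm_nonneg _)

lemma mem_haagerupCosts {n : ℕ} {v : Matrix (Fin n) (Fin n) (X ⊗[ℂ] Y)} {κ : Type} [Fintype κ]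
    [DecidableEq κ] (x : Matrix (Fin n) κ X) (y : Matrix κ (Fin n) Y) (hv : v = odot x y) :
    s.gnorm x * t.gnorm y ∈ haagerupCosts s t n v := by
  refine ⟨Fintype.card κ, x.submatrix id (Fintype.equivFin κ).symm,
    y.submatrix (Fintype.equivFin κ).symm id, ?_, ?_⟩
  · rw [hv]
    ext i j
    exact (Equiv.sum_comp (Fintype.equivFin κ).symm (fun k => x i k ⊗ₜ[ℂ] y k j)).symm
  · rw [← gnorm_eq_rnorm, ← gnorm_eq_rnorm]
    congr 1
    · exact (s.gnorm_submatrix_equiv (Equiv.refl _) (Fintype.equivFin κ).symm x).symm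
    · exact (t.gnorm_submatrix_equiv (Fintype.equivFin κ).symm (Equiv.refl _) y).symm

lemma haagerup_normalize {n : ℕ} {v : Matrix (Fin n) (Fin n) (X ⊗[ℂ] Y)} {c : ℝ}
    (h : c ∈ haagerupCosts s t n v) :
    ∃ (r : ℕ) (x : Matrix (Fin n) (Fin r) X) (y : Matrix (Fin r) (Fin n) Y),
      v = odot x y ∧ s.gnorm x ≤ √c ∧ t.gnorm y ≤ √c := by
  have hc := haagerupCosts_nonneg s t h
  obtain ⟨r, x, y, hv, hc'⟩ := h
  rw [← gnorm_eq_rnorm, ← gnorm_eq_rnorm] at hc'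
  by_cases h0 : c = 0
  · have hv0 : v = 0 := by
      rw [hv]
      rw [h0, eq_comm, mul_eq_zero] at hc'
      rcases hc' with h1 | h1
      · rw [s.eq_zero_of_gnorm x h1]; ext i j; simp [odot]
      · rw [t.eq_zero_of_gnorm y h1]; ext i j; simp [odot]
    refine ⟨0, 0, 0, ?_, ?_, ?_⟩
    · rw [hv0]; ext i j; simp [odot]
    · rw [gnorm_zero]; exact Real.sqrt_nonneg _
    · rw [gnorm_zero]; exact Real.sqrt_nonneg _
  · have hx : s.gnorm x ≠ 0 := fun h => h0 (by rw [hc', h, zero_mul])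
    have hy : t.gnorm y ≠ 0 := fun h => h0 (by rw [hc', h, mul_zero])
    refine ⟨r, ((√c / s.gnorm x : ℝ) : ℂ) • x, ((√c / t.gnorm y : ℝ) : ℂ) • y, ?_, ?_, ?_⟩
    · have e : (((√c / s.gnorm x : ℝ) : ℂ)) * ((√c / t.gnorm y : ℝ) : ℂ) = 1 := by
        rw [← Complex.ofReal_mul, div_mul_div_comm, Real.mul_self_sqrt hc, ← hc', div_self h0,
          Complex.ofReal_one]
      rw [hv]
      ext i j
      simp only [odot, Matrix.of_apply, Matrix.smul_apply, TensorProduct.smul_tmul_smul]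
      rw [e]
      simp
    · rw [gnorm_smul, Complex.norm_real, Real.norm_of_nonneg
        (div_nonneg (Real.sqrt_nonneg _) (s.gnorm_nonneg _)), div_mul_cancel₀ _ hx]
    · rw [gnorm_smul, Complex.norm_real, Real.norm_of_nonneg
        (div_nonneg (Real.sqrt_nonneg _) (t.gnorm_nonneg _)), div_mul_cancel₀ _ hy]

/-- The Haagerup tensor product. -/
noncomputable def haagerup [FiniteDimensional ℂ X] [FiniteDimensional ℂ Y] :
    OperatorSpaceStructure (X ⊗[ℂ] Y) :=
  ofCosts (haagerupCosts s t) (haagerupCosts_nonneg s t)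
    (fun a b => ⟨_, 1, sing a, sing b, by ext i j; simp [odot, sing], rfl⟩)
    (fun {n v w c d} hc hd => by
      have hc0 := haagerupCosts_nonneg s t hc
      have hd0 := haagerupCosts_nonneg s t hd
      obtain ⟨r, x, y, hv, hx, hy⟩ := haagerup_normalize s t hc
      obtain ⟨r', x', y', hw, hx', hy'⟩ := haagerup_normalize s t hd
      refine ⟨_, mem_haagerupCosts s t (Matrix.fromCols x x') (Matrix.fromRows y y') ?_, ?_⟩
      · rw [hv, hw]; ext i j; simp [odot]
      · have h1 : s.gnorm (Matrix.fromCols x x') ≤ √(c + d) := by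
          apply Real.le_sqrt_of_sq_le
          refine (s.gnorm_fromCols x x').trans (add_le_add ?_ ?_)
          · exact (pow_le_pow_left₀ (s.gnorm_nonneg _) hx 2).trans (Real.sq_sqrt hc0).le
          · exact (pow_le_pow_left₀ (s.gnorm_nonneg _) hx' 2).trans (Real.sq_sqrt hd0).le
        have h2 : t.gnorm (Matrix.fromRows y y') ≤ √(c + d) := by
          apply Real.le_sqrt_of_sq_le
          refine (t.gnorm_fromRows y y').trans (add_le_add ?_ ?_)
          · exact (pow_le_pow_left₀ (t.gnorm_nonneg _) hy 2).trans (Real.sq_sqrt hc0).le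
          · exact (pow_le_pow_left₀ (t.gnorm_nonneg _) hy' 2).trans (Real.sq_sqrt hd0).le
        exact (mul_le_mul h1 h2 (t.gnorm_nonneg _) (Real.sqrt_nonneg _)).trans
          (Real.mul_self_sqrt (add_nonneg hc0 hd0)).le)
    (fun {m n v c} α β hc => by
      obtain ⟨r, x, y, hv, rfl⟩ := hc
      rw [← gnorm_eq_rnorm, ← gnorm_eq_rnorm]
      refine ⟨_, mem_haagerupCosts s t (lmul α x) (rmul y β) ?_, ?_⟩
      · rw [hv, odot_lmul, odot_rmul]
      · calc _ ≤ (‖α‖ * s.gnorm x) * (t.gnorm y * ‖β‖) :=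
              mul_le_mul (s.gnorm_lmul_le _ _) (t.gnorm_rmul_le _ _) (t.gnorm_nonneg _)
                (mul_nonneg (_root_.norm_nonneg _) (s.gnorm_nonneg _))
          _ = _ := by ring)
    (fun {m n v w c d} hc hd => by
      have hc0 := haagerupCosts_nonneg s t hc
      have hd0 := haagerupCosts_nonneg s t hd
      obtain ⟨r, x, y, hv, hx, hy⟩ := haagerup_normalize s t hc
      obtain ⟨r', x', y', hw, hx', hy'⟩ := haagerup_normalize s t hd
      refine ⟨_, mem_haagerupCosts s t
        ((Matrix.fromBlocks x 0 0 x').submatrix finSumFinEquiv.symm id)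
        ((Matrix.fromBlocks y 0 0 y').submatrix id finSumFinEquiv.symm) ?_, ?_⟩
      · rw [hv, hw]
        ext i j
        obtain ⟨i, rfl⟩ := finSumFinEquiv.surjective i
        obtain ⟨j, rfl⟩ := finSumFinEquiv.surjective j
        rcases i with i | i <;> rcases j with j | j <;> simp [odot, dsum]
      · have e1 := s.gnorm_submatrix_equiv finSumFinEquiv.symm (Equiv.refl (Fin r ⊕ Fin r'))
          (Matrix.fromBlocks x 0 0 x')
        have e2 := t.gnorm_submatrix_equiv (Equiv.refl (Fin r ⊕ Fin r')) finSumFinEquiv.symm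
          (Matrix.fromBlocks y 0 0 y')
        rw [Equiv.coe_refl] at e1 e2
        rw [e1, e2]
        have hm : ∀ {a b : ℝ}, a ≤ √c → b ≤ √d → max a b ≤ √(max c d) := fun h h' =>
          max_le (h.trans (Real.sqrt_le_sqrt (le_max_left _ _)))
            (h'.trans (Real.sqrt_le_sqrt (le_max_right _ _)))
        exact (mul_le_mul ((s.gnorm_fromBlocks_le _ _).trans (hm hx hx'))
          ((t.gnorm_fromBlocks_le _ _).trans (hm hy hy')) (t.gnorm_nonneg _)
          (Real.sqrt_nonneg _)).trans (Real.mul_self_sqrt (le_max_of_le_left hc0)).le)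
    (fun {n v} hv => by
      obtain ⟨i, j, hij⟩ : ∃ i j, v i j ≠ 0 := by
        by_contra hcon
        push Not at hcon
        exact hv (by ext i j; exact hcon i j)
      obtain ⟨h, f, g, hfg, hne⟩ := exists_coord hij
      obtain ⟨K, hK, hf⟩ := s.exists_functional_cb_bound f
      obtain ⟨L, hL, hg⟩ := t.exists_functional_cb_bound g
      have key : ∀ c ∈ haagerupCosts s t n v, ‖h (v i j)‖ ≤ K * L * c := by
        rintro c ⟨r, x, y, hv, rfl⟩
        rw [← gnorm_eq_rnorm, ← gnorm_eq_rnorm]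
        have e : h (v i j) = (x.map f * y.map g) i j := by
          rw [hv]; simp [odot, hfg, Matrix.mul_apply]
        rw [e]
        refine (norm_complex_entry _ i j).trans ((Matrix.l2_opNorm_mul _ _).trans ?_)
        calc _ ≤ (K * s.gnorm x) * (L * t.gnorm y) :=
              mul_le_mul (hf x) (hg y) (_root_.norm_nonneg _) (mul_nonneg hK (s.gnorm_nonneg _))
          _ = _ := by ring
      have hpos : 0 < ‖h (v i j)‖ := norm_pos_iff.2 hne
      refine ⟨‖h (v i j)‖ / (K * L + 1), by positivity, fun c hc => ?_⟩
      have hc0 := haagerupCosts_nonneg s t hc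
      rw [div_le_iff₀ (by positivity)]
      have := key c hc
      nlinarith)

lemma haagerup_norm [FiniteDimensional ℂ X] [FiniteDimensional ℂ Y] {n : ℕ}
    (v : Matrix (Fin n) (Fin n) (X ⊗[ℂ] Y)) :
    (haagerup s t).norm n v = sInf (haagerupCosts s t n v) := rfl

end haagerup

end OperatorSpaceStructure

namespace OperatorSpaceStructure

variable {X Y : Type*} [AddCommGroup X] [Module ℂ X] [AddCommGroup Y] [Module ℂ Y]
variable (s : OperatorSpaceStructure X) (t : OperatorSpaceStructure Y)

section proj

lemma projCosts_nonneg {n : ℕ} {v : Matrix (Fin n) (Fin n) (X ⊗[ℂ] Y)} {c : ℝ}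
    (h : c ∈ projCosts s t n v) : 0 ≤ c := by
  obtain ⟨p, q, x, y, α, β, -, rfl⟩ := h
  have := s.norm_nonneg x
  have := t.norm_nonneg y
  positivity

lemma mem_projCosts {n : ℕ} {v : Matrix (Fin n) (Fin n) (X ⊗[ℂ] Y)} {P Q : Type} [Fintype P]
    [Fintype Q] [DecidableEq P] [DecidableEq Q] (x : Matrix P P X) (y : Matrix Q Q Y)
    (α : Matrix (Fin n) (P × Q) ℂ) (β : Matrix (P × Q) (Fin n) ℂ)
    (hv : v = lmul α (rmul (kron x y) β)) :
    ∃ c ∈ projCosts s t n v, c ≤ ‖α‖ * s.gnorm x * t.gnorm y * ‖β‖ := by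
  let f := (Fintype.equivFin P).symm
  let g := (Fintype.equivFin Q).symm
  let e : Fin (Fintype.card P) × Fin (Fintype.card Q) → P × Q := Prod.map f g
  have he : Function.Injective e := f.injective.prodMap g.injective
  have he' : incl e * (incl e).transpose = 1 := by
    ext a b
    obtain ⟨a', rfl⟩ : ∃ a', e a' = a := (f.surjective.prodMap g.surjective) a
    rw [Matrix.mul_apply, Finset.sum_eq_single a']
    · simp [incl, Matrix.one_apply, eq_comm]
    · intro k _ hk
      have : ¬ (e a' = e k) := fun h => hk (he h).symm
      simp [incl, this]
    · simp
  refine ⟨_, ⟨_, _, x.submatrix f f, y.submatrix g g, α * incl e, (incl e).transpose * β, ?_, rfl⟩,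
    ?_⟩
  · have h1 : kron (x.submatrix f f) (y.submatrix g g) = (kron x y).submatrix e e := by
      ext a b; simp [kron, e]
    rw [hv, h1, submatrix_eq]
    simp only [← lmul_rmul, rmul_rmul, lmul_lmul]
    rw [Matrix.mul_assoc, he', Matrix.mul_one, ← Matrix.mul_assoc, he', Matrix.one_mul]
  · rw [← gnorm_fin, ← gnorm_fin, gnorm_submatrix_equiv, gnorm_submatrix_equiv]
    have h1 : ‖α * incl e‖ ≤ ‖α‖ := (Matrix.l2_opNorm_mul _ _).trans
      (mul_le_of_le_one_right (_root_.norm_nonneg _) (opNorm_incl he))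
    have h2 : ‖(incl e).transpose * β‖ ≤ ‖β‖ := (Matrix.l2_opNorm_mul _ _).trans
      (mul_le_of_le_one_left (_root_.norm_nonneg _) (opNorm_transpose_incl he))
    have := s.gnorm_nonneg x
    have := t.gnorm_nonneg y
    gcongr

lemma proj_normalize {n : ℕ} {v : Matrix (Fin n) (Fin n) (X ⊗[ℂ] Y)} {c : ℝ}
    (h : c ∈ projCosts s t n v) :
    ∃ (p q : ℕ) (x : Matrix (Fin p) (Fin p) X) (y : Matrix (Fin q) (Fin q) Y)
      (α : Matrix (Fin n) (Fin p × Fin q) ℂ) (β : Matrix (Fin p × Fin q) (Fin n) ℂ),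
      v = lmul α (rmul (kron x y) β) ∧ s.gnorm x ≤ 1 ∧ t.gnorm y ≤ 1 ∧ ‖α‖ ≤ √c ∧ ‖β‖ ≤ √c := by
  have hc := projCosts_nonneg s t h
  obtain ⟨p, q, x, y, α, β, hv, hc'⟩ := h
  rw [← gnorm_fin, ← gnorm_fin] at hc'
  by_cases h0 : c = 0
  · have hv0 : v = 0 := by
      rw [hv]
      rw [h0, eq_comm, mul_eq_zero, mul_eq_zero, mul_eq_zero] at hc'
      rcases hc' with ((h1 | h1) | h1) | h1
      · rw [norm_eq_zero.1 h1]; ext i j; simp [lmul]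
      · rw [s.eq_zero_of_gnorm x h1]; ext i j; simp [lmul, rmul, kron]
      · rw [t.eq_zero_of_gnorm y h1]; ext i j; simp [lmul, rmul, kron]
      · rw [norm_eq_zero.1 h1]; ext i j; simp [lmul, rmul]
    refine ⟨0, 0, 0, 0, 0, 0, ?_, ?_, ?_, ?_, ?_⟩
    · rw [hv0]; ext i j; simp [lmul]
    · rw [gnorm_zero]; exact zero_le_one
    · rw [gnorm_zero]; exact zero_le_one
    · rw [_root_.norm_zero]; exact Real.sqrt_nonneg _
    · rw [_root_.norm_zero]; exact Real.sqrt_nonneg _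
  · have hx : s.gnorm x ≠ 0 := fun h => h0 (by rw [hc', h]; ring)
    have hy : t.gnorm y ≠ 0 := fun h => h0 (by rw [hc', h]; ring)
    have hα : ‖α‖ ≠ 0 := fun h => h0 (by rw [hc', h]; ring)
    have hβ : ‖β‖ ≠ 0 := fun h => h0 (by rw [hc', h]; ring)
    refine ⟨p, q, (((s.gnorm x)⁻¹ : ℝ) : ℂ) • x, (((t.gnorm y)⁻¹ : ℝ) : ℂ) • y,
      ((√c / ‖α‖ : ℝ) : ℂ) • α, ((√c / ‖β‖ : ℝ) : ℂ) • β, ?_, ?_, ?_, ?_, ?_⟩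
    · have e : ((√c / ‖α‖ : ℝ) : ℂ) * (((√c / ‖β‖ : ℝ) : ℂ) *
          ((((s.gnorm x)⁻¹ : ℝ) : ℂ) * (((t.gnorm y)⁻¹ : ℝ) : ℂ))) = 1 := by
        rw [← Complex.ofReal_mul, ← Complex.ofReal_mul, ← Complex.ofReal_mul, ← Complex.ofReal_one]
        congr 1
        have h1 : √c * √c = ‖α‖ * s.gnorm x * t.gnorm y * ‖β‖ := by rw [Real.mul_self_sqrt hc, hc']
        field_simp
        linarith
      have hk : kron ((((s.gnorm x)⁻¹ : ℝ) : ℂ) • x) ((((t.gnorm y)⁻¹ : ℝ) : ℂ) • y) =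
          ((((s.gnorm x)⁻¹ : ℝ) : ℂ) * (((t.gnorm y)⁻¹ : ℝ) : ℂ)) • kron x y := by
        ext a b
        simp only [kron, Matrix.of_apply, Matrix.smul_apply, TensorProduct.smul_tmul_smul]
      rw [hv, hk, smul_lmul, smul_rmul, rmul_smul, lmul_smul, lmul_smul, smul_smul, smul_smul, mul_assoc,
        e, one_smul]
    · rw [gnorm_smul, Complex.norm_real, Real.norm_of_nonneg (inv_nonneg.2 (s.gnorm_nonneg _)),
        inv_mul_cancel₀ hx]
    · rw [gnorm_smul, Complex.norm_real, Real.norm_of_nonneg (inv_nonneg.2 (t.gnorm_nonneg _)),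
        inv_mul_cancel₀ hy]
    · rw [_root_.norm_smul, Complex.norm_real, Real.norm_of_nonneg
        (div_nonneg (Real.sqrt_nonneg _) (_root_.norm_nonneg _)), div_mul_cancel₀ _ hα]
    · rw [_root_.norm_smul, Complex.norm_real, Real.norm_of_nonneg
        (div_nonneg (Real.sqrt_nonneg _) (_root_.norm_nonneg _)), div_mul_cancel₀ _ hβ]

/-- The position of the two diagonal blocks of `(x ⊕ x') ⊗ (y ⊕ y')`. -/
def blockPos (P Q P' Q' : Type) : (P × Q) ⊕ (P' × Q') → (P ⊕ P') × (Q ⊕ Q') :=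
  Sum.elim (Prod.map Sum.inl Sum.inl) (Prod.map Sum.inr Sum.inr)

lemma blockPos_injective (P Q P' Q' : Type) : Function.Injective (blockPos P Q P' Q') := by
  rintro (⟨a, b⟩ | ⟨a, b⟩) (⟨c, d⟩ | ⟨c, d⟩) h <;> simp_all [blockPos]

lemma kron_fromBlocks {P Q P' Q' : Type} (x : Matrix P P X) (x' : Matrix P' P' X)
    (y : Matrix Q Q Y) (y' : Matrix Q' Q' Y) :
    (kron (Matrix.fromBlocks x 0 0 x') (Matrix.fromBlocks y 0 0 y')).submatrix
      (blockPos P Q P' Q') (blockPos P Q P' Q') =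
    Matrix.fromBlocks (kron x y) 0 0 (kron x' y') := by
  ext (⟨a, b⟩ | ⟨a, b⟩) (⟨c, d⟩ | ⟨c, d⟩) <;> simp [blockPos, kron]

/-- The completely projective tensor product. -/
noncomputable def projTensor [FiniteDimensional ℂ X] [FiniteDimensional ℂ Y] :
    OperatorSpaceStructure (X ⊗[ℂ] Y) :=
  ofCosts (projCosts s t) (projCosts_nonneg s t)
    (fun a b => ⟨_, 1, 1, sing a, sing b, Matrix.of fun _ _ => 1, Matrix.of fun _ _ => 1, by
      ext i j; simp [lmul, rmul, kron, sing], rfl⟩)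
    (fun {n v w c d} hc hd => by
      have hc0 := projCosts_nonneg s t hc
      have hd0 := projCosts_nonneg s t hd
      obtain ⟨p, q, x, y, α, β, hv, hx, hy, hα, hβ⟩ := proj_normalize s t hc
      obtain ⟨p', q', x', y', α', β', hw, hx', hy', hα', hβ'⟩ := proj_normalize s t hd
      have hj := blockPos_injective (Fin p) (Fin q) (Fin p') (Fin q')
      obtain ⟨e, he, he'⟩ := mem_projCosts s t (v := v + w) (Matrix.fromBlocks x 0 0 x')
        (Matrix.fromBlocks y 0 0 y')
        (Matrix.fromCols α α' * (incl (blockPos (Fin p) (Fin q) (Fin p') (Fin q'))).transpose)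
        (incl (blockPos (Fin p) (Fin q) (Fin p') (Fin q')) * Matrix.fromRows β β') (by
          rw [← rmul_rmul, ← lmul_lmul, lmul_rmul (incl _).transpose,
            ← submatrix_eq, kron_fromBlocks, hv, hw]
          ext i j
          simp [lmul, rmul])
      refine ⟨e, he, he'.trans ?_⟩
      have h1 : ‖Matrix.fromCols α α' *
          (incl (blockPos (Fin p) (Fin q) (Fin p') (Fin q'))).transpose‖ ≤ √(c + d) := by
        refine (Matrix.l2_opNorm_mul _ _).trans ((mul_le_of_le_one_right (_root_.norm_nonneg _)
          (opNorm_transpose_incl hj)).trans ?_)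
        apply Real.le_sqrt_of_sq_le
        refine (opNorm_fromCols α α').trans (add_le_add ?_ ?_)
        · exact (pow_le_pow_left₀ (_root_.norm_nonneg _) hα 2).trans (Real.sq_sqrt hc0).le
        · exact (pow_le_pow_left₀ (_root_.norm_nonneg _) hα' 2).trans (Real.sq_sqrt hd0).le
      have h2 : ‖incl (blockPos (Fin p) (Fin q) (Fin p') (Fin q')) * Matrix.fromRows β β'‖ ≤
          √(c + d) := by
        refine (Matrix.l2_opNorm_mul _ _).trans ((mul_le_of_le_one_left (_root_.norm_nonneg _)
          (opNorm_incl hj)).trans ?_)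
        apply Real.le_sqrt_of_sq_le
        refine (opNorm_fromRows β β').trans (add_le_add ?_ ?_)
        · exact (pow_le_pow_left₀ (_root_.norm_nonneg _) hβ 2).trans (Real.sq_sqrt hc0).le
        · exact (pow_le_pow_left₀ (_root_.norm_nonneg _) hβ' 2).trans (Real.sq_sqrt hd0).le
      have h3 := (s.gnorm_fromBlocks_le x x').trans (max_le hx hx')
      have h4 := (t.gnorm_fromBlocks_le y y').trans (max_le hy hy')
      have h5 := s.gnorm_nonneg (Matrix.fromBlocks x 0 0 x')
      have h6 := t.gnorm_nonneg (Matrix.fromBlocks y 0 0 y')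
      calc _ ≤ √(c + d) * 1 * 1 * √(c + d) := by gcongr
        _ = c + d := by rw [mul_one, mul_one, Real.mul_self_sqrt (add_nonneg hc0 hd0)])
    (fun {m n v c} α β hc => by
      obtain ⟨p, q, x, y, α', β', hv, rfl⟩ := hc
      refine ⟨_, ⟨p, q, x, y, α * α', β' * β, ?_, rfl⟩, ?_⟩
      · rw [hv]
        simp only [← lmul_rmul, rmul_rmul, lmul_lmul]
      · have h1 := Matrix.l2_opNorm_mul α α'
        have h2 := Matrix.l2_opNorm_mul β' β
        have := s.norm_nonneg x
        have := t.norm_nonneg y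
        calc _ ≤ (‖α‖ * ‖α'‖) * s.norm p x * t.norm q y * (‖β'‖ * ‖β‖) := by gcongr
          _ = _ := by ring)
    (fun {m n v w c d} hc hd => by
      have hc0 := projCosts_nonneg s t hc
      have hd0 := projCosts_nonneg s t hd
      obtain ⟨p, q, x, y, α, β, hv, hx, hy, hα, hβ⟩ := proj_normalize s t hc
      obtain ⟨p', q', x', y', α', β', hw, hx', hy', hα', hβ'⟩ := proj_normalize s t hd
      have hj := blockPos_injective (Fin p) (Fin q) (Fin p') (Fin q')
      have hE := (finSumFinEquiv (m := m) (n := n)).injective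
      set I : Matrix (Fin (m + n)) (Fin m ⊕ Fin n) ℂ := incl finSumFinEquiv with hI
      obtain ⟨e, he, he'⟩ := mem_projCosts s t (v := dsum v w) (Matrix.fromBlocks x 0 0 x')
        (Matrix.fromBlocks y 0 0 y')
        (I * Matrix.fromBlocks α 0 0 α' *
          (incl (blockPos (Fin p) (Fin q) (Fin p') (Fin q'))).transpose)
        (incl (blockPos (Fin p) (Fin q) (Fin p') (Fin q')) * Matrix.fromBlocks β 0 0 β' *
          (I).transpose) (by
          have h1 : dsum v w = lmul (I)
              (rmul (Matrix.fromBlocks v 0 0 w) (I).transpose) := by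
            rw [dsum, submatrix_eq, incl_symm_transpose, hI, ← incl_symm_transpose,
              Matrix.transpose_transpose]
          have h2 : Matrix.fromBlocks v 0 0 w = lmul (Matrix.fromBlocks α 0 0 α')
              (rmul (Matrix.fromBlocks (kron x y) 0 0 (kron x' y'))
                (Matrix.fromBlocks β 0 0 β')) := by
            rw [hv, hw]
            ext (i | i) (j | j) <;> simp [lmul, rmul]
          rw [h1, h2, ← kron_fromBlocks, submatrix_eq]
          simp only [← lmul_rmul, rmul_rmul, lmul_lmul, Matrix.mul_assoc])
      refine ⟨e, he, he'.trans ?_⟩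
      have hm : ∀ {a b : ℝ}, a ≤ √c → b ≤ √d → max a b ≤ √(max c d) := fun h h' =>
        max_le (h.trans (Real.sqrt_le_sqrt (le_max_left _ _)))
          (h'.trans (Real.sqrt_le_sqrt (le_max_right _ _)))
      have h1 : ‖I * Matrix.fromBlocks α 0 0 α' *
          (incl (blockPos (Fin p) (Fin q) (Fin p') (Fin q'))).transpose‖ ≤ √(max c d) := by
        refine (Matrix.l2_opNorm_mul _ _).trans ((mul_le_of_le_one_right (_root_.norm_nonneg _)
          (opNorm_transpose_incl hj)).trans ?_)
        refine (Matrix.l2_opNorm_mul _ _).trans ((mul_le_of_le_one_left (_root_.norm_nonneg _)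
          (opNorm_incl hE)).trans ?_)
        exact (opNorm_fromBlocks _ _).trans (hm hα hα')
      have h2 : ‖incl (blockPos (Fin p) (Fin q) (Fin p') (Fin q')) * Matrix.fromBlocks β 0 0 β' *
          (I).transpose‖ ≤ √(max c d) := by
        refine (Matrix.l2_opNorm_mul _ _).trans ((mul_le_of_le_one_right (_root_.norm_nonneg _)
          (opNorm_transpose_incl hE)).trans ?_)
        refine (Matrix.l2_opNorm_mul _ _).trans ((mul_le_of_le_one_left (_root_.norm_nonneg _)
          (opNorm_incl hj)).trans ?_)
        exact (opNorm_fromBlocks _ _).trans (hm hβ hβ')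
      have h3 := (s.gnorm_fromBlocks_le x x').trans (max_le hx hx')
      have h4 := (t.gnorm_fromBlocks_le y y').trans (max_le hy hy')
      have h5 := s.gnorm_nonneg (Matrix.fromBlocks x 0 0 x')
      have h6 := t.gnorm_nonneg (Matrix.fromBlocks y 0 0 y')
      calc _ ≤ √(max c d) * 1 * 1 * √(max c d) := by gcongr
        _ = max c d := by rw [mul_one, mul_one, Real.mul_self_sqrt (le_max_of_le_left hc0)])
    (fun {n v} hv => by
      obtain ⟨i, j, hij⟩ : ∃ i j, v i j ≠ 0 := by
        by_contra hcon
        push Not at hcon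
        exact hv (by ext i j; exact hcon i j)
      obtain ⟨h, f, g, hfg, hne⟩ := exists_coord hij
      obtain ⟨K, hK, hf⟩ := s.exists_functional_cb_bound f
      obtain ⟨L, hL, hg⟩ := t.exists_functional_cb_bound g
      have key : ∀ c ∈ projCosts s t n v, ‖h (v i j)‖ ≤ K * L * c := by
        rintro c ⟨p, q, x, y, α, β, hv, rfl⟩
        rw [← gnorm_fin, ← gnorm_fin]
        have e : h (v i j) =
            (α * Matrix.kroneckerMap (· * ·) (x.map f) (y.map g) * β) i j := by
          rw [hv, lmul_rmul]
          simp only [rmul, lmul, kron, Matrix.of_apply, map_sum, map_smul, hfg, Matrix.mul_apply,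
            Matrix.kroneckerMap_apply, Matrix.map_apply, smul_eq_mul]
          exact Finset.sum_congr rfl fun a _ => mul_comm _ _
        rw [e]
        refine (norm_complex_entry _ i j).trans ((Matrix.l2_opNorm_mul _ _).trans ?_)
        have h1 := Matrix.l2_opNorm_mul α (Matrix.kroneckerMap (· * ·) (x.map f) (y.map g))
        have h2 := opNorm_kronecker (x.map f) (y.map g)
        have h3 := hf x
        have h4 := hg y
        have h5 := s.gnorm_nonneg x
        have h6 := t.gnorm_nonneg y
        have h7 : ‖x.map f‖ * ‖y.map g‖ ≤ (K * s.gnorm x) * (L * t.gnorm y) := by gcongr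
        calc _ ≤ (‖α‖ * ((K * s.gnorm x) * (L * t.gnorm y))) * ‖β‖ := by
              refine mul_le_mul_of_nonneg_right (h1.trans ?_) (_root_.norm_nonneg _)
              exact mul_le_mul_of_nonneg_left (h2.trans h7) (_root_.norm_nonneg _)
          _ = _ := by ring
      have hpos : 0 < ‖h (v i j)‖ := norm_pos_iff.2 hne
      refine ⟨‖h (v i j)‖ / (K * L + 1), by positivity, fun c hc => ?_⟩
      have hc0 := projCosts_nonneg s t hc
      rw [div_le_iff₀ (by positivity)]
      have := key c hc
      nlinarith)

lemma projTensor_norm [FiniteDimensional ℂ X] [FiniteDimensional ℂ Y] {n : ℕ}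
    (v : Matrix (Fin n) (Fin n) (X ⊗[ℂ] Y)) :
    (projTensor s t).norm n v = sInf (projCosts s t n v) := rfl

end proj

end OperatorSpaceStructure

/-- `φ` is a complete contraction: every amplification `M_n(X) → M_n(Y)` is a contraction. -/
def IsCompleteContraction {X Y : Type*} [AddCommGroup X] [Module ℂ X] [AddCommGroup Y]
    [Module ℂ Y] (s : OperatorSpaceStructure X) (t : OperatorSpaceStructure Y)
    (φ : X →ₗ[ℂ] Y) : Prop :=
  ∀ (n : ℕ) (x : Matrix (Fin n) (Fin n) X), t.norm n (x.map φ) ≤ s.norm n x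

/-- `φ` is a completely isometric isomorphism. -/
def IsCompletelyIsometricIso {X Y : Type*} [AddCommGroup X] [Module ℂ X] [AddCommGroup Y]
    [Module ℂ Y] (s : OperatorSpaceStructure X) (t : OperatorSpaceStructure Y)
    (φ : X →ₗ[ℂ] Y) : Prop :=
  Function.Surjective φ ∧
    ∀ (n : ℕ) (x : Matrix (Fin n) (Fin n) X), t.norm n (x.map φ) = s.norm n x

/-- Finite-dimensional operator spaces. -/
structure FdOS where
  carrier : Type
  [addCommGroup : AddCommGroup carrier]
  [module : Module ℂ carrier]
  [finiteDimensional : FiniteDimensional ℂ carrier]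
  oss : OperatorSpaceStructure carrier

namespace FdOS

instance : CoeSort FdOS Type := ⟨FdOS.carrier⟩

attribute [instance] FdOS.addCommGroup FdOS.module FdOS.finiteDimensional

/-- Morphisms of `FdOS`: the linear complete contractions. -/
@[ext]
structure Hom (X Y : FdOS) where
  toLin : X →ₗ[ℂ] Y
  isCC : IsCompleteContraction X.oss Y.oss toLin

instance : Category FdOS where
  Hom := Hom
  id X := ⟨LinearMap.id, fun n x => le_of_eq (by congr 1)⟩
  comp f g := ⟨g.toLin ∘ₗ f.toLin, fun n x =>
    le_trans (g.isCC n (x.map f.toLin)) (f.isCC n x)⟩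

@[ext]
lemma hom_ext {X Y : FdOS} {f g : X ⟶ Y} (h : f.toLin = g.toLin) : f = g := Hom.ext h

@[simp]
lemma id_toLin (X : FdOS) : Hom.toLin (𝟙 X) = LinearMap.id := rfl

@[simp]
lemma comp_toLin {X Y Z : FdOS} (f : X ⟶ Y) (g : Y ⟶ Z) :
    (f ≫ g).toLin = g.toLin ∘ₗ f.toLin := rfl

/-- An isomorphism of `FdOS` from a linear equivalence which is a complete contraction in both
directions. -/
def mkIso {X Y : FdOS} (e : X ≃ₗ[ℂ] Y)
    (h : IsCompleteContraction X.oss Y.oss e.toLinearMap)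
    (h' : IsCompleteContraction Y.oss X.oss e.symm.toLinearMap) : X ≅ Y where
  hom := ⟨e.toLinearMap, h⟩
  inv := ⟨e.symm.toLinearMap, h'⟩
  hom_inv_id := by ext x; simp
  inv_hom_id := by ext x; simp

/-- The operator space `ℂ`. -/
noncomputable abbrev unit : FdOS := ⟨ℂ, OperatorSpaceStructure.complex⟩

/-- The operator space `CB(X, Y)`. -/
noncomputable abbrev hom (X Y : FdOS) : FdOS :=
  ⟨X →ₗ[ℂ] Y, OperatorSpaceStructure.cb X.oss Y.oss⟩

/-- The dual operator space `X* = CB(X, ℂ)`. -/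
noncomputable abbrev dual (X : FdOS) : FdOS := hom X unit

/-- A choice of an operator space structure on each vector space tensor product `X ⊗ Y`. -/
abbrev TensorStructure := ∀ X Y : FdOS, OperatorSpaceStructure (X ⊗[ℂ] Y)

/-- The operator space `X ⊗ Y` with the structure given by `τ`. -/
abbrev tensor (τ : TensorStructure) (X Y : FdOS) : FdOS := ⟨X ⊗[ℂ] Y, τ X Y⟩

/-- The completely projective tensor product. -/
noncomputable def proj : TensorStructure := fun X Y =>
  OperatorSpaceStructure.projTensor X.oss Y.oss

/-- The completely injective tensor product. -/
noncomputable def inj : TensorStructure := fun X Y =>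
  OperatorSpaceStructure.injTensor X.oss Y.oss

/-- The Haagerup tensor product. -/
noncomputable def haagerup : TensorStructure := fun X Y =>
  OperatorSpaceStructure.haagerup X.oss Y.oss

/-- `τ` makes `FdOS` a monoidal category with unit `ℂ`, strictly over vector spaces: tensor
products of morphisms of `FdOS`, and the associators and unitors of vector spaces together with
their inverses, are complete contractions. -/
structure IsMonoidalTensor (τ : TensorStructure) : Prop where
  map : ∀ {X X' Y Y' : FdOS} (f : X ⟶ X') (g : Y ⟶ Y'),
    IsCompleteContraction (tensor τ X Y).oss (tensor τ X' Y').oss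
      (TensorProduct.map f.toLin g.toLin)
  assoc : ∀ X Y Z : FdOS,
    IsCompleteContraction (tensor τ (tensor τ X Y) Z).oss (tensor τ X (tensor τ Y Z)).oss
      (TensorProduct.assoc ℂ X Y Z).toLinearMap
  assoc_symm : ∀ X Y Z : FdOS,
    IsCompleteContraction (tensor τ X (tensor τ Y Z)).oss (tensor τ (tensor τ X Y) Z).oss
      (TensorProduct.assoc ℂ X Y Z).symm.toLinearMap
  lid : ∀ X : FdOS, IsCompleteContraction (tensor τ unit X).oss X.oss
    (TensorProduct.lid ℂ X).toLinearMap
  lid_symm : ∀ X : FdOS, IsCompleteContraction X.oss (tensor τ unit X).oss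
    (TensorProduct.lid ℂ X).symm.toLinearMap
  rid : ∀ X : FdOS, IsCompleteContraction (tensor τ X unit).oss X.oss
    (TensorProduct.rid ℂ X).toLinearMap
  rid_symm : ∀ X : FdOS, IsCompleteContraction X.oss (tensor τ X unit).oss
    (TensorProduct.rid ℂ X).symm.toLinearMap

/-- The monoidal category `(FdOS, ℂ, τ)`. -/
@[reducible]
noncomputable def monoidal {τ : TensorStructure} (h : IsMonoidalTensor τ) :
    MonoidalCategory FdOS :=
  letI : MonoidalCategoryStruct FdOS :=
    { tensorObj := tensor τ
      tensorUnit := unit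
      tensorHom := fun f g => ⟨TensorProduct.map f.toLin g.toLin, h.map f g⟩
      whiskerLeft := fun X _ _ g => ⟨TensorProduct.map LinearMap.id g.toLin, h.map (𝟙 X) g⟩
      whiskerRight := fun f Y => ⟨TensorProduct.map f.toLin LinearMap.id, h.map f (𝟙 Y)⟩
      associator := fun X Y Z =>
        mkIso (TensorProduct.assoc ℂ X Y Z) (h.assoc X Y Z) (h.assoc_symm X Y Z)
      leftUnitor := fun X => mkIso (TensorProduct.lid ℂ X) (h.lid X) (h.lid_symm X)
      rightUnitor := fun X => mkIso (TensorProduct.rid ℂ X) (h.rid X) (h.rid_symm X) }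
  MonoidalCategory.ofTensorHom
    (id_tensorHom_id := fun X Y => hom_ext TensorProduct.map_id)
    (id_tensorHom := fun X _ _ g => rfl)
    (tensorHom_id := fun f Y => rfl)
    (tensorHom_comp_tensorHom := fun f₁ f₂ g₁ g₂ =>
      hom_ext (TensorProduct.map_comp g₁.toLin g₂.toLin f₁.toLin f₂.toLin).symm)
    (associator_naturality := fun f₁ f₂ f₃ =>
      hom_ext (TensorProduct.ext_threefold fun x y z => rfl))
    (leftUnitor_naturality := fun {X Y} f =>
      hom_ext (TensorProduct.ext' fun (a : ℂ) (x : X) => (map_smul f.toLin a x).symm))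
    (rightUnitor_naturality := fun {X Y} f =>
      hom_ext (TensorProduct.ext' fun (x : X) (a : ℂ) => (map_smul f.toLin a x).symm))
    (pentagon := fun W X Y Z =>
      hom_ext (TensorProduct.ext_fourfold fun w x y z => rfl))
    (triangle := fun X Y =>
      hom_ext (TensorProduct.ext_threefold fun (x : X) (a : ℂ) (y : Y) =>
        (TensorProduct.tmul_smul a x y).trans (TensorProduct.smul_tmul' a x y)))

lemma ext_right {X Y Z W : Type*} [AddCommGroup X] [Module ℂ X] [AddCommGroup Y] [Module ℂ Y]
    [AddCommGroup Z] [Module ℂ Z] [AddCommGroup W] [Module ℂ W]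
    {f g : X ⊗[ℂ] (Y ⊗[ℂ] Z) →ₗ[ℂ] W}
    (h : ∀ x y z, f (x ⊗ₜ[ℂ] (y ⊗ₜ[ℂ] z)) = g (x ⊗ₜ[ℂ] (y ⊗ₜ[ℂ] z))) : f = g := by
  have e : f ∘ₗ (TensorProduct.assoc ℂ X Y Z).toLinearMap =
      g ∘ₗ (TensorProduct.assoc ℂ X Y Z).toLinearMap :=
    TensorProduct.ext_threefold fun x y z => by simpa using h x y z
  refine LinearMap.ext fun w => ?_
  simpa using LinearMap.congr_fun e ((TensorProduct.assoc ℂ X Y Z).symm w)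

/-- The symmetry of vector spaces is completely contractive for `τ`. -/
def IsSymmetricTensor (τ : TensorStructure) : Prop :=
  ∀ X Y : FdOS, IsCompleteContraction (tensor τ X Y).oss (tensor τ Y X).oss
    (TensorProduct.comm ℂ X Y).toLinearMap

/-- The symmetric monoidal category `(FdOS, ℂ, τ)`. -/
@[reducible]
noncomputable def symmetric {τ : TensorStructure} (h : IsMonoidalTensor τ)
    (hs : IsSymmetricTensor τ) : @SymmetricCategory FdOS _ (monoidal h) :=
  letI := monoidal h
  { braiding := fun X Y => mkIso (TensorProduct.comm ℂ X Y) (hs X Y) (hs Y X)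
    braiding_naturality_right := fun X _ _ f => hom_ext (TensorProduct.ext' fun x y => rfl)
    braiding_naturality_left := fun f Z => hom_ext (TensorProduct.ext' fun x y => rfl)
    hexagon_forward := fun X Y Z => hom_ext (TensorProduct.ext_threefold fun x y z => rfl)
    hexagon_reverse := fun X Y Z => by
      apply hom_ext
      exact ext_right fun x y z => rfl
    symmetry := fun X Y => hom_ext (TensorProduct.ext' fun x y => rfl) }

/-- The evaluation map `X ⊗ L(X, Y) → Y`. -/
noncomputable def evLin (X Y : FdOS) : X ⊗[ℂ] (X →ₗ[ℂ] Y) →ₗ[ℂ] Y :=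
  TensorProduct.lift (LinearMap.flip LinearMap.id)

/-- The curried form `Z → L(X, Y)` of a linear map `X ⊗ Z → Y`. -/
noncomputable def curryLin {X Y Z : FdOS} (f : X ⊗[ℂ] Z →ₗ[ℂ] Y) : Z →ₗ[ℂ] (X →ₗ[ℂ] Y) :=
  (TensorProduct.curry f).flip

/-- `CB(-, -)` is an internal hom for `τ`: evaluation is a complete contraction, and so are the
curried forms of complete contractions. -/
structure IsClosedTensor (τ : TensorStructure) : Prop where
  ev : ∀ X Y : FdOS, IsCompleteContraction (tensor τ X (hom X Y)).oss Y.oss (evLin X Y)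
  curry : ∀ {X Y Z : FdOS} (f : tensor τ X Z ⟶ Y),
    IsCompleteContraction Z.oss (hom X Y).oss (curryLin f.toLin)

/-- The monoidal closed category `(FdOS, ℂ, τ, CB(-, -))`. -/
@[reducible]
noncomputable def closed {τ : TensorStructure} (h : IsMonoidalTensor τ)
    (hc : IsClosedTensor τ) : @MonoidalClosed FdOS _ (monoidal h) :=
  letI := monoidal h
  { closed := fun X =>
      let e : ∀ Z Y : FdOS, ((MonoidalCategory.tensorLeft X).obj Z ⟶ Y) ≃ (Z ⟶ hom X Y) :=
        fun Z Y =>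
        { toFun := fun f => ⟨curryLin f.toLin, hc.curry f⟩
          invFun := fun g => (⟨TensorProduct.map LinearMap.id g.toLin, h.map (𝟙 X) g⟩ :
            tensor τ X Z ⟶ tensor τ X (hom X Y)) ≫ ⟨evLin X Y, hc.ev X Y⟩
          left_inv := fun f => hom_ext (TensorProduct.ext' fun x z => rfl)
          right_inv := fun g => hom_ext rfl }
      { rightAdj := Adjunction.rightAdjointOfEquiv e (fun Z' Z Y f g => hom_ext rfl)
        adj := Adjunction.adjunctionOfEquivRight e (fun Z' Z Y f g => hom_ext rfl) } }

/-- The permutation `(a ⊗ b) ⊗ (c ⊗ d) ↦ (a ⊗ c) ⊗ (b ⊗ d)`. -/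
noncomputable def shuffle (A B C D : FdOS) :
    (A ⊗[ℂ] B) ⊗[ℂ] (C ⊗[ℂ] D) →ₗ[ℂ] (A ⊗[ℂ] C) ⊗[ℂ] (B ⊗[ℂ] D) :=
  (TensorProduct.tensorTensorTensorComm ℂ A B C D).toLinearMap

/-- The map `A ⊗ B → L(A*, B)`, `a ⊗ b ↦ (φ ↦ φ(a) b)`. -/
noncomputable def parLin (A B : FdOS) : A ⊗[ℂ] B →ₗ[ℂ] ((A →ₗ[ℂ] ℂ) →ₗ[ℂ] B) :=
  OperatorSpaceStructure.tensorToHom B A ∘ₗ (TensorProduct.comm ℂ A B).toLinearMap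

end FdOS

/-- `(J, ◁)`, given by `S`, is normal duoidal to `(I, ⊗)`, given by `T`. -/
structure NormalDuoidal {𝒞 : Type*} [Category 𝒞] (T S : MonoidalCategory 𝒞) where
  /-- the weak interchange -/
  w : ∀ A B C D : 𝒞, T.tensorObj (S.tensorObj A B) (S.tensorObj C D) ⟶
    S.tensorObj (T.tensorObj A C) (T.tensorObj B D)
  w_natural : ∀ {A A' B B' C C' D D' : 𝒞} (f : A ⟶ A') (g : B ⟶ B') (h : C ⟶ C') (k : D ⟶ D'),
    T.tensorHom (S.tensorHom f g) (S.tensorHom h k) ≫ w A' B' C' D' =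
      w A B C D ≫ S.tensorHom (T.tensorHom f h) (T.tensorHom g k)
  i : T.tensorUnit ≅ S.tensorUnit
  δ : T.tensorUnit ⟶ S.tensorObj T.tensorUnit T.tensorUnit
  μ : T.tensorObj S.tensorUnit S.tensorUnit ⟶ S.tensorUnit
  w_assoc_tensor : ∀ A B C D E F : 𝒞,
    T.tensorHom (w A B C D) (𝟙 (S.tensorObj E F)) ≫
        w (T.tensorObj A C) (T.tensorObj B D) E F ≫
        S.tensorHom (T.associator A C E).hom (T.associator B D F).hom =
      (T.associator (S.tensorObj A B) (S.tensorObj C D) (S.tensorObj E F)).hom ≫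
        T.tensorHom (𝟙 (S.tensorObj A B)) (w C D E F) ≫
        w A B (T.tensorObj C E) (T.tensorObj D F)
  w_assoc_seq : ∀ A B C D E F : 𝒞,
    w (S.tensorObj A C) E (S.tensorObj B D) F ≫
        S.tensorHom (w A C B D) (𝟙 (T.tensorObj E F)) ≫
        (S.associator (T.tensorObj A B) (T.tensorObj C D) (T.tensorObj E F)).hom =
      T.tensorHom (S.associator A C E).hom (S.associator B D F).hom ≫
        w A (S.tensorObj C E) B (S.tensorObj D F) ≫
        S.tensorHom (𝟙 (T.tensorObj A B)) (w C E D F)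
  w_unit_tensor_left : ∀ A B : 𝒞,
    (T.leftUnitor (S.tensorObj A B)).inv ≫ T.tensorHom δ (𝟙 (S.tensorObj A B)) ≫
        w T.tensorUnit T.tensorUnit A B =
      S.tensorHom (T.leftUnitor A).inv (T.leftUnitor B).inv
  w_unit_tensor_right : ∀ A B : 𝒞,
    (T.rightUnitor (S.tensorObj A B)).inv ≫ T.tensorHom (𝟙 (S.tensorObj A B)) δ ≫
        w A B T.tensorUnit T.tensorUnit =
      S.tensorHom (T.rightUnitor A).inv (T.rightUnitor B).inv
  w_unit_seq_left : ∀ A B : 𝒞,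
    T.tensorHom (S.leftUnitor A).inv (S.leftUnitor B).inv ≫
        w S.tensorUnit A S.tensorUnit B ≫ S.tensorHom μ (𝟙 (T.tensorObj A B)) =
      (S.leftUnitor (T.tensorObj A B)).inv
  w_unit_seq_right : ∀ A B : 𝒞,
    T.tensorHom (S.rightUnitor A).inv (S.rightUnitor B).inv ≫
        w A S.tensorUnit B S.tensorUnit ≫ S.tensorHom (𝟙 (T.tensorObj A B)) μ =
      (S.rightUnitor (T.tensorObj A B)).inv
  /-- `(I, δ, i)` is a comonoid for `◁` -/
  δ_counit_left : δ ≫ S.tensorHom i.hom (𝟙 T.tensorUnit) ≫ (S.leftUnitor T.tensorUnit).hom =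
    𝟙 T.tensorUnit
  δ_counit_right : δ ≫ S.tensorHom (𝟙 T.tensorUnit) i.hom ≫ (S.rightUnitor T.tensorUnit).hom =
    𝟙 T.tensorUnit
  δ_coassoc : δ ≫ S.tensorHom δ (𝟙 T.tensorUnit) ≫
      (S.associator T.tensorUnit T.tensorUnit T.tensorUnit).hom =
    δ ≫ S.tensorHom (𝟙 T.tensorUnit) δ
  /-- `(J, μ, i)` is a monoid for `⊗` -/
  μ_unit_left : T.tensorHom i.hom (𝟙 S.tensorUnit) ≫ μ = (T.leftUnitor S.tensorUnit).hom
  μ_unit_right : T.tensorHom (𝟙 S.tensorUnit) i.hom ≫ μ = (T.rightUnitor S.tensorUnit).hom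
  μ_assoc : T.tensorHom μ (𝟙 S.tensorUnit) ≫ μ =
    (T.associator S.tensorUnit S.tensorUnit S.tensorUnit).hom ≫
      T.tensorHom (𝟙 S.tensorUnit) μ ≫ μ

/-- The canonical map `A ⟶ (A ⊸ ⊥) ⊸ ⊥`. -/
def toBidual {𝒞 : Type*} [Category 𝒞] [MonoidalCategory 𝒞] [SymmetricCategory 𝒞]
    [MonoidalClosed 𝒞] (bot A : 𝒞) : A ⟶ (ihom ((ihom A).obj bot)).obj bot :=
  MonoidalClosed.curry ((BraidedCategory.braiding ((ihom A).obj bot) A).hom ≫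
    (ihom.ev A).app bot)

/-- A symmetric monoidal closed category is `*`-autonomous with dualizing object `bot`. -/
def IsStarAutonomous (𝒞 : Type*) [Category 𝒞] (T : MonoidalCategory 𝒞) (_ : SymmetricCategory 𝒞)
    (_ : MonoidalClosed 𝒞) (bot : 𝒞) : Prop :=
  ∀ A : 𝒞, IsIso (toBidual bot A)

/-- The structure of a BV-category with negation on a category `𝒞` with a symmetric monoidal
closed structure `T`, an object `bot`, and a second monoidal structure `S` (the tensor `◁`). -/
structure BVCategoryWithNegation (𝒞 : Type*) [Category 𝒞] (T : MonoidalCategory 𝒞)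
    (sym : SymmetricCategory 𝒞) (cl : MonoidalClosed 𝒞) (bot : 𝒞) (S : MonoidalCategory 𝒞)
    extends NormalDuoidal T S where
  starAutonomous : IsStarAutonomous 𝒞 T sym cl bot
  w_symm : ∀ A B C D : 𝒞,
    (sym.braiding (S.tensorObj A B) (S.tensorObj C D)).hom ≫ w C D A B =
      w A B C D ≫ S.tensorHom (sym.braiding A C).hom (sym.braiding B D).hom

/-!
All structure maps are the vector space ones, so coherence can be checked on elementary tensors, and
the content is that these maps are completely contractive.

For maps out of the projective and the Haagerup tensor products it suffices to bound the images of
`x ⊗ y` and `x ⊙ y` (`isCompleteContraction_proj`, `isCompleteContraction_haagerup`). The structure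
maps send such representatives to representatives of the same kind; in particular the weak
interchange sends `(a ⊙ b) ⊗ (c ⊙ d)` to `(a ⊗ c) ⊙ (b ⊗ d)` (`shuffle_proj_haagerup`).

Statements about duals need enough matricial functionals. Their common source is a Hilbert space
factorization, `TupleCost.exists_factorization`. Suppose that a bilinear form `F` satisfies
`2 Re ∑ F(vᵢ, wᵢ) ≤ C + D` whenever the tuples `v` and `w` have cost at most `C` and `D`, where a cost
is homogeneous, subadditive under concatenation, and stable under contractions acting on tuples. Then
`F(v, w) = ∑ G(v)ₛ H(w)ₛ` with `G` and `H` dominated by the costs. The Riesz extension theorem for cones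
gives quadratic forms dominating `F`, and a positive semidefinite matrix built from them and `F` is
decomposed into matrices of rank one. Operator spaces need not be represented on a Hilbert space
for this.

* Applied twice to a norming functional of a matrix space, it shows that norms are detected by
  completely contractive matrices of functionals (`exists_functionals_gnorm_le`). Hence the map into
  the bidual is a complete isometry, which is `*`-autonomy (`FdOS.isStarAutonomous`), and the
  injective tensor product can be computed by slicing on either side
  (`gnorm_cb_tensorToHom_comm`), which identifies it with the par.
* Applied to a completely contractive matrix of functionals on `X ⊗_h Y`, it gives the
  Christensen–Sinclair factorization `f(x ⊗ y) = g(x) h(y)` (`exists_bilinear_factorization`).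
  Slicing the shuffle of `x ⊙ y` by `f` is then the product of the slices of `x` by `g` and of `y` by
  `h`, and this bounds the second shuffle (`shuffle_haagerup_injTensor`).
-/

/-! ### Norms of rectangular matrices -/

namespace MatrixSpace

variable {X Y : Type*} [AddCommGroup X] [Module ℂ X] [AddCommGroup Y] [Module ℂ Y]
variable {ι κ ρ σ ι' κ' ρ' σ' : Type*}

lemma odot_submatrix [Fintype κ] (x : Matrix ι κ X) (y : Matrix κ ρ Y) (f : ι' → ι) (g : ρ' → ρ) :
    (odot x y).submatrix f g = odot (x.submatrix f id) (y.submatrix id g) := rfl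

lemma kron_submatrix (x : Matrix ι κ X) (y : Matrix ρ σ Y) (f : ι' → ι) (g : κ' → κ)
    (f' : ρ' → ρ) (g' : σ' → σ) : kron (x.submatrix f g) (y.submatrix f' g') =
      (kron x y).submatrix (Prod.map f f') (Prod.map g g') := rfl

lemma amplProd_submatrix (T : Matrix ι κ (X →ₗ[ℂ] Y)) (x : Matrix ρ σ X) (f : ι' → ι) (g : κ' → κ)
    (f' : ρ' → ρ) (g' : σ' → σ) : amplProd (T.submatrix f g) (x.submatrix f' g') =
      (amplProd T x).submatrix (Prod.map f' f) (Prod.map g' g) := rfl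

lemma opNorm_submatrix_le [Fintype ι] [Fintype κ] [Fintype ρ] [Fintype σ] [DecidableEq ι]
    [DecidableEq κ] [DecidableEq ρ] [DecidableEq σ] {f : ι → κ} {g : ρ → σ}
    (hf : Function.Injective f) (hg : Function.Injective g) (A : Matrix κ σ ℂ) :
    ‖A.submatrix f g‖ ≤ ‖A‖ := by
  have e : A.submatrix f g = (incl f).transpose * A * incl g := by
    ext i j; simp [Matrix.mul_apply, incl]
  rw [e]
  refine (Matrix.l2_opNorm_mul _ _).trans ?_
  refine (mul_le_of_le_one_right (norm_nonneg _) (opNorm_incl hg)).trans ?_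
  refine (Matrix.l2_opNorm_mul _ _).trans ?_
  exact mul_le_of_le_one_left (norm_nonneg _) (opNorm_transpose_incl hf)

lemma opNorm_transpose [Fintype ι] [Fintype κ] [DecidableEq ι] [DecidableEq κ]
    (A : Matrix ι κ ℂ) : ‖A.transpose‖ = ‖A‖ := by
  have key : ∀ {ι κ : Type _} [Fintype ι] [Fintype κ] [DecidableEq ι] [DecidableEq κ]
      (A : Matrix ι κ ℂ), ‖A.map star‖ ≤ ‖A‖ := by
    intro ι κ _ _ _ _ A
    refine opNorm_le_of_mulVec _ _ (norm_nonneg _) fun ξ => ?_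
    have h := Matrix.l2_opNorm_mulVec A (WithLp.toLp 2 (star ξ.ofLp))
    have e1 : ‖(WithLp.toLp 2 (star ξ.ofLp) : EuclideanSpace ℂ κ)‖ = ‖ξ‖ := by
      simp [EuclideanSpace.norm_eq]
    have e2 : (A.map star).mulVec ξ.ofLp = star (A.mulVec (star ξ.ofLp)) := by
      ext i; simp [Matrix.mulVec, dotProduct]
    rw [e1] at h
    refine le_trans (le_of_eq ?_) h
    rw [e2]
    simp [EuclideanSpace.norm_eq]
  have e : A.transpose = (A.map star).conjTranspose := by
    ext i j; simp
  rw [e, Matrix.l2_opNorm_conjTranspose]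
  refine le_antisymm (key A) ?_
  refine le_trans (le_of_eq ?_) (key (A.map star))
  congr 1
  ext i j; simp

end MatrixSpace

namespace OperatorSpaceStructure

variable {X Y : Type*} [AddCommGroup X] [Module ℂ X] [AddCommGroup Y] [Module ℂ Y]
variable (s : OperatorSpaceStructure X) (t : OperatorSpaceStructure Y)
variable {ι κ ρ σ : Type*} [Fintype ι] [Fintype κ] [Fintype ρ] [Fintype σ]
  [DecidableEq ι] [DecidableEq κ] [DecidableEq ρ] [DecidableEq σ]

/-- Every rectangular matrix is a submatrix of a square one of the same norm, obtained by padding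
with zeros. -/
lemma exists_square (x : Matrix ι κ X) : ∃ (N : ℕ) (f : ι → Fin N) (g : κ → Fin N)
    (z : Matrix (Fin N) (Fin N) X), Function.Injective f ∧ Function.Injective g ∧
      x = z.submatrix f g ∧ s.norm N z = s.gnorm x ∧
      z = lmul (incl f) (rmul x (incl g).transpose) := by
  obtain ⟨N, f, g, hf, hg, h⟩ := s.gnorm_eq x
  refine ⟨N, f, g, _, hf, hg, ?_, h.symm, rfl⟩
  rw [submatrix_eq]
  simp only [← lmul_rmul, rmul_rmul, lmul_lmul, incl_transpose_mul hf, incl_transpose_mul hg,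
    lmul_one, rmul_one]

lemma gnorm_complex (A : Matrix ι κ ℂ) : complex.gnorm A = ‖A‖ := by
  obtain ⟨N, f, g, z, hf, hg, hA, hz, hz'⟩ := complex.exists_square A
  rw [← hz]
  have e : z = incl f * A * (incl g).transpose := by
    rw [hz', lmul_rmul]
    ext i j
    simp [lmul, rmul, Matrix.mul_apply, mul_comm]
  apply le_antisymm
  · change ‖z‖ ≤ _
    rw [e]
    refine (Matrix.l2_opNorm_mul _ _).trans ?_
    refine (mul_le_of_le_one_right (_root_.norm_nonneg _) (opNorm_transpose_incl hg)).trans ?_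
    refine (Matrix.l2_opNorm_mul _ _).trans ?_
    exact mul_le_of_le_one_left (_root_.norm_nonneg _) (opNorm_incl hf)
  · rw [hA]
    exact opNorm_submatrix_le hf hg z

end OperatorSpaceStructure

lemma IsCompleteContraction.gnorm_map_le {X Y : Type*} [AddCommGroup X] [Module ℂ X]
    [AddCommGroup Y] [Module ℂ Y] {s : OperatorSpaceStructure X} {t : OperatorSpaceStructure Y}
    {φ : X →ₗ[ℂ] Y} (h : IsCompleteContraction s t φ) {ι κ : Type*} [Fintype ι] [Fintype κ]
    [DecidableEq ι] [DecidableEq κ] (x : Matrix ι κ X) : t.gnorm (x.map φ) ≤ s.gnorm x := by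
  obtain ⟨N, f, g, z, hf, hg, hx, hz, -⟩ := s.exists_square x
  rw [← hz]
  refine le_trans ?_ (h N z)
  rw [← OperatorSpaceStructure.gnorm_fin, hx]
  exact t.gnorm_submatrix_le hf hg (z.map φ)

namespace OperatorSpaceStructure

variable {X Y : Type*} [AddCommGroup X] [Module ℂ X] [AddCommGroup Y] [Module ℂ Y]
variable (s : OperatorSpaceStructure X) (t : OperatorSpaceStructure Y)
variable {ι κ ρ σ : Type*} [Fintype ι] [Fintype κ] [Fintype ρ] [Fintype σ]
  [DecidableEq ι] [DecidableEq κ] [DecidableEq ρ] [DecidableEq σ]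

section haagerup

variable [FiniteDimensional ℂ X] [FiniteDimensional ℂ Y]

lemma gnorm_odot_le {κ : Type} [Fintype κ] [DecidableEq κ] (x : Matrix ι κ X)
    (y : Matrix κ ρ Y) : (haagerup s t).gnorm (odot x y) ≤ s.gnorm x * t.gnorm y := by
  obtain ⟨N, f, g, z, hf, hg, -, hz, hz'⟩ := (haagerup s t).exists_square (odot x y)
  rw [← hz, haagerup_norm]
  refine (csInf_le ⟨0, fun c hc => haagerupCosts_nonneg s t hc⟩
    (mem_haagerupCosts s t (lmul (incl f) x) (rmul y (incl g).transpose) ?_)).trans ?_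
  · rw [hz', odot_lmul, odot_rmul]
  · refine mul_le_mul ((s.gnorm_lmul_le _ _).trans ?_) ((t.gnorm_rmul_le _ _).trans ?_)
      (t.gnorm_nonneg _) (s.gnorm_nonneg _)
    · exact mul_le_of_le_one_left (s.gnorm_nonneg _) (opNorm_incl hf)
    · exact mul_le_of_le_one_right (t.gnorm_nonneg _) (opNorm_transpose_incl hg)

lemma haagerupCosts_nonempty {n : ℕ} (v : Matrix (Fin n) (Fin n) (X ⊗[ℂ] Y)) :
    (haagerupCosts s t n v).Nonempty := by
  -- An empty set has infimum `0`, so that `v = 0`; but `0` has the empty representation.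
  by_contra h
  rw [Set.not_nonempty_iff_eq_empty] at h
  have h0 : v = 0 := (haagerup s t).eq_zero_of_norm_eq_zero v (by
    rw [haagerup_norm, h, Real.sInf_empty])
  have : (haagerupCosts s t n v).Nonempty :=
    ⟨_, 0, 0, 0, by rw [h0]; ext i j; simp [odot], rfl⟩
  rw [h] at this
  exact Set.not_nonempty_empty this

/-- Tensors have balanced representations for every bound strictly above their Haagerup norm. -/
lemma exists_odot (v : Matrix ι ρ (X ⊗[ℂ] Y)) {K : ℝ} (hK : (haagerup s t).gnorm v < K) :
    ∃ (r : ℕ) (x : Matrix ι (Fin r) X) (y : Matrix (Fin r) ρ Y),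
      v = odot x y ∧ s.gnorm x ≤ √K ∧ t.gnorm y ≤ √K := by
  obtain ⟨N, f, g, z, hf, hg, hv, hz, -⟩ := (haagerup s t).exists_square v
  rw [← hz, haagerup_norm] at hK
  obtain ⟨c, hc, hcK⟩ := exists_lt_of_csInf_lt (haagerupCosts_nonempty s t z) hK
  obtain ⟨r, x, y, h, hx, hy⟩ := haagerup_normalize s t hc
  refine ⟨r, x.submatrix f id, y.submatrix id g, ?_, ?_, ?_⟩
  · rw [hv, h, odot_submatrix]
  · exact (s.gnorm_submatrix_le hf Function.injective_id x).trans
      (hx.trans (Real.sqrt_le_sqrt hcK.le))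
  · exact (t.gnorm_submatrix_le Function.injective_id hg y).trans
      (hy.trans (Real.sqrt_le_sqrt hcK.le))

end haagerup

section proj

variable [FiniteDimensional ℂ X] [FiniteDimensional ℂ Y]

lemma gnorm_kron_le (x : Matrix ι κ X) (y : Matrix ρ σ Y) :
    (projTensor s t).gnorm (kron x y) ≤ s.gnorm x * t.gnorm y := by
  obtain ⟨N, f, g, z, hf, hg, hx, hz, -⟩ := s.exists_square x
  obtain ⟨M, f', g', z', hf', hg', hy, hz', -⟩ := t.exists_square y
  rw [← hz, ← hz']
  have h1 : (projTensor s t).gnorm (kron x y) ≤ (projTensor s t).gnorm (kron z z') := by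
    rw [hx, hy, kron_submatrix]
    exact gnorm_submatrix_le _ (hf.prodMap hf') (hg.prodMap hg') _
  refine h1.trans ?_
  rw [← gnorm_submatrix_equiv _ finProdFinEquiv.symm finProdFinEquiv.symm, gnorm_fin,
    projTensor_norm]
  obtain ⟨c, hc, hc'⟩ := mem_projCosts s t z z' (incl finProdFinEquiv.symm).transpose
    (incl finProdFinEquiv.symm) (submatrix_eq finProdFinEquiv.symm finProdFinEquiv.symm (kron z z'))
  refine (csInf_le ⟨0, fun c hc => projCosts_nonneg s t hc⟩ hc).trans (hc'.trans ?_)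
  have h2 := opNorm_incl (finProdFinEquiv (m := N) (n := M)).symm.injective
  have h3 := opNorm_transpose_incl (finProdFinEquiv (m := N) (n := M)).symm.injective
  have h4 := s.gnorm_nonneg z
  have h5 := t.gnorm_nonneg z'
  rw [gnorm_fin] at h4 h5 ⊢
  rw [gnorm_fin]
  calc _ ≤ 1 * s.norm N z * t.norm M z' * 1 := by gcongr
    _ = _ := by ring

lemma projCosts_nonempty {n : ℕ} (v : Matrix (Fin n) (Fin n) (X ⊗[ℂ] Y)) :
    (projCosts s t n v).Nonempty := by
  -- As above: an empty set would force `v = 0`, which has the empty representation.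
  by_contra h
  rw [Set.not_nonempty_iff_eq_empty] at h
  have h0 : v = 0 := (projTensor s t).eq_zero_of_norm_eq_zero v (by
    rw [projTensor_norm, h, Real.sInf_empty])
  have : (projCosts s t n v).Nonempty :=
    ⟨_, 0, 0, 0, 0, 0, 0, by rw [h0]; ext i j; simp [lmul], rfl⟩
  rw [h] at this
  exact Set.not_nonempty_empty this

/-- Tensors have normalized representations for every bound strictly above their projective norm. -/
lemma exists_kron (v : Matrix ι κ (X ⊗[ℂ] Y)) {K : ℝ} (hK : (projTensor s t).gnorm v < K) :
    ∃ (p q : ℕ) (x : Matrix (Fin p) (Fin p) X) (y : Matrix (Fin q) (Fin q) Y)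
      (α : Matrix ι (Fin p × Fin q) ℂ) (β : Matrix (Fin p × Fin q) κ ℂ),
      v = lmul α (rmul (kron x y) β) ∧ s.gnorm x ≤ 1 ∧ t.gnorm y ≤ 1 ∧ ‖α‖ ≤ √K ∧ ‖β‖ ≤ √K := by
  obtain ⟨N, f, g, z, hf, hg, hv, hz, -⟩ := (projTensor s t).exists_square v
  rw [← hz, projTensor_norm] at hK
  obtain ⟨c, hc, hcK⟩ := exists_lt_of_csInf_lt (projCosts_nonempty s t z) hK
  obtain ⟨p, q, x, y, α, β, h, hx, hy, hα, hβ⟩ := proj_normalize s t hc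
  refine ⟨p, q, x, y, α.submatrix f id, β.submatrix id g, ?_, hx, hy, ?_, ?_⟩
  · rw [hv, h]; rfl
  · exact (opNorm_submatrix_le hf Function.injective_id α).trans
      (hα.trans (Real.sqrt_le_sqrt hcK.le))
  · exact (opNorm_submatrix_le Function.injective_id hg β).trans
      (hβ.trans (Real.sqrt_le_sqrt hcK.le))

end proj

section cb

variable [FiniteDimensional ℂ X]

lemma gnorm_amplProd_le (T : Matrix ι κ (X →ₗ[ℂ] Y)) (x : Matrix ρ σ X) :
    t.gnorm (amplProd T x) ≤ (cb s t).gnorm T * s.gnorm x := by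
  obtain ⟨N, f, g, z, hf, hg, hx, hz, -⟩ := s.exists_square x
  obtain ⟨M, f', g', S, hf', hg', hT, hS, -⟩ := (cb s t).exists_square T
  rw [← hz, ← hS]
  have h1 : t.gnorm (amplProd T x) ≤ t.gnorm (amplProd S z) := by
    rw [hx, hT, amplProd_submatrix]
    exact gnorm_submatrix_le _ (hf.prodMap hf') (hg.prodMap hg') _
  refine h1.trans ?_
  have h2 : ∀ w : Matrix (Fin N) (Fin N) X, s.norm N w ≤ 1 →
      t.gnorm (amplProd S w) ≤ (cb s t).norm M S := fun w hw => by
    refine le_csSup (cbSet_bddAbove s t S) ⟨N, w, hw, ?_⟩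
    rw [← gnorm_fin, ampl, gnorm_submatrix_equiv]
  by_cases h0 : s.norm N z = 0
  · rw [s.eq_zero_of_norm_eq_zero z h0, s.norm_zero, mul_zero]
    have : amplProd S (0 : Matrix (Fin N) (Fin N) X) = 0 := by ext i j; simp [amplProd]
    rw [this, gnorm_zero]
  · have hpos : 0 < s.norm N z := lt_of_le_of_ne (s.norm_nonneg z) (Ne.symm h0)
    have hc : ‖(((s.norm N z)⁻¹ : ℝ) : ℂ)‖ = (s.norm N z)⁻¹ := by
      rw [Complex.norm_real, Real.norm_of_nonneg (inv_nonneg.2 hpos.le)]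
    have h3 := h2 ((((s.norm N z)⁻¹ : ℝ) : ℂ) • z) (by
      rw [s.norm_smul, hc, inv_mul_cancel₀ h0])
    have e : amplProd S ((((s.norm N z)⁻¹ : ℝ) : ℂ) • z) =
        (((s.norm N z)⁻¹ : ℝ) : ℂ) • amplProd S z := by
      ext i j; simp [amplProd]
    rw [e, gnorm_smul, hc, inv_mul_le_iff₀ hpos] at h3
    rwa [mul_comm]

lemma gnorm_cb_le (T : Matrix ι κ (X →ₗ[ℂ] Y)) {K : ℝ}
    (h : ∀ (k : ℕ) (x : Matrix (Fin k) (Fin k) X), s.gnorm x ≤ 1 → t.gnorm (amplProd T x) ≤ K) :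
    (cb s t).gnorm T ≤ K := by
  obtain ⟨M, f', g', S, hf', hg', hT, hS, hS'⟩ := (cb s t).exists_square T
  rw [← hS]
  refine csSup_le (cbSet_nonempty s t _) ?_
  rintro c ⟨k, x, hx, rfl⟩
  rw [← gnorm_fin] at hx
  refine le_trans ?_ (h k x hx)
  have e : amplProd S x =
      lmul (Matrix.kroneckerMap (· * ·) (1 : Matrix (Fin k) (Fin k) ℂ) (incl f'))
        (rmul (amplProd T x) (Matrix.kroneckerMap (· * ·) (1 : Matrix (Fin k) (Fin k) ℂ)
          (incl g').transpose)) := by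
    rw [hS']
    ext ⟨p, i⟩ ⟨q, j⟩
    simp [amplProd, lmul, rmul, Fintype.sum_prod_type, Matrix.one_apply, ite_smul,
      Finset.sum_ite_eq]
  rw [← gnorm_fin, ampl, gnorm_submatrix_equiv, e]
  refine (t.gnorm_mul_le _ _ _).trans ?_
  have h1 : ‖Matrix.kroneckerMap (· * ·) (1 : Matrix (Fin k) (Fin k) ℂ) (incl f')‖ ≤ 1 :=
    (opNorm_kronecker _ _).trans (mul_le_one₀ opNorm_one_le (_root_.norm_nonneg _)
      (opNorm_incl hf'))
  have h2 : ‖Matrix.kroneckerMap (· * ·) (1 : Matrix (Fin k) (Fin k) ℂ) (incl g').transpose‖ ≤ 1 :=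
    (opNorm_kronecker _ _).trans (mul_le_one₀ opNorm_one_le (_root_.norm_nonneg _)
      (opNorm_transpose_incl hg'))
  have h3 := t.gnorm_nonneg (amplProd T x)
  calc _ ≤ 1 * t.gnorm (amplProd T x) * 1 := by gcongr
    _ = _ := by ring

end cb

/-- Amplifying `x` to the block diagonal matrix `1 ⊗ x` does not increase its norm. -/
lemma gnorm_blockDiagonal_le {κ σ : Type} [Fintype κ] [Fintype σ] [DecidableEq κ] [DecidableEq σ]
    (x : Matrix κ σ X) :
    s.gnorm (Matrix.of fun p q => if p.1 = q.1 then x p.2 q.2 else 0 :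
      Matrix (ι × κ) (ι × σ) X) ≤ s.gnorm x := by
  have key : ∀ n : ℕ, s.gnorm (Matrix.of fun p q => if p.1 = q.1 then x p.2 q.2 else 0 :
      Matrix (Fin n × κ) (Fin n × σ) X) ≤ s.gnorm x := by
    intro n
    induction n with
    | zero =>
      have : (Matrix.of fun p q => if p.1 = q.1 then x p.2 q.2 else 0 :
          Matrix (Fin 0 × κ) (Fin 0 × σ) X) = 0 := by
        ext i; exact i.1.elim0
      rw [this, gnorm_zero]; exact s.gnorm_nonneg _
    | succ n ih =>
      let e : ∀ τ : Type, (Fin n × τ) ⊕ τ → Fin (n + 1) × τ := fun τ =>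
        Sum.elim (fun p => (p.1.castSucc, p.2)) (fun t => (Fin.last n, t))
      have he : ∀ τ : Type, Function.Bijective (e τ) := by
        intro τ
        constructor
        · rintro (⟨a, b⟩ | b) (⟨c, d⟩ | d) h
          · simp only [e, Sum.elim_inl, Prod.mk.injEq, Fin.castSucc_inj] at h
            rw [h.1, h.2]
          · simp only [e, Sum.elim_inl, Sum.elim_inr, Prod.mk.injEq] at h
            exact absurd h.1 (Fin.castSucc_lt_last a).ne
          · simp only [e, Sum.elim_inl, Sum.elim_inr, Prod.mk.injEq] at h
            exact absurd h.1.symm (Fin.castSucc_lt_last c).ne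
          · simp only [e, Sum.elim_inr, Prod.mk.injEq, true_and] at h
            rw [h]
        · rintro ⟨a, b⟩
          refine Fin.lastCases ?_ (fun a => ?_) a
          · exact ⟨Sum.inr b, rfl⟩
          · exact ⟨Sum.inl (a, b), rfl⟩
      rw [← s.gnorm_submatrix_equiv (Equiv.ofBijective _ (he κ)) (Equiv.ofBijective _ (he σ))]
      refine le_trans (le_of_eq ?_) ((s.gnorm_fromBlocks_le _ x).trans (max_le ih le_rfl))
      congr 1
      ext (⟨a, b⟩ | b) (⟨c, d⟩ | d)
      · simp [e]
      · simp [e, (Fin.castSucc_lt_last a).ne]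
      · simp [e, (Fin.castSucc_lt_last c).ne']
      · simp [e]
  rw [← s.gnorm_submatrix_equiv ((Fintype.equivFin ι).symm.prodCongr (Equiv.refl κ))
    ((Fintype.equivFin ι).symm.prodCongr (Equiv.refl σ))]
  refine le_trans (le_of_eq ?_) (key (Fintype.card ι))
  congr 1
  ext ⟨a, b⟩ ⟨c, d⟩
  simp

end OperatorSpaceStructure

/-! ### The tensor products as monoidal structures -/

lemma IsCompleteContraction.of_lt {X Y : Type*} [AddCommGroup X] [Module ℂ X] [AddCommGroup Y]
    [Module ℂ Y] {s : OperatorSpaceStructure X} {t : OperatorSpaceStructure Y} {φ : X →ₗ[ℂ] Y}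
    (h : ∀ (n : ℕ) (x : Matrix (Fin n) (Fin n) X) (K : ℝ), s.gnorm x < K →
      t.gnorm (x.map φ) ≤ K) : IsCompleteContraction s t φ := by
  intro n x
  rw [← OperatorSpaceStructure.gnorm_fin, ← OperatorSpaceStructure.gnorm_fin]
  exact le_of_forall_gt_imp_ge_of_dense fun K hK => h n x K hK

namespace OperatorSpaceStructure

variable {X Y Z W : Type*} [AddCommGroup X] [Module ℂ X] [AddCommGroup Y] [Module ℂ Y]
  [AddCommGroup Z] [Module ℂ Z] [AddCommGroup W] [Module ℂ W]
  [FiniteDimensional ℂ X] [FiniteDimensional ℂ Y] [FiniteDimensional ℂ Z]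
  [FiniteDimensional ℂ W]
variable (s : OperatorSpaceStructure X) (t : OperatorSpaceStructure Y)
  (u : OperatorSpaceStructure Z) (r : OperatorSpaceStructure W)

/-- A map out of `X ⊗^ Y` is a complete contraction as soon as it maps all `x ⊗ y` with `x`, `y` in
matricial unit balls to contractions. -/
lemma isCompleteContraction_proj {φ : X ⊗[ℂ] Y →ₗ[ℂ] Z}
    (h : ∀ (p q : ℕ) (x : Matrix (Fin p) (Fin p) X) (y : Matrix (Fin q) (Fin q) Y),
      u.gnorm ((kron x y).map φ) ≤ s.gnorm x * t.gnorm y) :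
    IsCompleteContraction (projTensor s t) u φ := by
  refine IsCompleteContraction.of_lt fun n v K hK => ?_
  have hK0 : 0 ≤ K := ((projTensor s t).gnorm_nonneg v).trans hK.le
  obtain ⟨p, q, x, y, α, β, rfl, hx, hy, hα, hβ⟩ := exists_kron s t v hK
  rw [map_lmul, map_rmul]
  refine (u.gnorm_mul_le _ _ _).trans ?_
  have h1 : u.gnorm ((kron x y).map φ) ≤ 1 :=
    (h p q x y).trans (mul_le_one₀ hx (t.gnorm_nonneg _) hy)
  have h2 := u.gnorm_nonneg ((kron x y).map φ)
  calc _ ≤ √K * 1 * √K := by gcongr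
    _ = K := by rw [mul_one, Real.mul_self_sqrt hK0]

/-- A map out of `X ⊗_h Y` is a complete contraction as soon as it maps all `x ⊙ y` with `x`, `y`
in matricial unit balls to contractions. -/
lemma isCompleteContraction_haagerup {φ : X ⊗[ℂ] Y →ₗ[ℂ] Z}
    (h : ∀ (n r : ℕ) (x : Matrix (Fin n) (Fin r) X) (y : Matrix (Fin r) (Fin n) Y),
      u.gnorm ((odot x y).map φ) ≤ s.gnorm x * t.gnorm y) :
    IsCompleteContraction (haagerup s t) u φ := by
  refine IsCompleteContraction.of_lt fun n v K hK => ?_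
  have hK0 : 0 ≤ K := ((haagerup s t).gnorm_nonneg v).trans hK.le
  obtain ⟨r, x, y, rfl, hx, hy⟩ := exists_odot s t v hK
  refine (h n r x y).trans ?_
  exact (mul_le_mul hx hy (t.gnorm_nonneg _) (Real.sqrt_nonneg _)).trans
    (Real.mul_self_sqrt hK0).le

lemma proj_map {f : X →ₗ[ℂ] Z} {g : Y →ₗ[ℂ] W} (hf : IsCompleteContraction s u f)
    (hg : IsCompleteContraction t r g) :
    IsCompleteContraction (projTensor s t) (projTensor u r) (TensorProduct.map f g) := by
  refine isCompleteContraction_proj s t _ fun p q x y => ?_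
  have e : (kron x y).map (TensorProduct.map f g) = kron (x.map f) (y.map g) := rfl
  rw [e]
  exact (gnorm_kron_le u r _ _).trans (mul_le_mul (hf.gnorm_map_le x) (hg.gnorm_map_le y)
    (r.gnorm_nonneg _) (s.gnorm_nonneg _))

lemma haagerup_map {f : X →ₗ[ℂ] Z} {g : Y →ₗ[ℂ] W} (hf : IsCompleteContraction s u f)
    (hg : IsCompleteContraction t r g) :
    IsCompleteContraction (haagerup s t) (haagerup u r) (TensorProduct.map f g) := by
  refine isCompleteContraction_haagerup s t _ fun n k x y => ?_
  have e : (odot x y).map (TensorProduct.map f g) = odot (x.map f) (y.map g) := by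
    ext i j; simp [odot]
  rw [e]
  exact (gnorm_odot_le u r _ _).trans (mul_le_mul (hf.gnorm_map_le x) (hg.gnorm_map_le y)
    (r.gnorm_nonneg _) (s.gnorm_nonneg _))

lemma proj_assoc : IsCompleteContraction (projTensor (projTensor s t) u)
    (projTensor s (projTensor t u)) (TensorProduct.assoc ℂ X Y Z).toLinearMap := by
  refine isCompleteContraction_proj _ _ _ fun p q v z => ?_
  refine le_mul_of_forall_lt₀ fun K hK L hL => le_trans ?_ (mul_le_mul_of_nonneg_left hL.le
    (((projTensor s t).gnorm_nonneg v).trans hK.le))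
  have hK0 : 0 ≤ K := ((projTensor s t).gnorm_nonneg v).trans hK.le
  obtain ⟨k, l, x, y, α, β, rfl, hx, hy, hα, hβ⟩ := exists_kron s t v hK
  let e := Equiv.prodAssoc (Fin k) (Fin l) (Fin q)
  have e1 : (kron (lmul α (rmul (kron x y) β)) z).map (TensorProduct.assoc ℂ X Y Z) =
      lmul (Matrix.kroneckerMap (· * ·) α (1 : Matrix (Fin q) (Fin q) ℂ))
        (rmul ((kron x (kron y z)).submatrix e e)
          (Matrix.kroneckerMap (· * ·) β (1 : Matrix (Fin q) (Fin q) ℂ))) := by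
    rw [lmul_rmul, lmul_rmul]
    ext ⟨a, b⟩ ⟨c, d⟩
    simp only [Matrix.map_apply, kron, lmul, rmul, Matrix.of_apply, Matrix.submatrix_apply,
      TensorProduct.sum_tmul, map_sum, Finset.smul_sum, ← TensorProduct.smul_tmul', map_smul,
      Matrix.kroneckerMap_apply, Fintype.sum_prod_type, Matrix.one_apply, mul_ite, mul_one,
      mul_zero, ite_smul, zero_smul, Finset.sum_ite_eq,
      Finset.mem_univ, if_true, TensorProduct.assoc_tmul]
    simp [e]
  have e2 := (projTensor s (projTensor t u)).gnorm_submatrix_equiv e e (kron x (kron y z))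
  refine le_trans (le_of_eq (congrArg _ e1)) ((gnorm_mul_le _ _ _ _).trans ?_)
  rw [e2]
  have h1 : ‖Matrix.kroneckerMap (· * ·) α (1 : Matrix (Fin q) (Fin q) ℂ)‖ ≤ √K :=
    (opNorm_kronecker _ _).trans ((mul_le_of_le_one_right (_root_.norm_nonneg _)
      opNorm_one_le).trans hα)
  have h2 : ‖Matrix.kroneckerMap (· * ·) β (1 : Matrix (Fin q) (Fin q) ℂ)‖ ≤ √K :=
    (opNorm_kronecker _ _).trans ((mul_le_of_le_one_right (_root_.norm_nonneg _)
      opNorm_one_le).trans hβ)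
  have h3 : (projTensor s (projTensor t u)).gnorm (kron x (kron y z)) ≤ u.gnorm z := by
    refine (gnorm_kron_le s (projTensor t u) _ _).trans ?_
    refine (mul_le_of_le_one_left (gnorm_nonneg _ _) hx).trans ?_
    refine (gnorm_kron_le t u _ _).trans ?_
    exact mul_le_of_le_one_left (gnorm_nonneg _ _) hy
  have h4 := (projTensor s (projTensor t u)).gnorm_nonneg (kron x (kron y z))
  calc _ ≤ √K * u.gnorm z * √K := by
        have := u.gnorm_nonneg z
        gcongr
    _ = √K * √K * u.gnorm z := by ring
    _ = _ := by rw [Real.mul_self_sqrt hK0]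

lemma proj_comm : IsCompleteContraction (projTensor s t) (projTensor t s)
    (TensorProduct.comm ℂ X Y).toLinearMap := by
  refine isCompleteContraction_proj _ _ _ fun p q x y => ?_
  have e := (projTensor t s).gnorm_submatrix_equiv (Equiv.prodComm (Fin p) (Fin q))
    (Equiv.prodComm (Fin p) (Fin q)) (kron y x)
  have e' : (kron x y).map (TensorProduct.comm ℂ X Y).toLinearMap =
    (kron y x).submatrix (Equiv.prodComm (Fin p) (Fin q)) (Equiv.prodComm (Fin p) (Fin q)) := rfl
  rw [e', e, mul_comm]
  exact gnorm_kron_le t s y x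

lemma isCompleteContraction_comp {s : OperatorSpaceStructure X} {t : OperatorSpaceStructure Y}
    {u : OperatorSpaceStructure Z} {f : X →ₗ[ℂ] Y} {g : Y →ₗ[ℂ] Z}
    (hg : IsCompleteContraction t u g) (hf : IsCompleteContraction s t f) :
    IsCompleteContraction s u (g ∘ₗ f) := fun n x => (hg n (x.map f)).trans (hf n x)

lemma isCompleteContraction_id : IsCompleteContraction s s LinearMap.id := fun n x => le_rfl

lemma proj_assoc_symm : IsCompleteContraction (projTensor s (projTensor t u))
    (projTensor (projTensor s t) u) (TensorProduct.assoc ℂ X Y Z).symm.toLinearMap := by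
  -- The inverse associator is the associator conjugated by the symmetry.
  have e : (TensorProduct.assoc ℂ X Y Z).symm.toLinearMap =
      (TensorProduct.comm ℂ Z (X ⊗[ℂ] Y)).toLinearMap ∘ₗ
      TensorProduct.map LinearMap.id (TensorProduct.comm ℂ Y X).toLinearMap ∘ₗ
      (TensorProduct.assoc ℂ Z Y X).toLinearMap ∘ₗ
      TensorProduct.map (TensorProduct.comm ℂ Y Z).toLinearMap LinearMap.id ∘ₗ
      (TensorProduct.comm ℂ X (Y ⊗[ℂ] Z)).toLinearMap :=
    FdOS.ext_right fun x y z => rfl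
  rw [e]
  refine isCompleteContraction_comp (proj_comm u (projTensor s t)) ?_
  refine isCompleteContraction_comp (proj_map _ _ _ _ (isCompleteContraction_id u)
    (proj_comm t s)) ?_
  refine isCompleteContraction_comp (proj_assoc u t s) ?_
  exact isCompleteContraction_comp (proj_map _ _ _ _ (proj_comm t u)
    (isCompleteContraction_id s)) (proj_comm s (projTensor t u))

lemma proj_lid : IsCompleteContraction (projTensor complex s) s
    (TensorProduct.lid ℂ X).toLinearMap := by
  refine isCompleteContraction_proj _ _ _ fun p q a x => ?_
  have e : (kron a x).map (TensorProduct.lid ℂ X).toLinearMap =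
      lmul (Matrix.kroneckerMap (· * ·) a (1 : Matrix (Fin q) (Fin q) ℂ))
        (Matrix.of fun p q => if p.1 = q.1 then x p.2 q.2 else 0) := by
    ext ⟨i, j⟩ ⟨k, l⟩
    simp [kron, lmul, Fintype.sum_prod_type, Matrix.one_apply]
  rw [e, gnorm_complex]
  refine (s.gnorm_lmul_le _ _).trans (mul_le_mul ?_ (s.gnorm_blockDiagonal_le x)
    (s.gnorm_nonneg _) (_root_.norm_nonneg _))
  exact (opNorm_kronecker _ _).trans (mul_le_of_le_one_right (_root_.norm_nonneg _) opNorm_one_le)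

lemma gnorm_complex_one_le : complex.gnorm (1 : Matrix (Fin 1) (Fin 1) ℂ) ≤ 1 := by
  rw [gnorm_complex]
  exact opNorm_one_le

lemma proj_lid_symm : IsCompleteContraction s (projTensor complex s)
    (TensorProduct.lid ℂ X).symm.toLinearMap := by
  intro n x
  rw [← gnorm_fin, ← gnorm_fin]
  have e := (projTensor complex s).gnorm_submatrix_equiv (Equiv.uniqueProd (Fin n) (Fin 1)).symm
    (Equiv.uniqueProd (Fin n) (Fin 1)).symm (kron (1 : Matrix (Fin 1) (Fin 1) ℂ) x)
  have e' : x.map (TensorProduct.lid ℂ X).symm.toLinearMap =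
      (kron (1 : Matrix (Fin 1) (Fin 1) ℂ) x).submatrix (Equiv.uniqueProd (Fin n) (Fin 1)).symm
        (Equiv.uniqueProd (Fin n) (Fin 1)).symm := by
    ext i j
    simp [kron]
  rw [e', e]
  exact (gnorm_kron_le complex s _ _).trans
    (mul_le_of_le_one_left (s.gnorm_nonneg _) gnorm_complex_one_le)

lemma haagerup_assoc : IsCompleteContraction (haagerup (haagerup s t) u)
    (haagerup s (haagerup t u)) (TensorProduct.assoc ℂ X Y Z).toLinearMap := by
  refine isCompleteContraction_haagerup _ _ _ fun n k v z => ?_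
  refine le_mul_of_forall_lt₀ fun K hK L hL => le_trans ?_ (mul_le_mul_of_nonneg_left hL.le
    (((haagerup s t).gnorm_nonneg v).trans hK.le))
  have hK0 : 0 ≤ K := ((haagerup s t).gnorm_nonneg v).trans hK.le
  obtain ⟨l, x, y, rfl, hx, hy⟩ := exists_odot s t v hK
  have e : (odot (odot x y) z).map (TensorProduct.assoc ℂ X Y Z).toLinearMap =
      odot x (odot y z) := by
    ext i j
    simp only [odot, Matrix.map_apply, Matrix.of_apply, TensorProduct.sum_tmul, map_sum,
      TensorProduct.tmul_sum, LinearEquiv.coe_coe, TensorProduct.assoc_tmul]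
    rw [Finset.sum_comm]
  rw [e]
  refine (gnorm_odot_le s (haagerup t u) _ _).trans ?_
  have h1 := gnorm_odot_le t u y z
  have h2 := (haagerup t u).gnorm_nonneg (odot y z)
  have h3 := u.gnorm_nonneg z
  calc _ ≤ √K * (√K * u.gnorm z) := by gcongr; exact h1.trans (by gcongr)
    _ = √K * √K * u.gnorm z := by ring
    _ = _ := by rw [Real.mul_self_sqrt hK0]

lemma haagerup_assoc_symm : IsCompleteContraction (haagerup s (haagerup t u))
    (haagerup (haagerup s t) u) (TensorProduct.assoc ℂ X Y Z).symm.toLinearMap := by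
  refine isCompleteContraction_haagerup _ _ _ fun n k x v => ?_
  refine le_mul_of_forall_lt₀ fun L hL K hK => le_trans ?_ (mul_le_mul_of_nonneg_right hL.le
    (((haagerup t u).gnorm_nonneg v).trans hK.le))
  have hK0 : 0 ≤ K := ((haagerup t u).gnorm_nonneg v).trans hK.le
  obtain ⟨l, y, z, rfl, hy, hz⟩ := exists_odot t u v hK
  have e : (odot x (odot y z)).map (TensorProduct.assoc ℂ X Y Z).symm.toLinearMap =
      odot (odot x y) z := by
    ext i j
    simp only [odot, Matrix.map_apply, Matrix.of_apply, TensorProduct.sum_tmul, map_sum,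
      TensorProduct.tmul_sum, LinearEquiv.coe_coe, TensorProduct.assoc_symm_tmul]
    rw [Finset.sum_comm]
  rw [e]
  refine (gnorm_odot_le (haagerup s t) u _ _).trans ?_
  have h1 := gnorm_odot_le s t x y
  have h2 := (haagerup s t).gnorm_nonneg (odot x y)
  have h3 := s.gnorm_nonneg x
  have h4 := u.gnorm_nonneg z
  calc _ ≤ (s.gnorm x * √K) * √K := by gcongr; exact h1.trans (by gcongr)
    _ = s.gnorm x * (√K * √K) := by ring
    _ = _ := by rw [Real.mul_self_sqrt hK0]

lemma haagerup_lid : IsCompleteContraction (haagerup complex s) s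
    (TensorProduct.lid ℂ X).toLinearMap := by
  refine isCompleteContraction_haagerup _ _ _ fun n k a x => ?_
  have e : (odot a x).map (TensorProduct.lid ℂ X).toLinearMap = lmul a x := by
    ext i j; simp [odot, lmul]
  rw [e, gnorm_complex]
  exact s.gnorm_lmul_le a x

lemma haagerup_rid : IsCompleteContraction (haagerup s complex) s
    (TensorProduct.rid ℂ X).toLinearMap := by
  refine isCompleteContraction_haagerup _ _ _ fun n k x a => ?_
  have e : (odot x a).map (TensorProduct.rid ℂ X).toLinearMap = rmul x a := by
    ext i j; simp [odot, rmul]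
  rw [e, gnorm_complex]
  exact s.gnorm_rmul_le x a

lemma haagerup_lid_symm : IsCompleteContraction s (haagerup complex s)
    (TensorProduct.lid ℂ X).symm.toLinearMap := by
  intro n x
  rw [← gnorm_fin, ← gnorm_fin]
  have e : x.map (TensorProduct.lid ℂ X).symm.toLinearMap =
      odot (1 : Matrix (Fin n) (Fin n) ℂ) x := by
    ext i j
    simp [odot, Matrix.one_apply, TensorProduct.ite_tmul]
  rw [e]
  refine (gnorm_odot_le complex s _ _).trans (mul_le_of_le_one_left (s.gnorm_nonneg _) ?_)
  rw [gnorm_complex]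
  exact opNorm_one_le

lemma haagerup_rid_symm : IsCompleteContraction s (haagerup s complex)
    (TensorProduct.rid ℂ X).symm.toLinearMap := by
  intro n x
  rw [← gnorm_fin, ← gnorm_fin]
  have e : x.map (TensorProduct.rid ℂ X).symm.toLinearMap =
      odot x (1 : Matrix (Fin n) (Fin n) ℂ) := by
    ext i j
    simp [odot, Matrix.one_apply, TensorProduct.tmul_ite]
  rw [e]
  refine (gnorm_odot_le s complex _ _).trans (mul_le_of_le_one_right (s.gnorm_nonneg _) ?_)
  rw [gnorm_complex]
  exact opNorm_one_le

/-- The weak interchange is completely contractive: on representatives it sends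
`(a ⊙ b) ⊗ (c ⊙ d)` to `(a ⊗ c) ⊙ (b ⊗ d)`. -/
lemma shuffle_proj_haagerup :
    IsCompleteContraction (projTensor (haagerup s t) (haagerup u r))
      (haagerup (projTensor s u) (projTensor t r))
      (TensorProduct.tensorTensorTensorComm ℂ X Y Z W).toLinearMap := by
  refine isCompleteContraction_proj _ _ _ fun p q v w => ?_
  refine le_mul_of_forall_lt₀ fun K hK L hL => ?_
  have hK0 : 0 ≤ K := ((haagerup s t).gnorm_nonneg v).trans hK.le
  have hL0 : 0 ≤ L := ((haagerup u r).gnorm_nonneg w).trans hL.le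
  obtain ⟨k, a, b, rfl, ha, hb⟩ := exists_odot s t v hK
  obtain ⟨l, c, d, rfl, hc, hd⟩ := exists_odot u r w hL
  have e : (kron (odot a b) (odot c d)).map
      (TensorProduct.tensorTensorTensorComm ℂ X Y Z W).toLinearMap =
      odot (kron a c) (kron b d) := by
    ext ⟨i, j⟩ ⟨i', j'⟩
    simp only [kron, odot, Matrix.map_apply, Matrix.of_apply, TensorProduct.sum_tmul,
      TensorProduct.tmul_sum, map_sum, Fintype.sum_prod_type, LinearEquiv.coe_coe,
      TensorProduct.tensorTensorTensorComm_tmul]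
    exact Finset.sum_comm
  rw [e]
  refine (gnorm_odot_le _ _ _ _).trans ?_
  have h1 := (gnorm_kron_le s u a c).trans
    (mul_le_mul ha hc (u.gnorm_nonneg _) (Real.sqrt_nonneg _))
  have h2 := (gnorm_kron_le t r b d).trans
    (mul_le_mul hb hd (r.gnorm_nonneg _) (Real.sqrt_nonneg _))
  calc _ ≤ (√K * √L) * (√K * √L) := mul_le_mul h1 h2 (gnorm_nonneg _ _) (by positivity)
    _ = (√K * √K) * (√L * √L) := by ring
    _ = _ := by rw [Real.mul_self_sqrt hK0, Real.mul_self_sqrt hL0]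

lemma gnorm_ev_le (X Y : FdOS) : IsCompleteContraction
    (projTensor X.oss (cb X.oss Y.oss)) Y.oss (FdOS.evLin X Y) := by
  refine isCompleteContraction_proj _ _ _ fun p q x T => ?_
  rw [mul_comm]
  exact gnorm_amplProd_le X.oss Y.oss T x

/-- Currying is completely contractive since the value of the curried map at `z` on `x` is the value
of `f` at `x ⊗ z`. -/
lemma curry_isCompleteContraction {X Y Z : FdOS} {f : X ⊗[ℂ] Z →ₗ[ℂ] Y}
    (hf : IsCompleteContraction (projTensor X.oss Z.oss) Y.oss f) :
    IsCompleteContraction Z.oss (cb X.oss Y.oss) (FdOS.curryLin f) := by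
  intro n z
  rw [← gnorm_fin, ← gnorm_fin]
  refine gnorm_cb_le _ _ _ fun k x hx => ?_
  refine (hf.gnorm_map_le (kron x z)).trans ((gnorm_kron_le _ _ x z).trans ?_)
  exact mul_le_of_le_one_left (gnorm_nonneg _ _) hx

end OperatorSpaceStructure

namespace FdOS

open OperatorSpaceStructure

lemma isSymmetricTensor_proj : IsSymmetricTensor proj := fun X Y => proj_comm X.oss Y.oss

lemma isMonoidalTensor_proj : IsMonoidalTensor proj where
  map f g := proj_map _ _ _ _ f.isCC g.isCC
  assoc X Y Z := proj_assoc X.oss Y.oss Z.oss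
  assoc_symm X Y Z := proj_assoc_symm X.oss Y.oss Z.oss
  lid X := proj_lid X.oss
  lid_symm X := proj_lid_symm X.oss
  rid X := by
    have e : (TensorProduct.rid ℂ X).toLinearMap =
      (TensorProduct.lid ℂ X).toLinearMap ∘ₗ (TensorProduct.comm ℂ X ℂ).toLinearMap :=
      TensorProduct.ext' fun x a => by simp
    rw [e]
    exact isCompleteContraction_comp (proj_lid X.oss) (proj_comm X.oss complex)
  rid_symm X := by
    have e : (TensorProduct.rid ℂ X).symm.toLinearMap =
      (TensorProduct.comm ℂ ℂ X).toLinearMap ∘ₗ (TensorProduct.lid ℂ X).symm.toLinearMap :=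
      LinearMap.ext fun x => by simp
    rw [e]
    exact isCompleteContraction_comp (proj_comm complex X.oss) (proj_lid_symm X.oss)

lemma isClosedTensor_proj : IsClosedTensor proj where
  ev X Y := gnorm_ev_le X Y
  curry f := curry_isCompleteContraction f.isCC

lemma isMonoidalTensor_haagerup : IsMonoidalTensor haagerup where
  map f g := haagerup_map _ _ _ _ f.isCC g.isCC
  assoc X Y Z := haagerup_assoc X.oss Y.oss Z.oss
  assoc_symm X Y Z := haagerup_assoc_symm X.oss Y.oss Z.oss
  lid X := haagerup_lid X.oss
  lid_symm X := haagerup_lid_symm X.oss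
  rid X := haagerup_rid X.oss
  rid_symm X := haagerup_rid_symm X.oss

end FdOS

/-! ### Hilbert space factorization of bilinear forms -/

/-- A family of quadratic costs on the finite tuples of vectors of `V`: `cost v C` says that the
square of a gauge of the tuple `v` is at most `C`. The gauge is positively homogeneous, does not
increase under scalar contractions acting on the tuple, and its square is subadditive under
concatenation. The examples are given by rows and columns over an operator space. -/
structure TupleCost (V : Type*) [AddCommGroup V] [Module ℂ V] where
  cost : ∀ {k : Type} [Fintype k] [DecidableEq k], (k → V) → ℝ → Prop
  exists_cost : ∀ {k : Type} [Fintype k] [DecidableEq k] (v : k → V), ∃ C, cost v C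
  smul : ∀ {k : Type} [Fintype k] [DecidableEq k] {v : k → V} {C : ℝ} (r : ℝ), cost v C →
    cost ((r : ℂ) • v) (r ^ 2 * C)
  mul : ∀ {k l : Type} [Fintype k] [DecidableEq k] [Fintype l] [DecidableEq l] {v : k → V} {C : ℝ}
    {U : Matrix k l ℂ}, cost v C → ‖U‖ ≤ 1 → cost (fun j => ∑ i, U i j • v i) C
  append : ∀ {k l : Type} [Fintype k] [DecidableEq k] [Fintype l] [DecidableEq l] {v : k → V}
    {w : l → V} {C D : ℝ}, cost v C → cost w D → cost (Sum.elim v w) (C + D)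

namespace TupleCost

/-- Costs on `V` pulled back along a linear map. -/
def comap {V W : Type*} [AddCommGroup V] [Module ℂ V] [AddCommGroup W] [Module ℂ W]
    (c : TupleCost V) (e : W →ₗ[ℂ] V) : TupleCost W where
  cost w C := c.cost (fun i => e (w i)) C
  exists_cost w := c.exists_cost _
  smul r h := by
    have := c.smul r h
    simpa [Pi.smul_def] using this
  mul h hU := by
    have := c.mul h hU
    simpa using this
  append h h' := by
    have := c.append h h'
    convert this using 1
    funext i
    rcases i with i | i <;> rfl

variable {V : Type*} [AddCommGroup V] [Module ℂ V]

lemma cost_empty (c : TupleCost V) (v : Empty → V) : c.cost v 0 := by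
  obtain ⟨C, hC⟩ := c.exists_cost v
  have := c.smul 0 hC
  rw [Subsingleton.elim v (((0 : ℝ) : ℂ) • v)]
  simpa using this

end TupleCost

namespace MatrixSpace

section gram

variable {ι k l : Type} [Fintype ι] [DecidableEq ι] [Fintype k] [DecidableEq k]
  [Fintype l] [DecidableEq l]

/-- The positive matrix `∑ v vᴴ` of a tuple of vectors of `ℂ^ι`. -/
def gram (v : k → ι → ℂ) : Matrix ι ι ℂ := Matrix.of fun i j => ∑ a, v a i * star (v a j)

lemma gram_append (v : k → ι → ℂ) (w : l → ι → ℂ) : gram (Sum.elim v w) = gram v + gram w := by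
  ext i j; simp [gram]

lemma gram_smul (r : ℝ) (v : k → ι → ℂ) : gram ((r : ℂ) • v) = (r ^ 2) • gram v := by
  ext i j
  simp only [gram, Matrix.of_apply, Pi.smul_apply, smul_eq_mul, star_mul', RCLike.star_def,
    Complex.conj_ofReal, Matrix.smul_apply, Finset.smul_sum, Complex.real_smul]
  push_cast
  exact Finset.sum_congr rfl fun a _ => by ring

lemma gram_conjTranspose (v : k → ι → ℂ) : (gram v).conjTranspose = gram v := by
  ext i j; simp [gram, Matrix.conjTranspose_apply, mul_comm]

lemma gram_empty (v : Empty → ι → ℂ) : gram v = 0 := by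
  ext i j; simp [gram]

/-- Two tuples with the same matrix `∑ v vᴴ` are obtained from one another by a contraction. -/
lemma exists_contraction_of_gram_eq {v : k → ι → ℂ} {a : l → ι → ℂ} (h : gram v = gram a) :
    ∃ U : Matrix l k ℂ, ‖U‖ ≤ 1 ∧ v = fun j => ∑ i, U i j • a i := by
  -- The map `aᴴ ξ ↦ vᴴ ξ` is a well defined isometry of the range of `aᴴ`; it is extended by zero
  -- to the orthogonal complement.
  let A : Matrix ι l ℂ := Matrix.of fun i s => a s i
  let B : Matrix ι k ℂ := Matrix.of fun i s => v s i
  have hAB : A * A.conjTranspose = B * B.conjTranspose := by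
    have h1 : A * A.conjTranspose = gram a := by ext i j; simp [A, gram, Matrix.mul_apply]
    have h2 : B * B.conjTranspose = gram v := by ext i j; simp [B, gram, Matrix.mul_apply]
    rw [h1, h2, h]
  let TA : EuclideanSpace ℂ ι →ₗ[ℂ] EuclideanSpace ℂ l := Matrix.toEuclideanLin A.conjTranspose
  let TB : EuclideanSpace ℂ ι →ₗ[ℂ] EuclideanSpace ℂ k := Matrix.toEuclideanLin B.conjTranspose
  have hsq : ∀ {τ : Type} [Fintype τ] [DecidableEq τ] (M : Matrix ι τ ℂ) (ξ : EuclideanSpace ℂ ι),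
      ((‖Matrix.toEuclideanLin M.conjTranspose ξ‖ ^ 2 : ℝ) : ℂ) =
        star ξ.ofLp ⬝ᵥ ((M * M.conjTranspose).mulVec ξ.ofLp) := by
    intro τ _ _ M ξ
    have e1 : star ξ.ofLp ⬝ᵥ ((M * M.conjTranspose).mulVec ξ.ofLp) =
        star (M.conjTranspose.mulVec ξ.ofLp) ⬝ᵥ (M.conjTranspose.mulVec ξ.ofLp) := by
      rw [Matrix.star_mulVec, Matrix.conjTranspose_conjTranspose, ← Matrix.mulVec_mulVec,
        Matrix.dotProduct_mulVec]
    rw [e1, EuclideanSpace.norm_sq_eq]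
    simp [dotProduct, ← Complex.conj_mul']
  have hn : ∀ ξ, ‖TA ξ‖ = ‖TB ξ‖ := by
    intro ξ
    have h1 := hsq A ξ
    have h2 := hsq B ξ
    rw [hAB, ← h2, Complex.ofReal_inj] at h1
    exact (pow_left_inj₀ (norm_nonneg _) (norm_nonneg _) two_ne_zero).1 h1
  obtain ⟨g, hg⟩ := TA.rangeRestrict.exists_rightInverse_of_surjective TA.range_rangeRestrict
  have hg' : ∀ η : LinearMap.range TA, TA (g η) = η := fun η =>
    congrArg Subtype.val (LinearMap.congr_fun hg η)
  let P := (LinearMap.range TA).orthogonalProjectionOnto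
  let L : EuclideanSpace ℂ l →ₗ[ℂ] EuclideanSpace ℂ k := TB ∘ₗ g ∘ₗ P.toLinearMap
  have hL : ∀ ξ, L (TA ξ) = TB ξ := by
    intro ξ
    have h1 : P (TA ξ) = ⟨TA ξ, LinearMap.mem_range_self TA ξ⟩ :=
      Submodule.orthogonalProjectionOnto_mem_subspace_eq_self
        (⟨TA ξ, LinearMap.mem_range_self TA ξ⟩ : LinearMap.range TA)
    have h2 : TB (g (P (TA ξ)) - ξ) = 0 := by
      rw [← norm_eq_zero, ← hn, map_sub, hg', h1]
      simp
    rw [map_sub, sub_eq_zero] at h2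
    exact h2
  have hLn : ∀ η, ‖L η‖ ≤ ‖η‖ := by
    intro η
    change ‖TB (g (P η))‖ ≤ _
    rw [← hn, hg']
    exact (LinearMap.range TA).norm_orthogonalProjectionOnto_apply_le η
  let M : Matrix k l ℂ := Matrix.toEuclideanLin.symm L
  have hM : Matrix.toEuclideanLin M = L := Matrix.toEuclideanLin.apply_symm_apply L
  have hM1 : ‖M‖ ≤ 1 := by
    refine opNorm_le_of_mulVec M 1 zero_le_one fun ξ => ?_
    rw [one_mul]
    have := hLn ξ
    rwa [← hM] at this
  have hMA : M * A.conjTranspose = B.conjTranspose := by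
    apply Matrix.toEuclideanLin.injective
    ext ξ : 1
    have h1 := hL ξ
    rw [← hM] at h1
    change _ = TB ξ
    rw [← h1]
    simp [Matrix.toLpLin_apply, TA, Matrix.mulVec_mulVec]
  refine ⟨M.conjTranspose, by rwa [Matrix.l2_opNorm_conjTranspose], ?_⟩
  have hB : B = A * M.conjTranspose := by
    rw [← Matrix.conjTranspose_conjTranspose B, ← hMA, Matrix.conjTranspose_mul,
      Matrix.conjTranspose_conjTranspose]
  funext j
  ext i
  have := congrFun (congrFun hB i) j
  rw [Matrix.mul_apply] at this
  simpa [A, B, mul_comm] using this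

end gram

section factorization

variable {ι κ : Type} [Fintype ι] [DecidableEq ι] [Fintype κ] [DecidableEq κ]

/-- The convex cone of all triples `(∑ v vᴴ - ∑ a aᴴ, ∑ w wᴴ - ∑ b bᴴ, C + D - 2 Re ∑ F(v, w))`, for
tuples `a` of cost `C` and `b` of cost `D`. The antihermitian parts of the first two coordinates are
left free, so that the cone can be tested on all matrices and not only on the hermitian ones. -/
def costCone (c : TupleCost (ι → ℂ)) (d : TupleCost (κ → ℂ))
    (F : (ι → ℂ) →ₗ[ℂ] (κ → ℂ) →ₗ[ℂ] ℂ) :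
    PointedCone ℝ (Matrix ι ι ℂ × Matrix κ κ ℂ × ℝ) where
  carrier := {x | ∃ (k l m : Type) (_ : Fintype k) (_ : DecidableEq k) (_ : Fintype l)
    (_ : DecidableEq l) (_ : Fintype m) (_ : DecidableEq m) (v : k → ι → ℂ) (w : k → κ → ℂ)
    (a : l → ι → ℂ) (b : m → κ → ℂ) (C D : ℝ), c.cost a C ∧ d.cost b D ∧
    x.1 + x.1.conjTranspose = (2 : ℝ) • (gram v - gram a) ∧
    x.2.1 + x.2.1.conjTranspose = (2 : ℝ) • (gram w - gram b) ∧
    x.2.2 = C + D - 2 * (∑ i, F (v i) (w i)).re}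
  zero_mem' := ⟨Empty, Empty, Empty, inferInstance, inferInstance, inferInstance, inferInstance,
    inferInstance, inferInstance, Empty.elim, Empty.elim, Empty.elim, Empty.elim, 0, 0,
    c.cost_empty _, d.cost_empty _, by simp, by simp, by simp⟩
  add_mem' := by
    rintro x x' ⟨k, l, m, _, _, _, _, _, _, v, w, a, b, C, D, h1, h2, h3, h4, h5⟩
      ⟨k', l', m', _, _, _, _, _, _, v', w', a', b', C', D', h1', h2', h3', h4', h5'⟩
    refine ⟨k ⊕ k', l ⊕ l', m ⊕ m', inferInstance, inferInstance, inferInstance, inferInstance,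
      inferInstance, inferInstance, Sum.elim v v', Sum.elim w w', Sum.elim a a', Sum.elim b b',
      C + C', D + D', c.append h1 h1', d.append h2 h2', ?_, ?_, ?_⟩
    · rw [Prod.fst_add, Matrix.conjTranspose_add, add_add_add_comm, h3, h3', gram_append,
        gram_append, ← smul_add]
      congr 1; abel
    · rw [Prod.snd_add, Prod.fst_add, Matrix.conjTranspose_add, add_add_add_comm, h4, h4',
        gram_append, gram_append, ← smul_add]
      congr 1; abel
    · rw [Prod.snd_add, Prod.snd_add, h5, h5']
      simp only [Fintype.sum_sum_type, Sum.elim_inl, Sum.elim_inr, Complex.add_re]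
      ring
  smul_mem' := by
    rintro ⟨r, hr⟩ x ⟨k, l, m, _, _, _, _, _, _, v, w, a, b, C, D, h1, h2, h3, h4, h5⟩
    have hs : √r ^ 2 = r := Real.sq_sqrt hr
    refine ⟨k, l, m, inferInstance, inferInstance, inferInstance, inferInstance, inferInstance,
      inferInstance, ((√r : ℝ) : ℂ) • v, ((√r : ℝ) : ℂ) • w, ((√r : ℝ) : ℂ) • a,
      ((√r : ℝ) : ℂ) • b, √r ^ 2 * C, √r ^ 2 * D, c.smul _ h1, d.smul _ h2, ?_, ?_, ?_⟩
    · change r • x.1 + (r • x.1).conjTranspose = _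
      rw [Matrix.conjTranspose_smul, star_trivial, ← smul_add, h3, gram_smul, gram_smul, hs,
        ← smul_sub, smul_comm]
    · change r • x.2.1 + (r • x.2.1).conjTranspose = _
      rw [Matrix.conjTranspose_smul, star_trivial, ← smul_add, h4, gram_smul, gram_smul, hs,
        ← smul_sub, smul_comm]
    · change r * x.2.2 = _
      have e : ∑ i, F ((((√r : ℝ) : ℂ) • v) i) ((((√r : ℝ) : ℂ) • w) i) =
          ((r : ℝ) : ℂ) * ∑ i, F (v i) (w i) := by
        rw [Finset.mul_sum]
        refine Finset.sum_congr rfl fun i _ => ?_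
        rw [Pi.smul_apply, Pi.smul_apply, map_smul, map_smul, LinearMap.smul_apply, smul_smul,
          ← Complex.ofReal_mul, Real.mul_self_sqrt hr, smul_eq_mul]
      rw [e, hs, h5, Complex.re_ofReal_mul]
      ring

/-- Hermitian matrices are differences of matrices `∑ v vᴴ`; hence every triple
belongs to `costCone` after a change of its last coordinate. -/
lemma exists_gram_sub_gram (A : Matrix ι ι ℂ) : ∃ v a : ι → ι → ℂ,
    A + A.conjTranspose = (2 : ℝ) • (gram v - gram a) := by
  -- `H = ((H + 1) / 2) ^ 2 - ((H - 1) / 2) ^ 2` for the hermitian part `H` of `A`.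
  let H : Matrix ι ι ℂ := (2 : ℂ)⁻¹ • (A + A.conjTranspose)
  have hH : H.conjTranspose = H := by
    simp only [H, Matrix.conjTranspose_smul, Matrix.conjTranspose_add,
      Matrix.conjTranspose_conjTranspose, add_comm]
    simp
  have hg : ∀ Z : Matrix ι ι ℂ, Z.conjTranspose = Z → gram (fun s i => Z i s) = Z * Z := by
    intro Z hZ
    conv_rhs => rw [← hZ]
    conv_rhs => rw [show Z.conjTranspose * Z.conjTranspose = Z * Z.conjTranspose by
      nth_rewrite 1 [hZ]; rfl]
    ext i j; simp [gram, Matrix.mul_apply]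
  refine ⟨fun s i => ((2 : ℂ)⁻¹ • (H + 1)) i s, fun s i => ((2 : ℂ)⁻¹ • (H - 1)) i s, ?_⟩
  rw [hg _ (by simp [hH]), hg _ (by simp [hH])]
  have e : ((2 : ℂ)⁻¹ • (H + 1)) * ((2 : ℂ)⁻¹ • (H + 1)) -
      ((2 : ℂ)⁻¹ • (H - 1)) * ((2 : ℂ)⁻¹ • (H - 1)) = H := by
    simp only [Matrix.smul_mul, Matrix.mul_smul, smul_smul, ← smul_sub]
    have : (H + 1) * (H + 1) - (H - 1) * (H - 1) = (4 : ℂ) • H := by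
      have : (4 : ℂ) • H = H + H + H + H := by
        rw [show (4 : ℂ) = 1 + 1 + 1 + 1 by norm_num]; simp [add_smul]
      rw [this]; noncomm_ring
    rw [this, smul_smul]
    norm_num
  rw [e]
  ext i j
  simp [H]

/-- Grothendieck–Pietsch domination: a bilinear form bounded by the costs is bounded by quadratic
forms `v ↦ p (v vᴴ)` and `w ↦ q (w wᴴ)` that are themselves bounded by the costs. They come from the
Riesz extension of `(0, 0, t) ↦ t` to a functional which is nonnegative on `costCone`. A point
`(0, 0, t)` of the cone has `t ≥ 0`: there the tuples `v`, `w` arise from `a`, `b` by contractions,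
so they satisfy the same cost bounds, and the hypothesis on `F` applies. -/
lemma exists_functionals (c : TupleCost (ι → ℂ)) (d : TupleCost (κ → ℂ))
    (F : (ι → ℂ) →ₗ[ℂ] (κ → ℂ) →ₗ[ℂ] ℂ)
    (hF : ∀ {k : Type} [Fintype k] [DecidableEq k] (v : k → ι → ℂ) (w : k → κ → ℂ) (C D : ℝ),
      c.cost v C → d.cost w D → 2 * (∑ i, F (v i) (w i)).re ≤ C + D) :
    ∃ (p : Matrix ι ι ℂ →ₗ[ℝ] ℝ) (q : Matrix κ κ ℂ →ₗ[ℝ] ℝ),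
      (∀ A, p A.conjTranspose = p A) ∧ (∀ B, q B.conjTranspose = q B) ∧
      (∀ {k : Type} [Fintype k] [DecidableEq k] (v : k → ι → ℂ) (C : ℝ), c.cost v C →
        p (gram v) ≤ C) ∧
      (∀ {k : Type} [Fintype k] [DecidableEq k] (w : k → κ → ℂ) (D : ℝ), d.cost w D →
        q (gram w) ≤ D) ∧
      ∀ (v : ι → ℂ) (w : κ → ℂ), 2 * (F v w).re ≤
        p (gram fun _ : Unit => v) + q (gram fun _ : Unit => w) := by
  let f : (Matrix ι ι ℂ × Matrix κ κ ℂ × ℝ) →ₗ[ℝ] ℝ :=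
    LinearMap.snd ℝ _ _ ∘ₗ LinearMap.snd ℝ _ _
  let S : Submodule ℝ (Matrix ι ι ℂ × Matrix κ κ ℂ × ℝ) :=
    LinearMap.range (LinearMap.inr ℝ (Matrix ι ι ℂ) (Matrix κ κ ℂ × ℝ) ∘ₗ
      LinearMap.inr ℝ (Matrix κ κ ℂ) ℝ)
  have hS : ∀ t : ℝ, ((0, 0, t) : Matrix ι ι ℂ × Matrix κ κ ℂ × ℝ) ∈ S := fun t => ⟨t, rfl⟩
  obtain ⟨g, hg1, hg2⟩ := riesz_extension (costCone c d F) (f.toPMap S) (by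
    rintro ⟨-, t, rfl⟩ ⟨k, l, m, _, _, _, _, _, _, v, w, a, b, C, D, h1, h2, h3, h4, h5⟩
    change 0 ≤ t
    have h3' : gram v = gram a := by
      have : (0 : Matrix ι ι ℂ) + (0 : Matrix ι ι ℂ).conjTranspose = (2 : ℝ) • (gram v - gram a) :=
        h3
      rw [Matrix.conjTranspose_zero, add_zero, eq_comm, smul_eq_zero] at this
      exact sub_eq_zero.1 (this.resolve_left two_ne_zero)
    have h4' : gram w = gram b := by
      have : (0 : Matrix κ κ ℂ) + (0 : Matrix κ κ ℂ).conjTranspose = (2 : ℝ) • (gram w - gram b) :=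
        h4
      rw [Matrix.conjTranspose_zero, add_zero, eq_comm, smul_eq_zero] at this
      exact sub_eq_zero.1 (this.resolve_left two_ne_zero)
    obtain ⟨U, hU, hv⟩ := exists_contraction_of_gram_eq h3'
    obtain ⟨U', hU', hw⟩ := exists_contraction_of_gram_eq h4'
    have hc := c.mul h1 hU
    have hd := d.mul h2 hU'
    rw [← hv] at hc
    rw [← hw] at hd
    have := hF v w C D hc hd
    have h5' : t = C + D - 2 * (∑ i, F (v i) (w i)).re := h5
    linarith) (by
    rintro ⟨A, B, t⟩
    obtain ⟨v, a, hA⟩ := exists_gram_sub_gram A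
    obtain ⟨w, b, hB⟩ := exists_gram_sub_gram B
    obtain ⟨C, hC⟩ := c.exists_cost a
    obtain ⟨D, hD⟩ := d.exists_cost b
    refine ⟨⟨(0, 0, C + D - t), hS _⟩, ι ⊕ κ, ι, κ, inferInstance, inferInstance, inferInstance,
      inferInstance, inferInstance, inferInstance, Sum.elim v 0, Sum.elim 0 w, a, b, C, D, hC, hD,
      ?_, ?_, ?_⟩
    · have : gram (0 : κ → ι → ℂ) = 0 := by ext i j; simp [gram]
      rw [gram_append, this, add_zero, ← hA]
      simp
    · have : gram (0 : ι → κ → ℂ) = 0 := by ext i j; simp [gram]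
      rw [gram_append, this, zero_add, ← hB]
      simp
    · simp)
  have hg0 : ∀ t : ℝ, g (0, 0, t) = t := fun t => hg1 ⟨_, hS t⟩
  let p : Matrix ι ι ℂ →ₗ[ℝ] ℝ := g ∘ₗ LinearMap.inl ℝ _ _
  let q : Matrix κ κ ℂ →ₗ[ℝ] ℝ := g ∘ₗ LinearMap.inr ℝ _ _ ∘ₗ LinearMap.inl ℝ _ _
  have hpq : ∀ A B t, g (A, B, t) = p A + q B + t := by
    intro A B t
    have e : ((A, B, t) : Matrix ι ι ℂ × Matrix κ κ ℂ × ℝ) = (A, 0, 0) + (0, B, 0) + (0, 0, t) := by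
      simp
    rw [e, map_add, map_add, hg0]
    rfl
  have hmem : ∀ {k l m : Type} [Fintype k] [DecidableEq k] [Fintype l] [DecidableEq l] [Fintype m]
      [DecidableEq m] (v : k → ι → ℂ) (w : k → κ → ℂ) (a : l → ι → ℂ) (b : m → κ → ℂ) (C D : ℝ)
      (A : Matrix ι ι ℂ) (B : Matrix κ κ ℂ), c.cost a C → d.cost b D →
      A + A.conjTranspose = (2 : ℝ) • (gram v - gram a) →
      B + B.conjTranspose = (2 : ℝ) • (gram w - gram b) →
      0 ≤ p A + q B + (C + D - 2 * (∑ i, F (v i) (w i)).re) := by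
    intro k l m _ _ _ _ _ _ v w a b C D A B h1 h2 h3 h4
    rw [← hpq]
    exact hg2 _ ⟨k, l, m, inferInstance, inferInstance, inferInstance, inferInstance,
      inferInstance, inferInstance, v, w, a, b, C, D, h1, h2, h3, h4, rfl⟩
  have hp0 : ∀ A : Matrix ι ι ℂ, A + A.conjTranspose = 0 → 0 ≤ p A := by
    intro A hA
    have := hmem (k := Empty) (l := Empty) (m := Empty) Empty.elim Empty.elim Empty.elim Empty.elim
      0 0 A 0 (c.cost_empty _) (d.cost_empty _) (by simp [hA, gram_empty]) (by simp [gram_empty])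
    simpa using this
  have hq0 : ∀ B : Matrix κ κ ℂ, B + B.conjTranspose = 0 → 0 ≤ q B := by
    intro B hB
    have := hmem (k := Empty) (l := Empty) (m := Empty) Empty.elim Empty.elim Empty.elim Empty.elim
      0 0 0 B (c.cost_empty _) (d.cost_empty _) (by simp [gram_empty]) (by simp [hB, gram_empty])
    simpa using this
  refine ⟨p, q, fun A => ?_, fun B => ?_, ?_, ?_, ?_⟩
  · have h1 := hp0 (A - A.conjTranspose) (by simp)
    have h2 := hp0 (A.conjTranspose - A) (by simp)
    rw [map_sub] at h1 h2
    linarith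
  · have h1 := hq0 (B - B.conjTranspose) (by simp)
    have h2 := hq0 (B.conjTranspose - B) (by simp)
    rw [map_sub] at h1 h2
    linarith
  · intro k _ _ v C hv
    have := hmem (k := Empty) (m := Empty) Empty.elim Empty.elim v Empty.elim
      C 0 (-gram v) 0 hv (d.cost_empty _)
      (by rw [Matrix.conjTranspose_neg, gram_conjTranspose, gram_empty, two_smul]; abel)
      (by simp [gram_empty])
    simpa using this
  · intro k _ _ w D hw
    have := hmem (k := Empty) (l := Empty) Empty.elim Empty.elim Empty.elim w
      0 D 0 (-gram w) (c.cost_empty _) hw (by simp [gram_empty])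
      (by rw [Matrix.conjTranspose_neg, gram_conjTranspose, gram_empty, two_smul]; abel)
    simpa using this
  · intro v w
    have := hmem (k := Unit) (l := Empty) (m := Empty) (fun _ => v) (fun _ => w) Empty.elim
      Empty.elim 0 0 (gram fun _ : Unit => v) (gram fun _ : Unit => w) (c.cost_empty _)
      (d.cost_empty _) (by rw [gram_conjTranspose, gram_empty, two_smul]; simp)
      (by rw [gram_conjTranspose, gram_empty, two_smul]; simp)
    simp only [Finset.univ_unique, Finset.sum_const, Finset.card_singleton, one_smul] at this
    linarith

/-- A real functional on matrices which does not see antihermitian parts is given on the matrices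
`v vᴴ` by a hermitian form. -/
lemma exists_hermitian_form (p : Matrix ι ι ℂ →ₗ[ℝ] ℝ) (hp : ∀ A, p A.conjTranspose = p A) :
    ∃ P : Matrix ι ι ℂ, P.IsHermitian ∧ ∀ v : ι → ℂ,
      star v ⬝ᵥ P.mulVec v = (p (gram fun _ : Unit => v) : ℂ) := by
  let pc : Matrix ι ι ℂ →ₗ[ℂ] ℂ := Module.Dual.extendRCLike p
  have hpc : ∀ A, pc A = (p A : ℂ) - Complex.I * (p (Complex.I • A) : ℂ) := fun A => rfl
  have hI : ∀ A : Matrix ι ι ℂ, p (Complex.I • A.conjTranspose) = - p (Complex.I • A) := by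
    intro A
    rw [← hp (Complex.I • A.conjTranspose), Matrix.conjTranspose_smul,
      Matrix.conjTranspose_conjTranspose, ← map_neg]
    congr 1
    simp
  have hstar : ∀ A, star (pc A) = pc A.conjTranspose := by
    intro A
    rw [hpc, hpc, hp, hI]
    simp
  refine ⟨Matrix.of fun i j => pc (Matrix.single j i 1), ?_, fun v => ?_⟩
  · ext i j
    rw [Matrix.conjTranspose_apply, Matrix.of_apply, Matrix.of_apply, hstar,
      Matrix.conjTranspose_single, star_one]
  · have h1 : pc (gram fun _ : Unit => v) = (p (gram fun _ : Unit => v) : ℂ) := by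
      have h2 := hI (gram fun _ : Unit => v)
      rw [gram_conjTranspose] at h2
      have h3 : p (Complex.I • gram fun _ : Unit => v) = 0 := by linarith
      rw [hpc, h3]; simp
    have h4 : gram (fun _ : Unit => v) =
        ∑ i, ∑ j, (v i * star (v j)) • Matrix.single i j (1 : ℂ) := by
      conv_lhs => rw [Matrix.matrix_eq_sum_single (gram fun _ : Unit => v)]
      refine Finset.sum_congr rfl fun i _ => Finset.sum_congr rfl fun j _ => ?_
      rw [Matrix.smul_single]
      simp [gram]
    rw [← h1, h4]
    simp only [map_sum, map_smul, dotProduct, Matrix.mulVec, Matrix.of_apply, Pi.star_apply,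
      Finset.mul_sum, smul_eq_mul]
    rw [Finset.sum_comm]
    refine Finset.sum_congr rfl fun i _ => Finset.sum_congr rfl fun j _ => ?_
    ring

lemma gram_eq_sum {k : Type} [Fintype k] (v : k → ι → ℂ) :
    gram v = ∑ a, gram (fun _ : Unit => v a) := by
  ext i j; simp [gram, Matrix.sum_apply]

lemma bilin_eq_sum (F : (ι → ℂ) →ₗ[ℂ] (κ → ℂ) →ₗ[ℂ] ℂ) (v : ι → ℂ) (w : κ → ℂ) :
    F v w = ∑ i, ∑ j, v i * w j * F (Pi.single i 1) (Pi.single j 1) := by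
  conv_lhs => rw [pi_eq_sum_univ' v, pi_eq_sum_univ' w]
  simp only [map_sum, LinearMap.sum_apply, map_smul, LinearMap.smul_apply, smul_eq_mul,
    Finset.mul_sum]
  rw [Finset.sum_comm]
  refine Finset.sum_congr rfl fun i _ => Finset.sum_congr rfl fun j _ => ?_
  ring

open scoped ComplexOrder in
/-- The Hilbert space factorization of a bilinear form which is dominated by the two costs. The
quadratic forms dominating `F` and `-F` itself are the blocks of a positive semidefinite matrix, and
a decomposition of this matrix into matrices of rank one gives the factorization. -/
lemma exists_factorization_coord (c : TupleCost (ι → ℂ)) (d : TupleCost (κ → ℂ))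
    (F : (ι → ℂ) →ₗ[ℂ] (κ → ℂ) →ₗ[ℂ] ℂ)
    (hF : ∀ {k : Type} [Fintype k] [DecidableEq k] (v : k → ι → ℂ) (w : k → κ → ℂ) (C D : ℝ),
      c.cost v C → d.cost w D → 2 * (∑ i, F (v i) (w i)).re ≤ C + D) :
    ∃ (r : ℕ) (G : (ι → ℂ) →ₗ[ℂ] (Fin r → ℂ)) (H : (κ → ℂ) →ₗ[ℂ] (Fin r → ℂ)),
      (∀ v w, F v w = ∑ s, G v s * H w s) ∧
      (∀ {k : Type} [Fintype k] [DecidableEq k] (v : k → ι → ℂ) (C : ℝ), c.cost v C →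
        ∑ j, ∑ s, ‖G (v j) s‖ ^ 2 ≤ C) ∧
      (∀ {k : Type} [Fintype k] [DecidableEq k] (w : k → κ → ℂ) (D : ℝ), d.cost w D →
        ∑ j, ∑ s, ‖H (w j) s‖ ^ 2 ≤ D) := by
  obtain ⟨p, q, hp, hq, hpc, hqd, hpq⟩ := exists_functionals c d F hF
  obtain ⟨P, hP, hPv⟩ := exists_hermitian_form p hp
  obtain ⟨Q, hQ, hQv⟩ := exists_hermitian_form q hq
  let N : Matrix κ ι ℂ := Matrix.of fun j i => F (Pi.single i 1) (Pi.single j 1)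
  have hN : ∀ v w, w ⬝ᵥ N.mulVec v = F v w := by
    intro v w
    rw [bilin_eq_sum F v w, Finset.sum_comm]
    simp only [dotProduct, Matrix.mulVec, N, Matrix.of_apply, Finset.mul_sum]
    exact Finset.sum_congr rfl fun j _ => Finset.sum_congr rfl fun i _ => by ring
  -- The form `F` is linear in `w`, so that it is sesquilinear in `v` and the conjugate of `w`; this
  -- explains the transpose of `Q`.
  let M : Matrix (ι ⊕ κ) (ι ⊕ κ) ℂ := Matrix.fromBlocks P (-N.conjTranspose) (-N) Q.transpose
  have hM : M.PosSemidef := by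
    refine Matrix.PosSemidef.of_dotProduct_mulVec_nonneg ?_ fun η => ?_
    · rw [Matrix.IsHermitian, Matrix.fromBlocks_conjTranspose, hP, hQ.transpose,
        Matrix.conjTranspose_neg, Matrix.conjTranspose_neg, Matrix.conjTranspose_conjTranspose]
    · obtain ⟨v, w, rfl⟩ : ∃ v w, η = Sum.elim v (star w) :=
        ⟨η ∘ Sum.inl, star (η ∘ Sum.inr), by rw [star_star, Sum.elim_comp_inl_inr]⟩
      have e1 : star v ⬝ᵥ N.conjTranspose.mulVec (star w) = star (F v w) := by
        rw [← hN v w, Matrix.mulVec_conjTranspose, star_star, Matrix.star_dotProduct_star,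
          ← Matrix.dotProduct_mulVec]
      have e2 : w ⬝ᵥ Q.transpose.mulVec (star w) = star w ⬝ᵥ Q.mulVec w := by
        rw [Matrix.mulVec_transpose, dotProduct_comm, ← Matrix.dotProduct_mulVec]
      have e : star (Sum.elim v (star w)) ⬝ᵥ M.mulVec (Sum.elim v (star w)) =
          ((p (gram fun _ : Unit => v) + q (gram fun _ : Unit => w) - 2 * (F v w).re : ℝ) : ℂ) := by
        have e0 : star (Sum.elim v (star w)) = Sum.elim (star v) w := by
          ext (i | i) <;> simp
        rw [e0, Matrix.fromBlocks_mulVec, Sum.elim_comp_inl, Sum.elim_comp_inr,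
          sumElim_dotProduct_sumElim, dotProduct_add, dotProduct_add, Matrix.neg_mulVec,
          Matrix.neg_mulVec, dotProduct_neg, dotProduct_neg, e1, e2, hN, hPv, hQv]
        have e3 : star (F v w) + F v w = ((2 * (F v w).re : ℝ) : ℂ) := by
          rw [add_comm]; exact Complex.add_conj _
        push_cast at e3 ⊢
        linear_combination -e3
      rw [e, Complex.zero_le_real]
      linarith [hpq v w]
  obtain ⟨r, x, hx⟩ := Matrix.posSemidef_iff_eq_sum_vecMulVec.1 hM
  have hxM : ∀ a b, M a b = ∑ s, x s a * star (x s b) := by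
    intro a b
    rw [hx, Matrix.sum_apply]
    rfl
  have hsq : ∀ {τ : Type} [Fintype τ] (y : Fin r → τ → ℂ) (R : Matrix τ τ ℂ)
      (_ : ∀ a b, R a b = ∑ s, y s a * star (y s b)) (v : τ → ℂ),
      ((∑ s, ‖∑ i, star (y s i) * v i‖ ^ 2 : ℝ) : ℂ) = star v ⬝ᵥ R.mulVec v := by
    intro τ _ y R hR v
    calc ((∑ s, ‖∑ i, star (y s i) * v i‖ ^ 2 : ℝ) : ℂ)
        = ∑ s, ∑ a, ∑ b, (y s a * star (v a)) * (star (y s b) * v b) := by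
          push_cast
          refine Finset.sum_congr rfl fun s _ => ?_
          rw [← Complex.conj_mul', map_sum, Finset.sum_mul_sum]
          simp
      _ = ∑ a, ∑ b, ∑ s, (y s a * star (v a)) * (star (y s b) * v b) := by
          rw [Finset.sum_comm]
          exact Finset.sum_congr rfl fun a _ => Finset.sum_comm
      _ = star v ⬝ᵥ R.mulVec v := by
          simp only [dotProduct, Matrix.mulVec, hR, Finset.sum_mul, Finset.mul_sum, Pi.star_apply]
          exact Finset.sum_congr rfl fun a _ => Finset.sum_congr rfl fun b _ =>
            Finset.sum_congr rfl fun s _ => by ring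
  let G : (ι → ℂ) →ₗ[ℂ] (Fin r → ℂ) :=
    Matrix.mulVecLin (Matrix.of fun s i => star (x s (Sum.inl i)))
  let H : (κ → ℂ) →ₗ[ℂ] (Fin r → ℂ) := Matrix.mulVecLin (Matrix.of fun s j => -x s (Sum.inr j))
  have hG : ∀ v s, G v s = ∑ i, star (x s (Sum.inl i)) * v i := fun v s => rfl
  have hH : ∀ w s, H w s = ∑ j, -x s (Sum.inr j) * w j := fun w s => rfl
  have hGp : ∀ v, ∑ s, ‖G v s‖ ^ 2 = p (gram fun _ : Unit => v) := by
    intro v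
    have h1 := hsq (fun s i => x s (Sum.inl i)) P (fun a b => hxM (Sum.inl a) (Sum.inl b)) v
    rw [hPv, Complex.ofReal_inj] at h1
    exact h1
  have hHq : ∀ w, ∑ s, ‖H w s‖ ^ 2 = q (gram fun _ : Unit => w) := by
    intro w
    have h1 := hsq (fun s j => star (x s (Sum.inr j))) Q (fun a b => by
      have h2 := hxM (Sum.inr b) (Sum.inr a)
      rw [show M (Sum.inr b) (Sum.inr a) = Q a b from rfl] at h2
      rw [h2]
      exact Finset.sum_congr rfl fun s _ => by rw [star_star, mul_comm]) w
    rw [hQv, Complex.ofReal_inj] at h1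
    rw [← h1]
    refine Finset.sum_congr rfl fun s _ => ?_
    rw [hH]
    simp
  refine ⟨r, G, H, fun v w => ?_, fun {k} _ _ v C hv => ?_, fun {k} _ _ w D hw => ?_⟩
  · have h1 : ∀ i j, F (Pi.single i 1) (Pi.single j 1) =
        ∑ s, star (x s (Sum.inl i)) * (-x s (Sum.inr j)) := by
      intro i j
      have h2 := hxM (Sum.inr j) (Sum.inl i)
      rw [show M (Sum.inr j) (Sum.inl i) = -F (Pi.single i 1) (Pi.single j 1) from rfl,
        neg_eq_iff_eq_neg] at h2
      rw [h2, ← Finset.sum_neg_distrib]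
      exact Finset.sum_congr rfl fun s _ => by ring
    simp only [hG, hH, Finset.sum_mul_sum]
    conv_rhs => rw [Finset.sum_comm]
    rw [bilin_eq_sum F v w]
    refine Finset.sum_congr rfl fun i _ => ?_
    conv_rhs => rw [Finset.sum_comm]
    refine Finset.sum_congr rfl fun j _ => ?_
    rw [h1, Finset.mul_sum]
    exact Finset.sum_congr rfl fun s _ => by ring
  · simp only [hGp]
    rw [← map_sum, ← gram_eq_sum]
    exact hpc v C hv
  · simp only [hHq]
    rw [← map_sum, ← gram_eq_sum]
    exact hqd w D hw

end factorization

end MatrixSpace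

/-- A bilinear form on finite-dimensional spaces which is dominated by the costs of tuples factors
through a finite-dimensional Hilbert space, by linear maps dominated by the respective costs. -/
theorem TupleCost.exists_factorization {V W : Type*} [AddCommGroup V] [Module ℂ V] [AddCommGroup W]
    [Module ℂ W] [FiniteDimensional ℂ V] [FiniteDimensional ℂ W] (c : TupleCost V)
    (d : TupleCost W) (F : V →ₗ[ℂ] W →ₗ[ℂ] ℂ)
    (hF : ∀ {k : Type} [Fintype k] [DecidableEq k] (v : k → V) (w : k → W) (C D : ℝ),
      c.cost v C → d.cost w D → 2 * (∑ i, F (v i) (w i)).re ≤ C + D) :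
    ∃ (r : ℕ) (G : V →ₗ[ℂ] (Fin r → ℂ)) (H : W →ₗ[ℂ] (Fin r → ℂ)),
      (∀ v w, F v w = ∑ s, G v s * H w s) ∧
      (∀ {k : Type} [Fintype k] [DecidableEq k] (v : k → V) (C : ℝ), c.cost v C →
        ∑ j, ∑ s, ‖G (v j) s‖ ^ 2 ≤ C) ∧
      (∀ {k : Type} [Fintype k] [DecidableEq k] (w : k → W) (D : ℝ), d.cost w D →
        ∑ j, ∑ s, ‖H (w j) s‖ ^ 2 ≤ D) := by
  let e := (Module.finBasis ℂ V).equivFun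
  let e' := (Module.finBasis ℂ W).equivFun
  obtain ⟨r, G, H, h1, h2, h3⟩ := MatrixSpace.exists_factorization_coord
    (c.comap e.symm.toLinearMap) (d.comap e'.symm.toLinearMap)
    (F.compl₁₂ e.symm.toLinearMap e'.symm.toLinearMap) (fun v w C D hv hw => hF _ _ C D hv hw)
  refine ⟨r, G ∘ₗ e.toLinearMap, H ∘ₗ e'.toLinearMap, fun v w => ?_, fun {k} _ _ v C hv => ?_,
    fun {k} _ _ w D hw => ?_⟩
  · have := h1 (e v) (e' w)
    simpa using this
  · refine h2 (fun j => e (v j)) C ?_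
    change c.cost (fun j => e.symm (e (v j))) C
    simpa using hv
  · refine h3 (fun j => e' (w j)) D ?_
    change d.cost (fun j => e'.symm (e' (w j))) D
    simpa using hw

/-! ### Matricial functionals -/

namespace MatrixSpace

variable {ι κ : Type*} [Fintype ι] [Fintype κ] [DecidableEq ι] [DecidableEq κ]

lemma norm_bilinear_sum_le (A : Matrix ι κ ℂ) (ξ : ι → ℂ) (η : κ → ℂ) :
    ‖∑ i, ∑ j, ξ i * A i j * η j‖ ≤ ‖A‖ * (√(∑ i, ‖ξ i‖ ^ 2) * √(∑ j, ‖η j‖ ^ 2)) := by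
  let ξ' : EuclideanSpace ℂ ι := WithLp.toLp 2 (star ξ)
  let η' : EuclideanSpace ℂ κ := WithLp.toLp 2 η
  have h1 : ‖ξ'‖ = √(∑ i, ‖ξ i‖ ^ 2) := by simp [ξ', EuclideanSpace.norm_eq]
  have h2 : ‖η'‖ = √(∑ j, ‖η j‖ ^ 2) := by simp [η', EuclideanSpace.norm_eq]
  have h3 : ∑ i, ∑ j, ξ i * A i j * η j =
      inner ℂ ξ' (WithLp.toLp 2 (A.mulVec η'.ofLp) : EuclideanSpace ℂ ι) := by
    simp only [PiLp.inner_apply, ξ', η', RCLike.inner_apply, Pi.star_apply, RCLike.star_def,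
      Complex.conj_conj, Matrix.mulVec, dotProduct, Finset.sum_mul]
    exact Finset.sum_congr rfl fun i _ => Finset.sum_congr rfl fun j _ => by ring
  rw [h3, ← h1, ← h2]
  refine (norm_inner_le_norm _ _).trans ?_
  have h4 := mul_le_mul_of_nonneg_left (Matrix.l2_opNorm_mulVec A η') (norm_nonneg ξ')
  refine h4.trans (le_of_eq ?_)
  ring

lemma sum_sum_comm {a b c d M : Type*} [Fintype a] [Fintype b] [Fintype c] [Fintype d]
    [AddCommMonoid M] (f : a → b → c → d → M) :
    ∑ i, ∑ j, ∑ k, ∑ l, f i j k l = ∑ k, ∑ l, ∑ i, ∑ j, f i j k l := by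
  have h := Finset.sum_comm (s := Finset.univ (α := a × b)) (t := Finset.univ (α := c × d))
    (f := fun p q => f p.1 p.2 q.1 q.2)
  simpa only [Fintype.sum_prod_type] using h

lemma two_mul_re_mul_le (a b : ℂ) : 2 * (a * b).re ≤ ‖a‖ ^ 2 + ‖b‖ ^ 2 := by
  have h := Complex.re_le_norm (a * b)
  rw [norm_mul] at h
  nlinarith [sq_nonneg (‖a‖ - ‖b‖)]

lemma opNorm_le_one_of_sum_sq (A : Matrix ι κ ℂ)
    (h : ∀ ξ : κ → ℂ, ∑ i, ‖∑ j, A i j * ξ j‖ ^ 2 ≤ ∑ j, ‖ξ j‖ ^ 2) : ‖A‖ ≤ 1 := by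
  refine opNorm_le_of_mulVec _ _ zero_le_one fun ξ => ?_
  rw [one_mul, EuclideanSpace.norm_eq, EuclideanSpace.norm_eq]
  exact Real.sqrt_le_sqrt (h ξ.ofLp)

end MatrixSpace

namespace OperatorSpaceStructure

variable {X Y : Type*} [AddCommGroup X] [Module ℂ X] [AddCommGroup Y] [Module ℂ Y]
variable (s : OperatorSpaceStructure X) (t : OperatorSpaceStructure Y)
variable {ι κ : Type} [Fintype ι] [DecidableEq ι] [Fintype κ] [DecidableEq κ]

/-- The cost on tuples in `X^ι` given by the norm of the matrix over `X` whose columns are the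
entries of the tuple. -/
noncomputable def columnsCost (ι : Type) [Fintype ι] [DecidableEq ι] : TupleCost (ι → X) where
  cost {k} _ _ v C := s.gnorm (Matrix.of fun i j => v j i : Matrix ι k X) ^ 2 ≤ C
  exists_cost v := ⟨_, le_rfl⟩
  smul {k} _ _ v C r h := by
    have e : (Matrix.of fun i j => ((r : ℂ) • v) j i : Matrix ι k X) =
        (r : ℂ) • (Matrix.of fun i j => v j i) := rfl
    rw [e, gnorm_smul, mul_pow, Complex.norm_real, Real.norm_eq_abs, sq_abs]
    exact mul_le_mul_of_nonneg_left h (sq_nonneg r)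
  mul {k l} _ _ _ _ v C U h hU := by
    have e : (Matrix.of fun i j => (∑ a, U a j • v a) i : Matrix ι l X) =
        rmul (Matrix.of fun i j => v j i) U := by
      ext i j; simp [rmul]
    rw [e]
    refine le_trans (pow_le_pow_left₀ (s.gnorm_nonneg _) ?_ 2) h
    exact (s.gnorm_rmul_le _ _).trans (mul_le_of_le_one_right (s.gnorm_nonneg _) hU)
  append {k l} _ _ _ _ v w C D h h' := by
    have e : (Matrix.of fun i j => Sum.elim v w j i : Matrix ι (k ⊕ l) X) =
        Matrix.fromCols (Matrix.of fun i j => v j i) (Matrix.of fun i j => w j i) := by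
      ext i (j | j) <;> rfl
    rw [e]
    exact (s.gnorm_fromCols _ _).trans (add_le_add h h')

/-- The cost on tuples in `X^ι` in which the matrix with columns the entries of the tuple is
factored as `α x` with `‖x‖ ≤ 1` and `α` measured by its Hilbert-Schmidt norm. -/
noncomputable def leftCost (ι : Type) [Fintype ι] [DecidableEq ι] : TupleCost (ι → X) where
  cost {k} _ _ v C := ∃ (p : Type) (_ : Fintype p) (_ : DecidableEq p) (α : Matrix ι p ℂ)
    (x : Matrix p k X), (Matrix.of fun i j => v j i) = lmul α x ∧ s.gnorm x ≤ 1 ∧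
      ∑ i, ∑ a, ‖α i a‖ ^ 2 ≤ C
  exists_cost {k} _ _ v := by
    let z : Matrix ι k X := Matrix.of fun i j => v j i
    have hz := s.gnorm_nonneg z
    refine ⟨_, ι, inferInstance, inferInstance, ((s.gnorm z + 1 : ℝ) : ℂ) • 1,
      (((s.gnorm z + 1)⁻¹ : ℝ) : ℂ) • z, ?_, ?_, le_rfl⟩
    · rw [lmul_smul_one, smul_smul, ← Complex.ofReal_mul, mul_inv_cancel₀ (by positivity),
        Complex.ofReal_one, one_smul]
    · rw [gnorm_smul, Complex.norm_real, Real.norm_of_nonneg (by positivity),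
        inv_mul_le_iff₀ (by positivity)]
      linarith
  smul {k} _ _ v C r := by
    rintro ⟨p, _, _, α, x, h, hx, hα⟩
    refine ⟨p, inferInstance, inferInstance, (r : ℂ) • α, x, ?_, hx, ?_⟩
    · rw [smul_lmul, ← h]; rfl
    · simp only [Matrix.smul_apply, smul_eq_mul, norm_mul, mul_pow, ← Finset.mul_sum,
        Complex.norm_real, Real.norm_eq_abs, sq_abs]
      exact mul_le_mul_of_nonneg_left hα (sq_nonneg r)
  mul {k l} _ _ _ _ v C U := by
    rintro ⟨p, _, _, α, x, h, hx, hα⟩ hU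
    refine ⟨p, inferInstance, inferInstance, α, rmul x U, ?_, ?_, hα⟩
    · rw [lmul_rmul, ← h]
      ext i j; simp [rmul]
    · exact (s.gnorm_rmul_le _ _).trans (mul_le_one₀ hx (_root_.norm_nonneg _) hU)
  append {k l} _ _ _ _ v w C D := by
    rintro ⟨p, _, _, α, x, h, hx, hα⟩ ⟨p', _, _, α', x', h', hx', hα'⟩
    refine ⟨p ⊕ p', inferInstance, inferInstance, Matrix.fromCols α α',
      Matrix.fromBlocks x 0 0 x', ?_, (s.gnorm_fromBlocks_le _ _).trans (max_le hx hx'), ?_⟩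
    · ext i (j | j)
      · have := congrFun (congrFun h i) j
        simpa [lmul] using this
      · have := congrFun (congrFun h' i) j
        simpa [lmul] using this
    · simp only [Fintype.sum_sum_type, Matrix.fromCols_apply_inl, Matrix.fromCols_apply_inr,
        Finset.sum_add_distrib]
      exact add_le_add hα hα'

/-- The cost on tuples in `X^ι` in which the matrix with rows the entries of the tuple is
factored as `x β` with `‖x‖ ≤ 1` and `β` measured by its Hilbert-Schmidt norm. -/
noncomputable def rightCost (ι : Type) [Fintype ι] [DecidableEq ι] : TupleCost (ι → X) where
  cost {k} _ _ v C := ∃ (p : Type) (_ : Fintype p) (_ : DecidableEq p) (x : Matrix k p X)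
    (β : Matrix p ι ℂ), (Matrix.of fun j i => v j i) = rmul x β ∧ s.gnorm x ≤ 1 ∧
      ∑ a, ∑ i, ‖β a i‖ ^ 2 ≤ C
  exists_cost {k} _ _ v := by
    let z : Matrix k ι X := Matrix.of fun j i => v j i
    have hz := s.gnorm_nonneg z
    refine ⟨_, ι, inferInstance, inferInstance, (((s.gnorm z + 1)⁻¹ : ℝ) : ℂ) • z,
      ((s.gnorm z + 1 : ℝ) : ℂ) • 1, ?_, ?_, le_rfl⟩
    · rw [smul_rmul, rmul_one, smul_smul, ← Complex.ofReal_mul, mul_inv_cancel₀ (by positivity),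
        Complex.ofReal_one, one_smul]
    · rw [gnorm_smul, Complex.norm_real, Real.norm_of_nonneg (by positivity),
        inv_mul_le_iff₀ (by positivity)]
      linarith
  smul {k} _ _ v C r := by
    rintro ⟨p, _, _, x, β, h, hx, hβ⟩
    refine ⟨p, inferInstance, inferInstance, x, (r : ℂ) • β, ?_, hx, ?_⟩
    · rw [smul_rmul, ← h]; rfl
    · simp only [Matrix.smul_apply, smul_eq_mul, norm_mul, mul_pow, ← Finset.mul_sum,
        Complex.norm_real, Real.norm_eq_abs, sq_abs]
      exact mul_le_mul_of_nonneg_left hβ (sq_nonneg r)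
  mul {k l} _ _ _ _ v C U := by
    rintro ⟨p, _, _, x, β, h, hx, hβ⟩ hU
    refine ⟨p, inferInstance, inferInstance, lmul U.transpose x, β, ?_, ?_, hβ⟩
    · rw [← lmul_rmul, ← h]
      ext i j; simp [lmul]
    · refine (s.gnorm_lmul_le _ _).trans (mul_le_one₀ ?_ (s.gnorm_nonneg _) hx)
      rwa [opNorm_transpose]
  append {k l} _ _ _ _ v w C D := by
    rintro ⟨p, _, _, x, β, h, hx, hβ⟩ ⟨p', _, _, x', β', h', hx', hβ'⟩
    refine ⟨p ⊕ p', inferInstance, inferInstance, Matrix.fromBlocks x 0 0 x',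
      Matrix.fromRows β β', ?_, (s.gnorm_fromBlocks_le _ _).trans (max_le hx hx'), ?_⟩
    · ext (j | j) i
      · have := congrFun (congrFun h j) i
        simpa [rmul] using this
      · have := congrFun (congrFun h' j) i
        simpa [rmul] using this
    · simp only [Fintype.sum_sum_type, Matrix.fromRows_apply_inl, Matrix.fromRows_apply_inr]
      exact add_le_add hβ hβ'

lemma map_pi_eq_sum {r : ℕ} (G : (ι → X) →ₗ[ℂ] (Fin r → ℂ)) (v : ι → X) (u : Fin r) :
    G v u = ∑ i, G (Pi.single i (v i)) u := by
  conv_lhs => rw [← Finset.univ_sum_single v]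
  rw [map_sum, Finset.sum_apply]

/-- The matrix of functionals on `X` given by a map `X^ι → ℂ^r`. -/
def functionals {r : ℕ} (G : (ι → X) →ₗ[ℂ] (Fin r → ℂ)) : Matrix ι (Fin r) (X →ₗ[ℂ] ℂ) :=
  Matrix.of fun i u => LinearMap.proj u ∘ₗ G ∘ₗ LinearMap.single ℂ (fun _ => X) i

lemma functionals_apply {r : ℕ} (G : (ι → X) →ₗ[ℂ] (Fin r → ℂ)) (i : ι) (u : Fin r) (x : X) :
    functionals G i u x = G (Pi.single i x) u := rfl

/-- The defining inequality of a completely contractive matrix of functionals, tested on a vector of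
`ℂ^k ⊗ ℂ^ι`, is the bound of `G` by `leftCost`. -/
lemma gnorm_functionals_le [FiniteDimensional ℂ X] {r : ℕ} (G : (ι → X) →ₗ[ℂ] (Fin r → ℂ))
    (hG : ∀ {k : Type} [Fintype k] [DecidableEq k] (v : k → ι → X) (C : ℝ),
      (s.leftCost ι).cost v C → ∑ j, ∑ u, ‖G (v j) u‖ ^ 2 ≤ C) :
    (cb s complex).gnorm (functionals G) ≤ 1 := by
  refine gnorm_cb_le _ _ _ fun k x hx => ?_
  rw [gnorm_complex, ← opNorm_transpose]
  refine opNorm_le_one_of_sum_sq _ fun ξ => ?_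
  let α : Matrix ι (Fin k) ℂ := Matrix.of fun i p => ξ (p, i)
  have h := hG (fun j i => lmul α x i j) (∑ p, ∑ i, ‖α i p‖ ^ 2)
    ⟨Fin k, inferInstance, inferInstance, α, x, rfl, hx, Finset.sum_comm.le⟩
  rw [Fintype.sum_prod_type, Fintype.sum_prod_type]
  refine le_trans (le_of_eq ?_) h
  refine Finset.sum_congr rfl fun j _ => Finset.sum_congr rfl fun u _ => ?_
  rw [map_pi_eq_sum G, Fintype.sum_prod_type, Finset.sum_comm]
  congr 2
  refine Finset.sum_congr rfl fun i _ => ?_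
  simp only [amplProd, Matrix.of_apply, Matrix.transpose_apply, functionals]
  change _ = (LinearMap.proj u ∘ₗ G ∘ₗ LinearMap.single ℂ (fun _ => X) i) (lmul α x i j)
  simp only [lmul, Matrix.of_apply, map_sum, map_smul, α, smul_eq_mul]
  exact Finset.sum_congr rfl fun p _ => mul_comm _ _

/-- The counterpart of `gnorm_functionals_le` for rows. -/
lemma gnorm_transpose_functionals_le [FiniteDimensional ℂ X] {r : ℕ}
    (G : (ι → X) →ₗ[ℂ] (Fin r → ℂ))
    (hG : ∀ {k : Type} [Fintype k] [DecidableEq k] (v : k → ι → X) (C : ℝ),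
      (s.rightCost ι).cost v C → ∑ j, ∑ u, ‖G (v j) u‖ ^ 2 ≤ C) :
    (cb s complex).gnorm (functionals G).transpose ≤ 1 := by
  refine gnorm_cb_le _ _ _ fun k x hx => ?_
  rw [gnorm_complex]
  refine opNorm_le_one_of_sum_sq _ fun ξ => ?_
  let β : Matrix (Fin k) ι ℂ := Matrix.of fun p i => ξ (p, i)
  have h := hG (fun j i => rmul x β j i) (∑ p, ∑ i, ‖β p i‖ ^ 2)
    ⟨Fin k, inferInstance, inferInstance, x, β, rfl, hx, le_rfl⟩
  rw [Fintype.sum_prod_type, Fintype.sum_prod_type]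
  refine le_trans (le_of_eq ?_) h
  refine Finset.sum_congr rfl fun j _ => Finset.sum_congr rfl fun u _ => ?_
  rw [map_pi_eq_sum G, Fintype.sum_prod_type, Finset.sum_comm]
  congr 2
  refine Finset.sum_congr rfl fun i _ => ?_
  simp only [amplProd, Matrix.of_apply, Matrix.transpose_apply, functionals]
  change _ = (LinearMap.proj u ∘ₗ G ∘ₗ LinearMap.single ℂ (fun _ => X) i) (rmul x β j i)
  simp only [rmul, Matrix.of_apply, map_sum, map_smul, β, smul_eq_mul]
  exact Finset.sum_congr rfl fun p _ => mul_comm _ _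

lemma exists_norming_functional (x : Matrix ι κ X) : ∃ F : Matrix ι κ X →ₗ[ℂ] ℂ,
    F x = s.gnorm x ∧ ∀ y, ‖F y‖ ≤ s.gnorm y := by
  let _ : Norm (Matrix ι κ X) := ⟨fun x => s.gnorm x⟩
  have core : NormedSpace.Core ℂ (Matrix ι κ X) :=
    { norm_nonneg := fun x => s.gnorm_nonneg _
      norm_smul := fun c x => s.gnorm_smul c x
      norm_triangle := fun x y => s.gnorm_add_le x y
      norm_eq_zero_iff := fun x => ⟨s.eq_zero_of_gnorm x, fun h => by
        subst h; exact s.gnorm_zero⟩ }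
  let _ : NormedAddCommGroup (Matrix ι κ X) := NormedAddCommGroup.ofCore core
  let _ : NormedSpace ℂ (Matrix ι κ X) := NormedSpace.ofCore core
  obtain ⟨g, hg, hgx⟩ := exists_dual_vector'' ℂ x
  refine ⟨g.toLinearMap, hgx, fun y => ?_⟩
  exact (g.le_opNorm y).trans (mul_le_of_le_one_left (s.gnorm_nonneg y) hg)

/-- Ruan's theorem in dual form: the norms on an operator space are detected by matrices of
functionals of cb-norm at most one.
A norming functional of `M_{ι,κ}(X)` is regarded as a trilinear form on `ℂ^ι`, `X` and `ℂ^κ`,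
which is factored twice. -/
theorem exists_functionals_gnorm_le [FiniteDimensional ℂ X] (x : Matrix ι κ X) :
    ∃ (p q : ℕ) (φ : Matrix (Fin p) (Fin q) (X →ₗ[ℂ] ℂ)), (cb s complex).gnorm φ ≤ 1 ∧
      s.gnorm x ≤ ‖amplProd φ x‖ := by
  obtain ⟨F, hFx, hF⟩ := s.exists_norming_functional x
  -- First split off `ℂ^κ`: this gives a map `G : ℂ^ι ⊗ X → ℂ^q`.
  let F₁ : (ι → X) →ₗ[ℂ] (κ → ℂ) →ₗ[ℂ] ℂ := LinearMap.mk₂ ℂ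
    (fun v w => F (Matrix.of fun i j => w j • v i))
    (fun v v' w => by rw [← map_add]; congr 1; ext i j; simp)
    (fun c v w => by rw [← map_smul]; congr 1; ext i j; simp [smul_comm c])
    (fun v w w' => by rw [← map_add]; congr 1; ext i j; simp [add_smul])
    (fun c v w => by rw [← map_smul]; congr 1; ext i j; simp [smul_smul])
  obtain ⟨q, G, H, hGH, hG, hH⟩ := TupleCost.exists_factorization (s.columnsCost ι)
    (complex.columnsCost κ) F₁ (by
      intro k _ _ v w C D hv hw
      let V : Matrix ι k X := Matrix.of fun i j => v j i
      let W : Matrix κ k ℂ := Matrix.of fun i j => w j i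
      have e : ∑ a, F₁ (v a) (w a) = F (rmul V W.transpose) := by
        simp only [F₁, LinearMap.mk₂_apply]
        rw [← map_sum]
        congr 1
        ext i j; simp [rmul, Matrix.sum_apply, V, W]
      rw [e]
      have h1 := (Complex.re_le_norm _).trans ((hF (rmul V W.transpose)).trans
        (s.gnorm_rmul_le V W.transpose))
      rw [opNorm_transpose] at h1
      have h2 : s.gnorm V ^ 2 ≤ C := hv
      have h3 : complex.gnorm W ^ 2 ≤ D := hw
      rw [gnorm_complex] at h3
      nlinarith [sq_nonneg (s.gnorm V - ‖W‖)])
  -- Then regard `G` as a bilinear form on `ℂ^ι × (ℂ^q ⊗ X)` and split off `ℂ^ι`.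
  let F₂ : (ι → ℂ) →ₗ[ℂ] (Fin q → X) →ₗ[ℂ] ℂ := LinearMap.mk₂ ℂ
    (fun ξ z => ∑ u, G (fun i => ξ i • z u) u)
    (fun ξ ξ' z => by
      rw [← Finset.sum_add_distrib]
      refine Finset.sum_congr rfl fun u _ => ?_
      rw [← Pi.add_apply (G _), ← map_add]
      refine congrFun (congrArg G ?_) u; ext i; simp [add_smul])
    (fun c ξ z => by
      rw [Finset.smul_sum]
      refine Finset.sum_congr rfl fun u _ => ?_
      rw [← Pi.smul_apply c (G _), ← map_smul]
      refine congrFun (congrArg G ?_) u; ext i; simp [smul_smul])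
    (fun ξ z z' => by
      rw [← Finset.sum_add_distrib]
      refine Finset.sum_congr rfl fun u _ => ?_
      rw [← Pi.add_apply (G _), ← map_add]
      refine congrFun (congrArg G ?_) u; ext i; simp)
    (fun c ξ z => by
      rw [Finset.smul_sum]
      refine Finset.sum_congr rfl fun u _ => ?_
      rw [← Pi.smul_apply c (G _), ← map_smul]
      refine congrFun (congrArg G ?_) u; ext i; simp [smul_comm c])
  obtain ⟨p, A, B, hAB, hA, hB⟩ := TupleCost.exists_factorization (complex.columnsCost ι)
    (s.rightCost (Fin q)) F₂ (by
      rintro k _ _ ξ z C D hξ ⟨l, _, _, y, β, hz, hy, hβ⟩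
      let Ξ : Matrix ι k ℂ := Matrix.of fun i j => ξ j i
      have h1 : ‖Ξ‖ ^ 2 ≤ C := by
        have : complex.gnorm Ξ ^ 2 ≤ C := hξ
        rwa [gnorm_complex] at this
      have h2 : ∑ a, ∑ u, ‖G (fun i => lmul Ξ y i a) u‖ ^ 2 ≤ C := by
        refine hG (fun a i => lmul Ξ y i a) C
          (le_trans (pow_le_pow_left₀ (s.gnorm_nonneg _) ?_ 2) h1)
        exact (s.gnorm_lmul_le Ξ y).trans (mul_le_of_le_one_right (_root_.norm_nonneg _) hy)
      have hz' : ∀ j u, z j u = ∑ a, β a u • y j a := fun j u => congrFun (congrFun hz j) u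
      have e : ∑ j, F₂ (ξ j) (z j) = ∑ a, ∑ u, β a u * G (fun i => lmul Ξ y i a) u := by
        have e1 : ∀ u, ∑ j, G (fun i => ξ j i • z j u) u =
            ∑ a, β a u * G (fun i => lmul Ξ y i a) u := by
          intro u
          have e2 : ∑ j, (fun i => ξ j i • z j u) = ∑ a, β a u • (fun i => lmul Ξ y i a) := by
            ext i
            simp only [Finset.sum_apply, hz', Pi.smul_apply, lmul, Matrix.of_apply, Ξ,
              Finset.smul_sum]
            rw [Finset.sum_comm]
            exact Finset.sum_congr rfl fun a _ => Finset.sum_congr rfl fun j _ => smul_comm _ _ _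
          rw [← Finset.sum_apply u Finset.univ (fun j => G (fun i => ξ j i • z j u)), ← map_sum, e2,
            map_sum, Finset.sum_apply]
          simp
        simp only [F₂, LinearMap.mk₂_apply]
        rw [Finset.sum_comm]
        simp only [e1]
        rw [Finset.sum_comm]
      rw [e, Complex.re_sum, Finset.mul_sum]
      have h3 : ∀ a, 2 * (∑ u, β a u * G (fun i => lmul Ξ y i a) u).re ≤
          ∑ u, ‖β a u‖ ^ 2 + ∑ u, ‖G (fun i => lmul Ξ y i a) u‖ ^ 2 := by
        intro a
        rw [Complex.re_sum, Finset.mul_sum, ← Finset.sum_add_distrib]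
        exact Finset.sum_le_sum fun u _ => two_mul_re_mul_le _ _
      refine (Finset.sum_le_sum fun a _ => h3 a).trans ?_
      rw [Finset.sum_add_distrib, add_comm]
      exact add_le_add h2 hβ)
  refine ⟨p, q, (functionals B).transpose, s.gnorm_transpose_functionals_le B hB, ?_⟩
  have hA1 : ∑ i, ∑ u, ‖A (Pi.single i 1) u‖ ^ 2 ≤ 1 := by
    refine hA (fun i => Pi.single i 1) 1 ?_
    have e : (Matrix.of fun i j => (Pi.single j (1 : ℂ) : ι → ℂ) i : Matrix ι ι ℂ) = 1 := by
      ext i j; simp [Pi.single_apply, Matrix.one_apply]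
    change complex.gnorm
      (Matrix.of fun i j => (Pi.single j (1 : ℂ) : ι → ℂ) i : Matrix ι ι ℂ) ^ 2 ≤ 1
    rw [e, gnorm_complex]
    exact pow_le_one₀ (_root_.norm_nonneg _) opNorm_one_le
  have hH1 : ∑ j, ∑ u, ‖H (Pi.single j 1) u‖ ^ 2 ≤ 1 := by
    refine hH (fun i => Pi.single i 1) 1 ?_
    have e : (Matrix.of fun i j => (Pi.single j (1 : ℂ) : κ → ℂ) i : Matrix κ κ ℂ) = 1 := by
      ext i j; simp [Pi.single_apply, Matrix.one_apply]
    change complex.gnorm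
      (Matrix.of fun i j => (Pi.single j (1 : ℂ) : κ → ℂ) i : Matrix κ κ ℂ) ^ 2 ≤ 1
    rw [e, gnorm_complex]
    exact pow_le_one₀ (_root_.norm_nonneg _) opNorm_one_le
  -- The families `A e_i` and `H e_j` are vectors of `ℂ^ι ⊗ ℂ^p` and `ℂ^κ ⊗ ℂ^q` of norm at most one
  -- (`hA1`, `hH1`), and the form of the matrix `amplProd φ x` takes the value `F x` at them (`key`).
  have hG2 : ∀ i y u, G (Pi.single i y) u =
      ∑ a, A (Pi.single i 1) a * functionals B u a y := by
    intro i y u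
    have h1 := hAB (Pi.single i 1) (Pi.single u y)
    rw [show (∑ a, A (Pi.single i 1) a * functionals B u a y) =
      F₂ (Pi.single i 1) (Pi.single u y) from h1.symm]
    simp only [F₂, LinearMap.mk₂_apply]
    rw [Finset.sum_eq_single u]
    · refine congrFun (congrArg G ?_) u
      ext j
      by_cases h : j = i
      · subst h; simp
      · simp [h]
    · intro u' _ hu
      have : (fun j => (Pi.single i (1 : ℂ) : ι → ℂ) j • (Pi.single u y : Fin q → X) u') = 0 := by
        ext j; simp [hu]
      rw [this, map_zero, Pi.zero_apply]
    · simp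
  have key : F x = ∑ c : ι × Fin p, ∑ d : κ × Fin q,
      A (Pi.single c.1 1) c.2 * amplProd (functionals B).transpose x c d *
        H (Pi.single d.1 1) d.2 := by
    have h1 : x = ∑ j, Matrix.of fun i j' => (Pi.single j (1 : ℂ) : κ → ℂ) j' • x i j := by
      ext i j
      simp [Matrix.sum_apply, Pi.single_apply]
    have h2 : F x = ∑ j, F₁ (fun i => x i j) (Pi.single j 1) := by
      conv_lhs => rw [h1]
      rw [map_sum]
      rfl
    rw [h2]
    simp only [hGH, Fintype.sum_prod_type]
    have h3 : ∀ j u, G (fun i => x i j) u =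
        ∑ i, ∑ a, A (Pi.single i 1) a * functionals B u a (x i j) := by
      intro j u
      rw [map_pi_eq_sum G]
      exact Finset.sum_congr rfl fun i _ => hG2 i (x i j) u
    simp only [h3, Finset.sum_mul]
    rw [sum_sum_comm]
    rfl
  have h4 := norm_bilinear_sum_le (amplProd (functionals B).transpose x)
    (fun c : ι × Fin p => A (Pi.single c.1 1) c.2) (fun d : κ × Fin q => H (Pi.single d.1 1) d.2)
  rw [← key, hFx, Complex.norm_real, Real.norm_of_nonneg (s.gnorm_nonneg x),
    Fintype.sum_prod_type, Fintype.sum_prod_type] at h4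
  refine h4.trans (mul_le_of_le_one_right (_root_.norm_nonneg _) ?_)
  exact mul_le_one₀ (Real.sqrt_le_one.2 hA1) (Real.sqrt_nonneg _) (Real.sqrt_le_one.2 hH1)

/-- The Christensen–Sinclair factorization: completely contractive matrices of functionals on
`X ⊗_h Y` factor as `f(x ⊗ y) = g(x) h(y)` with completely contractive `g` and `h`. -/
theorem exists_bilinear_factorization [FiniteDimensional ℂ X] [FiniteDimensional ℂ Y]
    (f : Matrix ι κ (X ⊗[ℂ] Y →ₗ[ℂ] ℂ)) (hf : (cb (haagerup s t) complex).gnorm f ≤ 1) :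
    ∃ (r : ℕ) (g : Matrix ι (Fin r) (X →ₗ[ℂ] ℂ)) (h : Matrix (Fin r) κ (Y →ₗ[ℂ] ℂ)),
      (cb s complex).gnorm g ≤ 1 ∧ (cb t complex).gnorm h ≤ 1 ∧
      ∀ i j x y, f i j (x ⊗ₜ[ℂ] y) = ∑ u, g i u x * h u j y := by
  let F : (ι → X) →ₗ[ℂ] (κ → Y) →ₗ[ℂ] ℂ := LinearMap.mk₂ ℂ
    (fun v w => ∑ i, ∑ j, f i j (v i ⊗ₜ[ℂ] w j))
    (fun v v' w => by simp [TensorProduct.add_tmul, Finset.sum_add_distrib])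
    (fun c v w => by simp [← TensorProduct.smul_tmul', Finset.mul_sum])
    (fun v w w' => by simp [TensorProduct.tmul_add, Finset.sum_add_distrib])
    (fun c v w => by simp [Finset.mul_sum])
  obtain ⟨r, G, H, hGH, hG, hH⟩ := TupleCost.exists_factorization (s.leftCost ι) (t.rightCost κ) F
    (by
      rintro k _ _ v w C D ⟨p, _, _, α, x, hv, hx, hα⟩ ⟨q, _, _, y, β, hw, hy, hβ⟩
      have hv' : ∀ j i, v j i = ∑ a, α i a • x a j := fun j i => congrFun (congrFun hv i) j
      have hw' : ∀ j i, w j i = ∑ b, β b i • y j b := fun j i => congrFun (congrFun hw j) i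
      have e : ∑ j, F (v j) (w j) = ∑ c : p × ι, ∑ d : q × κ,
          α c.2 c.1 * amplProd f (odot x y) c d * β d.1 d.2 := by
        simp only [F, LinearMap.mk₂_apply, hv', hw', amplProd, odot, Matrix.of_apply, map_sum,
          Finset.mul_sum, Finset.sum_mul, TensorProduct.sum_tmul, TensorProduct.tmul_sum,
          ← TensorProduct.smul_tmul', TensorProduct.tmul_smul, map_smul, smul_eq_mul,
          Fintype.sum_prod_type]
        have h := Fintype.sum_equiv
          (⟨fun z => (z.2.2.2.2, z.2.1, z.2.2.2.1, z.2.2.1, z.1),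
            fun z => (z.2.2.2.2, z.2.1, z.2.2.2.1, z.2.2.1, z.1), fun _ => rfl, fun _ => rfl⟩ :
            k × ι × κ × q × p ≃ p × ι × q × κ × k)
          (fun z => β z.2.2.2.1 z.2.2.1 * (α z.2.1 z.2.2.2.2 *
            f z.2.1 z.2.2.1 (x z.2.2.2.2 z.1 ⊗ₜ[ℂ] y z.1 z.2.2.2.1)))
          (fun z => α z.2.1 z.1 * f z.2.1 z.2.2.2.1 (x z.1 z.2.2.2.2 ⊗ₜ[ℂ] y z.2.2.2.2 z.2.2.1) *
            β z.2.2.1 z.2.2.2.1) (fun z => by simp only [Equiv.coe_fn_mk]; ring)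
        simpa only [Fintype.sum_prod_type] using h
      have h1 := norm_bilinear_sum_le (amplProd f (odot x y)) (fun c : p × ι => α c.2 c.1)
        (fun d : q × κ => β d.1 d.2)
      rw [← e] at h1
      have h2 : ‖amplProd f (odot x y)‖ ≤ 1 := by
        rw [← gnorm_complex]
        refine (gnorm_amplProd_le (haagerup s t) complex f (odot x y)).trans ?_
        refine mul_le_one₀ hf (gnorm_nonneg _ _) ((gnorm_odot_le s t x y).trans ?_)
        exact mul_le_one₀ hx (t.gnorm_nonneg _) hy
      have h3 : ∑ c : p × ι, ‖α c.2 c.1‖ ^ 2 ≤ C := by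
        rw [Fintype.sum_prod_type, Finset.sum_comm]; exact hα
      have h4 : ∑ d : q × κ, ‖β d.1 d.2‖ ^ 2 ≤ D := by
        rw [Fintype.sum_prod_type]; exact hβ
      have h5 := (Complex.re_le_norm _).trans (h1.trans
        (mul_le_of_le_one_left (by positivity) h2))
      have h6 := Real.sq_sqrt (show 0 ≤ ∑ c : p × ι, ‖α c.2 c.1‖ ^ 2 by positivity)
      have h7 := Real.sq_sqrt (show 0 ≤ ∑ d : q × κ, ‖β d.1 d.2‖ ^ 2 by positivity)
      nlinarith [sq_nonneg (√(∑ c : p × ι, ‖α c.2 c.1‖ ^ 2) - √(∑ d : q × κ, ‖β d.1 d.2‖ ^ 2))])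
  refine ⟨r, functionals G, (functionals H).transpose, s.gnorm_functionals_le G hG,
    t.gnorm_transpose_functionals_le H hH, fun i j x y => ?_⟩
  have h := hGH (Pi.single i x) (Pi.single j y)
  simp only [F, LinearMap.mk₂_apply] at h
  rw [Finset.sum_eq_single i, Finset.sum_eq_single j] at h
  · simpa [functionals_apply] using h
  · intro j' _ hj; simp [hj]
  · simp
  · intro i' _ hi; simp [hi]
  · simp

end OperatorSpaceStructure

/-! ### The completely injective tensor product and duality -/

namespace OperatorSpaceStructure

variable {X Y Z W : Type*} [AddCommGroup X] [Module ℂ X] [AddCommGroup Y] [Module ℂ Y]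
  [AddCommGroup Z] [Module ℂ Z] [AddCommGroup W] [Module ℂ W]
  [FiniteDimensional ℂ X] [FiniteDimensional ℂ Y] [FiniteDimensional ℂ Z]
  [FiniteDimensional ℂ W]
variable (s : OperatorSpaceStructure X) (t : OperatorSpaceStructure Y)
  (u : OperatorSpaceStructure Z) (r : OperatorSpaceStructure W)
variable {ι κ : Type} [Fintype ι] [DecidableEq ι] [Fintype κ] [DecidableEq κ]

lemma gnorm_comap (φ : X →ₗ[ℂ] Y) (hφ : Function.Injective φ) (x : Matrix ι κ X) :
    (comap φ hφ t).gnorm x = t.gnorm (x.map φ) := by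
  obtain ⟨N, f, g, z, hf, hg, hx, hz, hz'⟩ := (comap φ hφ t).exists_square x
  rw [← hz]
  change t.norm N (z.map φ) = _
  rw [← gnorm_fin]
  apply le_antisymm
  · rw [hz', map_lmul, map_rmul]
    refine (t.gnorm_mul_le _ _ _).trans ?_
    have h1 := opNorm_incl hf
    have h2 := opNorm_transpose_incl hg
    have h3 := t.gnorm_nonneg (x.map φ)
    calc _ ≤ 1 * t.gnorm (x.map φ) * 1 := by gcongr
      _ = _ := by ring
  · rw [hx]
    exact t.gnorm_submatrix_le hf hg (z.map φ)

lemma gnorm_injTensor (v : Matrix ι κ (X ⊗[ℂ] Y)) :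
    (injTensor s t).gnorm v = (cb (dual t) s).gnorm (v.map (tensorToHom X Y)) :=
  gnorm_comap (cb (dual t) s) _ _ v

/-- The canonical map into the bidual is a complete isometry. -/
lemma gnorm_le_gnorm_eval (x : Matrix ι κ X) :
    s.gnorm x ≤ (dual (dual s)).gnorm (x.map (Module.Dual.eval ℂ X)) := by
  obtain ⟨p, q, φ, hφ, hx⟩ := s.exists_functionals_gnorm_le x
  have e := complex.gnorm_submatrix_equiv (Equiv.prodComm ι (Fin p)) (Equiv.prodComm κ (Fin q))
    (amplProd (x.map (Module.Dual.eval ℂ X)) φ)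
  have e' : (amplProd (x.map (Module.Dual.eval ℂ X)) φ).submatrix (Equiv.prodComm ι (Fin p))
    (Equiv.prodComm κ (Fin q)) = amplProd φ x := rfl
  rw [e', gnorm_complex] at e
  rw [e] at hx
  refine hx.trans ((gnorm_amplProd_le (dual s) complex _ φ).trans ?_)
  exact mul_le_of_le_one_right (gnorm_nonneg _ _) hφ

/-- A matrix of linear maps `Y* → X` and the matrix of the transposed maps `X* → Y` have the same
norm; by symmetry it suffices to prove an inequality. -/
lemma gnorm_cb_transpose_le (T : Matrix ι κ ((Y →ₗ[ℂ] ℂ) →ₗ[ℂ] X))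
    (S : Matrix ι κ ((X →ₗ[ℂ] ℂ) →ₗ[ℂ] Y))
    (h : ∀ i j (φ : X →ₗ[ℂ] ℂ) (ψ : Y →ₗ[ℂ] ℂ), ψ (S i j φ) = φ (T i j ψ)) :
    (cb (dual s) t).gnorm S ≤ (cb (dual t) s).gnorm T := by
  refine gnorm_cb_le _ _ _ fun k f hf => ?_
  obtain ⟨p, q, φ, hφ, hy⟩ := t.exists_functionals_gnorm_le (amplProd S f)
  let e : ∀ ι : Type, ∀ p : ℕ, (Fin k × ι) × Fin p ≃ (Fin p × ι) × Fin k := fun ι p =>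
    ⟨fun z => ((z.2, z.1.2), z.1.1), fun z => ((z.2, z.1.2), z.1.1), fun _ => rfl, fun _ => rfl⟩
  have h1 := complex.gnorm_submatrix_equiv (e ι p) (e κ q) (amplProd f (amplProd T φ))
  have h2 : (amplProd f (amplProd T φ)).submatrix (e ι p) (e κ q) = amplProd φ (amplProd S f) := by
    ext ⟨⟨a, i⟩, b⟩ ⟨⟨c, j⟩, d⟩
    exact (h i j (f a c) (φ b d)).symm
  rw [h2, gnorm_complex] at h1
  rw [h1] at hy
  refine hy.trans ((gnorm_amplProd_le s complex f (amplProd T φ)).trans ?_)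
  refine (mul_le_of_le_one_left (gnorm_nonneg _ _) hf).trans ?_
  refine (gnorm_amplProd_le (dual t) s T φ).trans ?_
  exact mul_le_of_le_one_right (gnorm_nonneg _ _) hφ

lemma apply_tensorToHom_comm (v : X ⊗[ℂ] Y) (φ : X →ₗ[ℂ] ℂ) (ψ : Y →ₗ[ℂ] ℂ) :
    ψ (tensorToHom Y X (TensorProduct.comm ℂ X Y v) φ) = φ (tensorToHom X Y v ψ) := by
  induction v using TensorProduct.induction_on with
  | zero => simp
  | tmul x y => simp [tensorToHom_tmul, mul_comm]
  | add v w hv hw => simp [hv, hw]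

/-- The injective norm, defined by slicing with functionals on the second factor, can equally be
computed by slicing with functionals on the first. -/
lemma gnorm_cb_tensorToHom_comm (v : Matrix ι κ (X ⊗[ℂ] Y)) :
    (cb (dual s) t).gnorm (v.map (tensorToHom Y X ∘ₗ (TensorProduct.comm ℂ X Y).toLinearMap)) =
      (injTensor s t).gnorm v := by
  rw [gnorm_injTensor]
  apply le_antisymm
  · exact gnorm_cb_transpose_le s t _ _ fun i j φ ψ => apply_tensorToHom_comm (v i j) φ ψ
  · exact gnorm_cb_transpose_le t s _ _ fun i j φ ψ => (apply_tensorToHom_comm (v i j) ψ φ).symm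

/-- Every linear map from `X*` to `Y` comes from a tensor, by finite-dimensionality. -/
lemma tensorToHom_comm_surjective : Function.Surjective
    (tensorToHom Y X ∘ₗ (TensorProduct.comm ℂ X Y).toLinearMap) := by
  intro T
  let b := Module.finBasis ℂ X
  refine ⟨∑ c, b c ⊗ₜ[ℂ] T (b.coord c), ?_⟩
  ext φ
  have hφ : φ = ∑ c, φ (b c) • b.coord c := by
    refine b.ext fun i => ?_
    simp
  simp only [map_sum, LinearMap.sum_apply, LinearMap.comp_apply, LinearEquiv.coe_coe,
    TensorProduct.comm_tmul, tensorToHom_tmul]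
  conv_rhs => rw [hφ, map_sum]
  exact Finset.sum_congr rfl fun c _ => (map_smul T _ _).symm

/-- If a functional on `Y ⊗ W` is given by a sum of products of functionals, then so is its slice
of a shuffled tensor. -/
lemma tensorToHom_shuffle {ρ : Type} [Fintype ρ] (f : Y ⊗[ℂ] W →ₗ[ℂ] ℂ) (g : ρ → Y →ₗ[ℂ] ℂ)
    (h : ρ → W →ₗ[ℂ] ℂ) (hf : ∀ y w, f (y ⊗ₜ[ℂ] w) = ∑ a, g a y * h a w)
    (p : X ⊗[ℂ] Y) (q : Z ⊗[ℂ] W) :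
    tensorToHom (X ⊗[ℂ] Z) (Y ⊗[ℂ] W)
      (TensorProduct.tensorTensorTensorComm ℂ X Y Z W (p ⊗ₜ[ℂ] q)) f =
      ∑ a, tensorToHom X Y p (g a) ⊗ₜ[ℂ] tensorToHom Z W q (h a) := by
  induction p using TensorProduct.induction_on with
  | zero => simp
  | add p p' hp hp' => simp [TensorProduct.add_tmul, hp, hp', Finset.sum_add_distrib]
  | tmul x y =>
    induction q using TensorProduct.induction_on with
    | zero => simp
    | add q q' hq hq' => simp [TensorProduct.tmul_add, hq, hq', Finset.sum_add_distrib]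
    | tmul z w =>
      simp only [TensorProduct.tensorTensorTensorComm_tmul, tensorToHom_tmul, hf,
        TensorProduct.smul_tmul_smul, Finset.sum_smul]

/-- The shuffle `v` is completely contractive: the slice of `v(x ⊙ y)` by a matrix of functionals
`f = g ⊙ h` on the Haagerup tensor product is the product of the slice of `x` by `g` and the slice
of `y` by `h`. -/
lemma shuffle_haagerup_injTensor :
    IsCompleteContraction (haagerup (injTensor s t) (injTensor u r))
      (injTensor (haagerup s u) (haagerup t r))
      (TensorProduct.tensorTensorTensorComm ℂ X Y Z W).toLinearMap := by
  refine isCompleteContraction_haagerup _ _ _ fun n m x y => ?_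
  rw [gnorm_injTensor, gnorm_injTensor, gnorm_injTensor]
  refine gnorm_cb_le _ _ _ fun k f hf => ?_
  obtain ⟨l, g, h, hg, hh, hfgh⟩ := exists_bilinear_factorization t r f hf
  have e : amplProd (((odot x y).map
      (TensorProduct.tensorTensorTensorComm ℂ X Y Z W).toLinearMap).map
        (tensorToHom (X ⊗[ℂ] Z) (Y ⊗[ℂ] W))) f =
      odot (amplProd (x.map (tensorToHom X Y)) g) (amplProd (y.map (tensorToHom Z W)) h) := by
    ext ⟨a, i⟩ ⟨b, j⟩
    simp only [amplProd, odot, Matrix.map_apply, Matrix.of_apply, map_sum, LinearMap.sum_apply,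
      Fintype.sum_prod_type, LinearEquiv.coe_coe]
    rw [Finset.sum_comm]
    refine Finset.sum_congr rfl fun c _ => ?_
    exact tensorToHom_shuffle (f a b) (fun u => g a u) (fun u => h u b) (hfgh a b) (x i c) (y c j)
  rw [e]
  refine (gnorm_odot_le _ _ _ _).trans (mul_le_mul ?_ ?_ (gnorm_nonneg _ _) (gnorm_nonneg _ _))
  · exact (gnorm_amplProd_le (dual t) s _ g).trans (mul_le_of_le_one_right (gnorm_nonneg _ _) hg)
  · exact (gnorm_amplProd_le (dual r) u _ h).trans (mul_le_of_le_one_right (gnorm_nonneg _ _) hh)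

end OperatorSpaceStructure

/-! ### The category of finite-dimensional operator spaces -/

namespace FdOS

open OperatorSpaceStructure

lemma isStarAutonomous : IsStarAutonomous FdOS (monoidal isMonoidalTensor_proj)
    (symmetric isMonoidalTensor_proj isSymmetricTensor_proj)
    (closed isMonoidalTensor_proj isClosedTensor_proj) unit := by
  intro A
  let e := Module.evalEquiv ℂ A
  have he : IsCompleteContraction (dual (dual A)).oss A.oss e.symm.toLinearMap := by
    intro n x
    rw [← gnorm_fin, ← gnorm_fin]
    refine (gnorm_le_gnorm_eval A.oss (x.map e.symm.toLinearMap)).trans (le_of_eq ?_)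
    refine congrArg (gnorm (cb (cb A.oss complex) complex)) ?_
    exact Matrix.ext fun i j => e.apply_symm_apply (x i j)
  -- The inverse of the bidual map is completely contractive as matricial functionals are norming.
  let inv : dual (dual A) ⟶ A := ⟨e.symm.toLinearMap, he⟩
  refine ⟨inv, ?_, ?_⟩
  · refine hom_ext (LinearMap.ext fun a => ?_)
    exact e.symm_apply_apply a
  · refine hom_ext (LinearMap.ext fun a => ?_)
    exact e.apply_symm_apply a

/-- The weak interchange, as a morphism of operator spaces. -/
noncomputable def interchange (A B C D : FdOS) :
    tensor proj (tensor haagerup A B) (tensor haagerup C D) ⟶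
      tensor haagerup (tensor proj A C) (tensor proj B D) :=
  ⟨shuffle A B C D, shuffle_proj_haagerup A.oss B.oss C.oss D.oss⟩

lemma tensor_ext_six {A B C D E F M : Type*} [AddCommGroup A] [Module ℂ A] [AddCommGroup B]
    [Module ℂ B] [AddCommGroup C] [Module ℂ C] [AddCommGroup D] [Module ℂ D] [AddCommGroup E]
    [Module ℂ E] [AddCommGroup F] [Module ℂ F] [AddCommGroup M] [Module ℂ M]
    {f g : ((A ⊗[ℂ] B) ⊗[ℂ] (C ⊗[ℂ] D)) ⊗[ℂ] (E ⊗[ℂ] F) →ₗ[ℂ] M}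
    (h : ∀ a b c d e k, f (((a ⊗ₜ b) ⊗ₜ (c ⊗ₜ d)) ⊗ₜ (e ⊗ₜ k)) =
      g (((a ⊗ₜ b) ⊗ₜ (c ⊗ₜ d)) ⊗ₜ (e ⊗ₜ k))) : f = g := by
  ext a b c d e k
  exact h a b c d e k

lemma tensor_ext_six' {A B C D E F M : Type*} [AddCommGroup A] [Module ℂ A] [AddCommGroup B]
    [Module ℂ B] [AddCommGroup C] [Module ℂ C] [AddCommGroup D] [Module ℂ D] [AddCommGroup E]
    [Module ℂ E] [AddCommGroup F] [Module ℂ F] [AddCommGroup M] [Module ℂ M]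
    {f g : ((A ⊗[ℂ] B) ⊗[ℂ] C) ⊗[ℂ] ((D ⊗[ℂ] E) ⊗[ℂ] F) →ₗ[ℂ] M}
    (h : ∀ a b c d e k, f (((a ⊗ₜ b) ⊗ₜ c) ⊗ₜ ((d ⊗ₜ e) ⊗ₜ k)) =
      g (((a ⊗ₜ b) ⊗ₜ c) ⊗ₜ ((d ⊗ₜ e) ⊗ₜ k))) : f = g := by
  ext a b c d e k
  exact h a b c d e k

/-- The Haagerup tensor product is normal duoidal to the completely projective one. All coherence
conditions can be checked on elementary tensors. -/
noncomputable def normalDuoidal : NormalDuoidal (monoidal isMonoidalTensor_proj)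
    (monoidal isMonoidalTensor_haagerup) where
  w := interchange
  w_natural f g h k := hom_ext (TensorProduct.ext_fourfold' fun a b c d => rfl)
  i := Iso.refl unit
  δ := ⟨(TensorProduct.lid ℂ ℂ).symm.toLinearMap, isMonoidalTensor_haagerup.lid_symm unit⟩
  μ := ⟨(TensorProduct.lid ℂ ℂ).toLinearMap, isMonoidalTensor_proj.lid unit⟩
  w_assoc_tensor A B C D E F := hom_ext (tensor_ext_six fun a b c d e k => rfl)
  w_assoc_seq A B C D E F := hom_ext (tensor_ext_six' fun a b c d e k => rfl)
  w_unit_tensor_left A B := hom_ext (TensorProduct.ext' fun a b => rfl)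
  w_unit_tensor_right A B := hom_ext (TensorProduct.ext' fun a b => rfl)
  w_unit_seq_left A B := hom_ext (TensorProduct.ext' fun a b =>
    congrArg (fun z : ℂ => z ⊗ₜ[ℂ] (a ⊗ₜ[ℂ] b)) (one_smul ℂ (1 : ℂ)))
  w_unit_seq_right A B := hom_ext (TensorProduct.ext' fun a b =>
    congrArg (fun z : ℂ => (a ⊗ₜ[ℂ] b) ⊗ₜ[ℂ] z) (one_smul ℂ (1 : ℂ)))
  δ_counit_left := hom_ext (LinearMap.ext fun (a : ℂ) => one_smul ℂ a)
  δ_counit_right := hom_ext (LinearMap.ext fun (a : ℂ) => mul_one a)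
  δ_coassoc := hom_ext (LinearMap.ext fun (a : ℂ) => rfl)
  μ_unit_left := hom_ext (TensorProduct.ext' fun (a b : ℂ) => rfl)
  μ_unit_right := hom_ext (TensorProduct.ext' fun (a b : ℂ) => mul_comm a b)
  μ_assoc := hom_ext (TensorProduct.ext_threefold fun (a b c : ℂ) => mul_assoc a b c)

end FdOS

theorem mainTheorem2 :
    ∃ (hP : FdOS.IsMonoidalTensor FdOS.proj) (hS : FdOS.IsSymmetricTensor FdOS.proj)
      (hC : FdOS.IsClosedTensor FdOS.proj) (hH : FdOS.IsMonoidalTensor FdOS.haagerup),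
      (∃ V : BVCategoryWithNegation FdOS (FdOS.monoidal hP) (FdOS.symmetric hP hS)
          (FdOS.closed hP hC) FdOS.unit (FdOS.monoidal hH),
        (∀ A B C D : FdOS, (V.w A B C D).toLin = FdOS.shuffle A B C D) ∧
        V.i.hom.toLin = LinearMap.id) ∧
      (∀ A B C D : FdOS, IsCompleteContraction
        (FdOS.tensor FdOS.haagerup (FdOS.tensor FdOS.inj A B) (FdOS.tensor FdOS.inj C D)).oss
        (FdOS.tensor FdOS.inj (FdOS.tensor FdOS.haagerup A C) (FdOS.tensor FdOS.haagerup B D)).oss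
        (FdOS.shuffle A B C D)) ∧
      (∀ A B : FdOS, IsCompletelyIsometricIso (FdOS.tensor FdOS.inj A B).oss
        (FdOS.hom (FdOS.dual A) B).oss (FdOS.parLin A B)) := by
  refine ⟨FdOS.isMonoidalTensor_proj, FdOS.isSymmetricTensor_proj, FdOS.isClosedTensor_proj,
    FdOS.isMonoidalTensor_haagerup, ⟨{ FdOS.normalDuoidal with
      starAutonomous := FdOS.isStarAutonomous
      w_symm := fun A B C D => FdOS.hom_ext (TensorProduct.ext_fourfold' fun a b c d => rfl) },
      fun _ _ _ _ => rfl, rfl⟩,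
    fun A B C D => OperatorSpaceStructure.shuffle_haagerup_injTensor A.oss B.oss C.oss D.oss,
    fun A B => ⟨OperatorSpaceStructure.tensorToHom_comm_surjective, fun n x => ?_⟩⟩
  rw [← OperatorSpaceStructure.gnorm_fin, ← OperatorSpaceStructure.gnorm_fin]
  exact OperatorSpaceStructure.gnorm_cb_tensorToHom_comm A.oss B.oss x
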